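/- Let $m$ be Lebesgue measure on $[0,1]$. Let $T:[0,1]\to[0,1]$ be piecewise expanding: there is a finite set $D\subset[0,1]$ containing $0$ and $1$ such that $T$ is $C^2$ on each component of $[0,1]\setminus D$, $\int_0^1 |T''|/(T')^2\,dx<\infty$ and $\inf_{[0,1]\setminus D}|T'|>2$. Let $T$ be topologically mixing off its singular set: for all nonempty relatively open $U,V\subset[0,1]$ there is $n_0$ such that for every $n\ge n_0$ some $x\in U$ satisfies $x,Tx,\dots,T^{n-1}x\notin D$ and $T^nx\in V$. Let $Lf(x)=\sum_{y\in T^{-1}(x)} f(y)/|T'(y)|$ be the transfer operator on $L^1[0,1]$. For $k\ge1$ put $\delta=1/k$, let $I_1,\dots,I_k$ be the partition of $[0,1]$ into consecutive intervals of length $\delta$, let $\mathbf E_\delta$ be the conditional expectation on this partition, $L_\delta=\mathbf E_\delta L\,\mathbf E_\delta$ the Ulam operator, and $P_k=(P_{ij})$ with $P_{ij}=m(T^{-1}(I_j)\cap I_i)/m(I_i)$ its matrix, acting on row vectors $v\in\mathbb R^k$ with the $\ell^1$ norm. A vector $v$ is identified with the step function equal to $v_i/\delta$ on $I_i$. Let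 $V\subset\mathbb R^k$ be the space of zero-sum vectors, $\|A|_V\|_1=\sup\{|vA|_1: v\in V,\ |v|_1=1\}$ (and $0$ if $V=0$), and let $N(\delta)$ be the least integer $N\ge1$ with $\|P_k^N|_V\|_1\le\frac12$, if there is one. Then: 1. $N(\delta)$ exists for all sufficiently small $\delta=1/k$, $N(\delta)=O(\log(1/\delta))$ and $2\delta N(\delta)\to0$ as $\delta=1/k\to0$. 2. $T$ has exactly one absolutely continuous invariant probability measure; its density $f$ (a suitable version of it) has bounded variation, and $Lf=f$ almost everywhere. 3. For every $k\ge1$, $\|L_\delta f-Lf\|_{L^1}\le 2\delta\,\mathrm{var}(f)$. If $N\ge 1$ satisfies $\|P_k^N|_V\|_1\le\frac12$, then $P_k$ has a unique stationary probability vector $f_\delta$, and $\|f_\delta-f\|_{L^1}\le 2N\,\|L_\delta f-Lf\|_{L^1}$. Moreover $\|f_\delta-f\|_{L^1}\to0$ as $\delta=1/k\to0$. 4. The algorithm computes $f$ to any precision. Let $B\ge\mathrm{var}(f)$ and $\varepsilon>0$. For every sufficiently large $k$ there is $\tau>0$ such that the following holds whenever $0\le\eta\le\tau$ and $\varepsilon_1,\varepsilon_2\le\tau$.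 Let $M$ be a stochastic matrix with $\sum_j|M_{ij}-P_{ij}|\le\eta$ for all $i$; let $f_\delta$ be a stationary probability vector of $P_k$ and $\tilde f_\delta\in\mathbb R^k$ with $|\tilde f_\delta-f_\delta|_1\le\varepsilon_1$; and let $\Delta L$ be a real number with $\|L_\delta f-Lf\|_{L^1}\le\Delta L+\varepsilon_2$ and $\Delta L\le 2\delta B+\varepsilon_2$. Then there is an integer $N\ge1$ with $\|M^N|_V\|_1+N\eta<\frac12$, and for the least such $N$ $$\|\tilde f_\delta-f\|_{L^1}\le\varepsilon_1+2N(\Delta L+\varepsilon_2)\le\varepsilon .$$ -/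

import Mathlib

open MeasureTheory Filter Topology Set

namespace UlamMethod

/-- `T` is a piecewise expanding self-map of `[0,1]` with singular points contained in the finite
set `D ∋ 0, 1`: it is `C²` on the open intervals between neighbouring points of `D`,
`|T''| / (T')²` is integrable, and `inf |T'| > 2` off `D`. Only the values of `T` on `[0,1]` matter;
the values at the points of `D` are arbitrary. (Such a map is automatically nonsingular.) -/
structure IsPiecewiseExpanding (T : ℝ → ℝ) (D : Finset ℝ) : Prop where
  mapsTo : MapsTo T (Icc 0 1) (Icc 0 1)
  subset_Icc : (D : Set ℝ) ⊆ Icc 0 1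
  zero_mem : (0 : ℝ) ∈ D
  one_mem : (1 : ℝ) ∈ D
  contDiffOn : ContDiffOn ℝ 2 T (Icc 0 1 \ D)
  integrableOn_distortion :
    IntegrableOn (fun x => |deriv (deriv T) x| / (deriv T x) ^ 2) (Icc 0 1)
  expanding : ∃ c : ℝ, 2 < c ∧ ∀ x ∈ Icc (0 : ℝ) 1 \ D, c ≤ |deriv T x|

/-- Topological mixing on `[0,1]` of a map that is considered off its finite singular set `D`:
for nonempty relatively open `U, V ⊆ [0,1]`, for every large `n` some point of `U` has its first
`n` iterates (those to which `T` is applied) outside `D` and its `n`-th iterate in `V`. -/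
def IsTopologicallyMixing (T : ℝ → ℝ) (D : Finset ℝ) : Prop :=
  ∀ U V : Set ℝ, IsOpen U → IsOpen V → (U ∩ Icc 0 1).Nonempty → (V ∩ Icc 0 1).Nonempty →
    ∃ n₀ : ℕ, ∀ n ≥ n₀, ∃ x ∈ U ∩ Icc 0 1, (∀ i < n, T^[i] x ∉ D) ∧ T^[n] x ∈ V

/-- `f` is the density of an absolutely continuous `T`-invariant probability measure on `[0,1]`. -/
structure IsInvariantDensity (T : ℝ → ℝ) (f : ℝ → ℝ) : Prop where
  integrableOn : IntegrableOn f (Icc 0 1)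
  nonneg : ∀ᵐ x ∂(volume.restrict (Icc (0 : ℝ) 1)), 0 ≤ f x
  integral_eq_one : ∫ x in Icc (0 : ℝ) 1, f x = 1
  invariant : ∀ A : Set ℝ, MeasurableSet A →
    ∫ x in Icc (0 : ℝ) 1 ∩ T ⁻¹' A, f x = ∫ x in Icc (0 : ℝ) 1 ∩ A, f x

/-- The Perron-Frobenius operator `(Lf)(x) = ∑_{y ∈ T⁻¹(x)} f(y) / |T'(y)|` on `[0,1]`. -/
noncomputable def transferOp (T : ℝ → ℝ) (f : ℝ → ℝ) (x : ℝ) : ℝ :=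
  ∑ᶠ y ∈ {y : ℝ | y ∈ Icc (0 : ℝ) 1 ∧ T y = x}, f y / |deriv T y|

/-- The `L¹` distance on `[0,1]`. -/
noncomputable def l1Dist (f g : ℝ → ℝ) : ℝ := ∫ x in Icc (0 : ℝ) 1, |f x - g x|

/-- The `i`-th interval (from `0`) of the partition of `[0,1)` into `k` intervals of length
`δ = 1 / k`. -/
def cell (k : ℕ) (i : Fin k) : Set ℝ := Ico (((i : ℕ) : ℝ) / k) ((((i : ℕ) : ℝ) + 1) / k)

/-- The step function with coordinates `w` in the basis `(1/δ) 1_{I_i}`: it gives mass `w i` to the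
`i`-th interval. -/
noncomputable def stepFun (k : ℕ) (w : Fin k → ℝ) (x : ℝ) : ℝ :=
  ∑ i, (cell k i).indicator (fun _ => (k : ℝ) * w i) x

/-- The conditional expectation `E(f | F_δ)` on the partition into `k` intervals. -/
noncomputable def cellAverage (k : ℕ) (f : ℝ → ℝ) : ℝ → ℝ :=
  stepFun k fun i => ∫ x in cell k i, f x

/-- The Ulam discretization `L_δ f = E(L(E(f | F_δ)) | F_δ)`, `δ = 1 / k`. -/
noncomputable def ulamOp (T : ℝ → ℝ) (k : ℕ) (f : ℝ → ℝ) : ℝ → ℝ :=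
  cellAverage k (transferOp T (cellAverage k f))

/-- The Ulam matrix `P_{ij} = m(T⁻¹(I_j) ∩ I_i) / m(I_i)`; it acts on row vectors of masses. -/
noncomputable def ulamMatrix (T : ℝ → ℝ) (k : ℕ) : Matrix (Fin k) (Fin k) ℝ :=
  Matrix.of fun i j => volume.real (cell k i ∩ T ⁻¹' cell k j) / volume.real (cell k i)

/-- `‖M|_V‖₁`: the `ℓ¹` operator norm of `v ↦ v M` on the space `V` of zero-sum vectors
(it is `0` when `V = 0`). -/
noncomputable def normOnV {k : ℕ} (M : Matrix (Fin k) (Fin k) ℝ) : ℝ :=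
  sSup {r : ℝ | ∃ v : Fin k → ℝ, ∑ i, v i = 0 ∧ ∑ i, |v i| = 1 ∧ r = ∑ i, |Matrix.vecMul v M i|}

/-- The positive integers `N` with `‖P_k^N|_V‖₁ ≤ 1/2`. -/
def contractionTimes (T : ℝ → ℝ) (k : ℕ) : Set ℕ :=
  {N : ℕ | 0 < N ∧ normOnV (ulamMatrix T k ^ N) ≤ 1 / 2}

/-- `N(δ)` for `δ = 1 / k`: the least positive `N` with `‖P_k^N|_V‖₁ ≤ 1/2`. -/
noncomputable def contractionTime (T : ℝ → ℝ) (k : ℕ) : ℕ := sInf (contractionTimes T k)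

/-- `v` is a probability vector. -/
def IsProbVec {k : ℕ} (v : Fin k → ℝ) : Prop := (∀ i, 0 ≤ v i) ∧ ∑ i, v i = 1

/-- `v` is a stationary probability vector of the Markov chain with transition matrix `M`. -/
def IsStationaryVec {k : ℕ} (M : Matrix (Fin k) (Fin k) ℝ) (v : Fin k → ℝ) : Prop :=
  IsProbVec v ∧ Matrix.vecMul v M = v

/-- The matrix computed by the algorithm: `M` is a stochastic matrix whose rows approximate those of
the Ulam matrix with `ℓ¹` error at most `η`. -/
def IsApproxMatrix (T : ℝ → ℝ) (k : ℕ) (η : ℝ) (M : Matrix (Fin k) (Fin k) ℝ) : Prop :=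
  (∀ i, IsProbVec (M i)) ∧ ∀ i, ∑ j, |M i j - ulamMatrix T k i j| ≤ η

/-- The positive integers `N` for which the computed powers of the matrix `M`, known up to `η`,
certify the contraction: `‖M^N|_V‖₁ + N η < 1/2`. -/
def stoppingTimes {k : ℕ} (M : Matrix (Fin k) (Fin k) ℝ) (η : ℝ) : Set ℕ :=
  {N : ℕ | 0 < N ∧ normOnV (M ^ N) + N * η < 1 / 2}

/-- The integer `N` computed by the algorithm: it tries `N = 1, 2, …` and stops at the first
certified one. -/
noncomputable def stoppingTime {k : ℕ} (M : Matrix (Fin k) (Fin k) ℝ) (η : ℝ) : ℕ :=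
  sInf (stoppingTimes M η)

/-- The error bound `ε₁ + 2 N (ΔL + ε₂)` produced by the algorithm. -/
noncomputable def errorBound (ε₁ : ℝ) (N : ℕ) (ΔL ε₂ : ℝ) : ℝ := ε₁ + 2 * N * (ΔL + ε₂)

end UlamMethod

open UlamMethod

namespace UlamMethod

/-! ### Variation of real functions -/

lemma eVariationOn_le_of_abs_sub_le {v F : ℝ → ℝ} {s : Set ℝ} {C : ℝ}
    (h : ∀ x ∈ s, ∀ y ∈ s, x ≤ y → |v y - v x| ≤ F y - F x)
    (hC : ∀ x ∈ s, ∀ y ∈ s, x ≤ y → F y - F x ≤ C) :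
    eVariationOn v s ≤ ENNReal.ofReal C := by
  refine iSup_le ?_
  rintro ⟨n, u, hu, us⟩
  calc ∑ i ∈ Finset.range n, edist (v (u (i + 1))) (v (u i))
      ≤ ∑ i ∈ Finset.range n, ENNReal.ofReal (F (u (i + 1)) - F (u i)) := by
        refine Finset.sum_le_sum fun i _ => ?_
        rw [edist_dist, Real.dist_eq]
        exact ENNReal.ofReal_le_ofReal (h _ (us i) _ (us (i + 1)) (hu i.le_succ))
    _ = ENNReal.ofReal (∑ i ∈ Finset.range n, (F (u (i + 1)) - F (u i))) := by
        rw [ENNReal.ofReal_sum_of_nonneg]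
        intro i _
        exact (abs_nonneg _).trans (h _ (us i) _ (us (i + 1)) (hu i.le_succ))
    _ ≤ ENNReal.ofReal C := by
        rw [Finset.sum_range_sub (fun i => F (u i))]
        exact ENNReal.ofReal_le_ofReal (hC _ (us 0) _ (us n) (hu n.zero_le))

lemma sum_eVariationOn_le (f : ℝ → ℝ) {s : ℕ → Set ℝ} {t : Set ℝ}
    (h : ∀ i j, i < j → ∀ x ∈ s i, ∀ y ∈ s j, x ≤ y) (n : ℕ) (ht : ∀ i < n, s i ⊆ t) :
    ∑ i ∈ Finset.range n, eVariationOn f (s i) ≤ eVariationOn f t := by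
  have key : ∑ i ∈ Finset.range n, eVariationOn f (s i) ≤
      eVariationOn f (⋃ i ∈ Finset.range n, s i) := by
    induction n with
    | zero => simp
    | succ n ih =>
      rw [Finset.sum_range_succ, Finset.range_add_one, Finset.set_biUnion_insert, union_comm]
      refine le_trans (by gcongr; exact ih fun i hi => ht i (by omega))
        (eVariationOn.add_le_union f ?_)
      intro x hx y hy
      simp only [Finset.mem_range, mem_iUnion] at hx
      obtain ⟨i, hi, hx⟩ := hx
      exact h i n hi x hx y hy
  refine key.trans (eVariationOn.mono f ?_)
  simpa using ht

lemma eVariationOn_add_le (f g : ℝ → ℝ) (s : Set ℝ) :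
    eVariationOn (fun x => f x + g x) s ≤ eVariationOn f s + eVariationOn g s := by
  refine iSup_le ?_
  rintro ⟨n, u, hu, us⟩
  calc ∑ i ∈ Finset.range n, edist (f (u (i + 1)) + g (u (i + 1))) (f (u i) + g (u i))
      ≤ ∑ i ∈ Finset.range n, (edist (f (u (i + 1))) (f (u i)) +
          edist (g (u (i + 1))) (g (u i))) :=
        Finset.sum_le_sum fun i _ => edist_add_add_le _ _ _ _
    _ ≤ _ := by
        rw [Finset.sum_add_distrib]
        exact add_le_add (eVariationOn.sum_le hu us) (eVariationOn.sum_le hu us)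

lemma eVariationOn_sum_le {ι : Type*} (t : Finset ι) (f : ι → ℝ → ℝ) (s : Set ℝ) :
    eVariationOn (fun x => ∑ i ∈ t, f i x) s ≤ ∑ i ∈ t, eVariationOn (f i) s := by
  classical
  induction t using Finset.induction_on with
  | empty => simpa using eVariationOn.constant_on (f := fun _ : ℝ => (0 : ℝ)) (s := s) (by
      rintro _ ⟨_, _, rfl⟩ _ ⟨_, _, rfl⟩; rfl)
  | insert a t ha ih =>
    simp only [Finset.sum_insert ha]
    exact (eVariationOn_add_le _ _ _).trans (by gcongr)

lemma eVariationOn_mul_le {f w : ℝ → ℝ} {s : Set ℝ} {θ M : ℝ}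
    (hw : ∀ x ∈ s, |w x| ≤ θ) (hf : ∀ x ∈ s, |f x| ≤ M) :
    eVariationOn (fun x => f x * w x) s ≤
      ENNReal.ofReal θ * eVariationOn f s + ENNReal.ofReal M * eVariationOn w s := by
  refine iSup_le ?_
  rintro ⟨n, u, hu, us⟩
  calc ∑ i ∈ Finset.range n, edist (f (u (i + 1)) * w (u (i + 1))) (f (u i) * w (u i))
      ≤ ∑ i ∈ Finset.range n, (ENNReal.ofReal θ * edist (f (u (i + 1))) (f (u i)) +
          ENNReal.ofReal M * edist (w (u (i + 1))) (w (u i))) := by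
        refine Finset.sum_le_sum fun i _ => ?_
        have h1 := hw _ (us (i + 1))
        have h2 := hf _ (us i)
        have hθ : 0 ≤ θ := (abs_nonneg _).trans h1
        have hM : 0 ≤ M := (abs_nonneg _).trans h2
        rw [edist_dist, edist_dist, edist_dist, ← ENNReal.ofReal_mul hθ, ← ENNReal.ofReal_mul hM,
          ← ENNReal.ofReal_add (by positivity) (by positivity)]
        refine ENNReal.ofReal_le_ofReal ?_
        rw [Real.dist_eq, Real.dist_eq, Real.dist_eq]
        calc |f (u (i + 1)) * w (u (i + 1)) - f (u i) * w (u i)|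
            = |w (u (i + 1)) * (f (u (i + 1)) - f (u i)) + f (u i) * (w (u (i + 1)) - w (u i))| := by
              congr 1; ring
          _ ≤ |w (u (i + 1))| * |f (u (i + 1)) - f (u i)| +
                |f (u i)| * |w (u (i + 1)) - w (u i)| := by
              rw [← abs_mul, ← abs_mul]; exact abs_add_le _ _
          _ ≤ _ := by gcongr
    _ ≤ _ := by
        rw [Finset.sum_add_distrib, ← Finset.mul_sum, ← Finset.mul_sum]
        gcongr
        · exact eVariationOn.sum_le hu us
        · exact eVariationOn.sum_le hu us

/-- Extending a function by zero to the left of an order-connected set. -/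
lemma eVariationOn_Iic_le_of_eq_zero {H : ℝ → ℝ} {S : Set ℝ} [hS : S.OrdConnected] {c : ℝ}
    (hc : c ∈ S) (hH : ∀ x ∉ S, H x = 0) {A : ENNReal}
    (hA : ∀ x ∈ S, x ≤ c → ENNReal.ofReal |H x| + eVariationOn H (S ∩ Icc x c) ≤ A) :
    eVariationOn H (Iic c) ≤ A := by
  refine iSup_le ?_
  rintro ⟨n, u, hu, us⟩
  suffices key : ∀ n : ℕ, (u n ∈ S → ∃ x ∈ S, x ≤ u n ∧
      ∑ i ∈ Finset.range n, edist (H (u (i + 1))) (H (u i)) ≤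
        ENNReal.ofReal |H x| + eVariationOn H (S ∩ Icc x (u n))) ∧
      (u n ∉ S → ∑ i ∈ Finset.range n, edist (H (u (i + 1))) (H (u i)) = 0) by
    by_cases hn : u n ∈ S
    · obtain ⟨x, hx, hxu, h⟩ := (key n).1 hn
      refine h.trans (le_trans ?_ (hA x hx (hxu.trans (us n))))
      gcongr
      exact eVariationOn.mono _ (inter_subset_inter_right _ (Icc_subset_Icc_right (us n)))
    · rw [(key n).2 hn]; exact zero_le
  intro n
  induction n with
  | zero => exact ⟨fun h => ⟨u 0, h, le_rfl, by simp⟩, by simp⟩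
  | succ n ih =>
    refine ⟨fun h => ?_, fun h => ?_⟩
    · by_cases hn : u n ∈ S
      · obtain ⟨x, hx, hxu, h'⟩ := ih.1 hn
        refine ⟨x, hx, hxu.trans (hu n.le_succ), ?_⟩
        rw [Finset.sum_range_succ]
        calc _ ≤ ENNReal.ofReal |H x| + eVariationOn H (S ∩ Icc x (u n)) +
                eVariationOn H {u n, u (n + 1)} := by
              rw [eVariationOn.pair, edist_comm (H (u n))]
              gcongr
          _ ≤ _ := by
              rw [add_assoc]
              gcongr
              refine (eVariationOn.add_le_union H ?_).trans (eVariationOn.mono _ ?_)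
              · rintro a ⟨_, ha⟩ b (rfl | rfl)
                · exact ha.2
                · exact ha.2.trans (hu n.le_succ)
              · rintro a (⟨ha, ha'⟩ | rfl | rfl)
                · exact ⟨ha, ha'.1, ha'.2.trans (hu n.le_succ)⟩
                · exact ⟨hn, hxu, hu n.le_succ⟩
                · exact ⟨h, hxu.trans (hu n.le_succ), le_rfl⟩
      · refine ⟨u (n + 1), h, le_rfl, ?_⟩
        rw [Finset.sum_range_succ, ih.2 hn, hH _ hn, zero_add, edist_dist, Real.dist_eq, sub_zero]
        exact le_self_add
    · have hn : u n ∉ S := fun hn => h (hS.out hn hc ⟨hu n.le_succ, us (n + 1)⟩)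
      rw [Finset.sum_range_succ, ih.2 hn, hH _ hn, hH _ h]
      simp

lemma eVariationOn_Ici_le_of_eq_zero {H : ℝ → ℝ} {S : Set ℝ} [hS : S.OrdConnected] {c : ℝ}
    (hc : c ∈ S) (hH : ∀ x ∉ S, H x = 0) {A : ENNReal}
    (hA : ∀ x ∈ S, c ≤ x → ENNReal.ofReal |H x| + eVariationOn H (S ∩ Icc c x) ≤ A) :
    eVariationOn H (Ici c) ≤ A := by
  have hneg : ∀ s : Set ℝ, eVariationOn (H ∘ Neg.neg) (Neg.neg ⁻¹' s) = eVariationOn H s := by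
    intro s
    rw [eVariationOn.comp_eq_of_antitoneOn H Neg.neg (fun a _ b _ h => neg_le_neg h)]
    congr 1
    exact image_preimage_eq _ neg_surjective
  have hS' : (Neg.neg ⁻¹' S).OrdConnected := by
    refine ⟨fun x hx y hy z hz => hS.out hy hx ⟨neg_le_neg hz.2, neg_le_neg hz.1⟩⟩
  have h1 : (Neg.neg ⁻¹' Ici c : Set ℝ) = Iic (-c) := by ext; simp
  rw [← hneg, h1]
  refine eVariationOn_Iic_le_of_eq_zero (S := Neg.neg ⁻¹' S) (by simpa using hc)
    (fun x hx => hH _ hx) fun x hx hxc => ?_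
  have h2 : (Neg.neg ⁻¹' S ∩ Icc x (-c) : Set ℝ) = Neg.neg ⁻¹' (S ∩ Icc c (-x)) := by
    ext y; simp only [mem_inter_iff, mem_preimage, mem_Icc]
    constructor <;> rintro ⟨a, b, d⟩ <;> refine ⟨a, ?_, ?_⟩ <;> linarith
  rw [h2]
  refine (add_le_add le_rfl (hneg _).le).trans ?_
  exact hA (-x) hx (by linarith)

lemma eVariationOn_univ_eq (H : ℝ → ℝ) (c : ℝ) :
    eVariationOn H univ = eVariationOn H (Iic c) + eVariationOn H (Ici c) := by
  rw [← eVariationOn.union H isGreatest_Iic isLeast_Ici, Iic_union_Ici]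

lemma eVariationOn_split (f : ℝ → ℝ) {s : Set ℝ} {z : ℝ} (hz : z ∈ s) :
    eVariationOn f (s ∩ Iic z) + eVariationOn f (s ∩ Ici z) = eVariationOn f s := by
  have h1 : IsGreatest (s ∩ Iic z) z := ⟨⟨hz, show z ≤ z from le_rfl⟩, fun _ h => h.2⟩
  have h2 : IsLeast (s ∩ Ici z) z := ⟨⟨hz, show z ≤ z from le_rfl⟩, fun _ h => h.2⟩
  rw [← eVariationOn.union f h1 h2, ← inter_union_distrib_left, Iic_union_Ici, inter_univ]

lemma exists_monotone_sub_eqOn {f : ℝ → ℝ} {s : Set ℝ} (hf : BoundedVariationOn f s) :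
    ∃ p q : ℝ → ℝ, Monotone p ∧ Monotone q ∧ EqOn f (fun x => p x - q x) s := by
  rcases s.eq_empty_or_nonempty with rfl | ⟨a, ha⟩
  · exact ⟨0, 0, monotone_const, monotone_const, by simp⟩
  have hl := hf.locallyBoundedVariationOn
  set p := variationOnFromTo f s a with hp
  have hb : ∀ x ∈ s, |p x| ≤ (eVariationOn f s).toReal := by
    intro x _
    rw [hp, variationOnFromTo]
    split_ifs
    · rw [abs_of_nonneg ENNReal.toReal_nonneg]
      exact ENNReal.toReal_mono hf (eVariationOn.mono _ inter_subset_left)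
    · rw [abs_neg, abs_of_nonneg ENNReal.toReal_nonneg]
      exact ENNReal.toReal_mono hf (eVariationOn.mono _ inter_subset_left)
  have hb' : ∀ x ∈ s, |(p - f) x| ≤ (eVariationOn f s).toReal +
      (|f a| + (eVariationOn f s).toReal) := by
    intro x hx
    have h1 := hb x hx
    have h2 := hf.dist_le hx ha
    rw [Real.dist_eq] at h2
    simp only [Pi.sub_apply, abs_le] at *
    have := neg_abs_le (f a)
    have := le_abs_self (f a)
    constructor <;> linarith [h1.1, h1.2, h2.1, h2.2]
  have hp1 : MonotoneOn p s := variationOnFromTo.monotoneOn hl ha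
  have hq1 : MonotoneOn (p - f) s := variationOnFromTo.sub_self_monotoneOn hl ha
  have bdd : ∀ (g : ℝ → ℝ) (C : ℝ), (∀ x ∈ s, |g x| ≤ C) → BddBelow (g '' s) ∧ BddAbove (g '' s) := by
    intro g C h
    exact ⟨⟨-C, by rintro _ ⟨x, hx, rfl⟩; exact (abs_le.1 (h x hx)).1⟩,
      ⟨C, by rintro _ ⟨x, hx, rfl⟩; exact (abs_le.1 (h x hx)).2⟩⟩
  obtain ⟨P, hP, hPs⟩ := hp1.exists_monotone_extension (bdd p _ hb).1 (bdd p _ hb).2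
  obtain ⟨Q, hQ, hQs⟩ := hq1.exists_monotone_extension (bdd _ _ hb').1 (bdd _ _ hb').2
  refine ⟨P, Q, hP, hQ, fun x hx => ?_⟩
  have h1 := hPs hx
  have h2 := hQs hx
  simp only [Pi.sub_apply] at h2
  simp only
  linarith

lemma boundedVariationOn_Icc_monotone_sub {p q : ℝ → ℝ} (hp : Monotone p) (hq : Monotone q)
    (a b : ℝ) : BoundedVariationOn (fun x => p x - q x) (Icc a b) := by
  have h : ∀ g : ℝ → ℝ, Monotone g → BoundedVariationOn g (Icc a b) := by
    intro g hg
    refine (hg.monotoneOn _).boundedVariationOn (C := max |g a| |g b|) fun x hx => ?_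
    exact abs_le_max_abs_abs (hg hx.1) (hg hx.2)
  have h2 : eVariationOn (fun x => - q x) (Icc a b) ≤ eVariationOn q (Icc a b) := by
    refine iSup_le ?_
    rintro ⟨n, u, hu, us⟩
    calc ∑ i ∈ Finset.range n, edist (- q (u (i + 1))) (- q (u i))
        = ∑ i ∈ Finset.range n, edist (q (u (i + 1))) (q (u i)) :=
          Finset.sum_congr rfl fun i _ => edist_neg_neg _ _
      _ ≤ _ := eVariationOn.sum_le hu us
  refine ne_top_of_le_ne_top ?_ (eVariationOn_add_le p (fun x => - q x) (Icc a b))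
  exact ENNReal.add_ne_top.2 ⟨h p hp, ne_top_of_le_ne_top (h q hq) h2⟩

lemma integrableOn_of_boundedVariationOn {f : ℝ → ℝ} {s : Set ℝ} (hs : MeasurableSet s)
    (hs' : volume s ≠ ⊤) (hf : BoundedVariationOn f s) : IntegrableOn f s := by
  rcases s.eq_empty_or_nonempty with rfl | ⟨a, ha⟩
  · simp
  obtain ⟨p, q, hp, hq, he⟩ := exists_monotone_sub_eqOn hf
  have hm : AEStronglyMeasurable f (volume.restrict s) := by
    have h1 : Measurable fun x => p x - q x := hp.measurable.sub hq.measurable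
    refine h1.aestronglyMeasurable.congr ?_
    filter_upwards [ae_restrict_mem hs] with x hx using (he hx).symm
  refine IntegrableOn.of_bound hs'.lt_top hm (|f a| + (eVariationOn f s).toReal) ?_
  filter_upwards [ae_restrict_mem hs] with x hx
  have h2 := hf.dist_le hx ha
  rw [Real.dist_eq] at h2
  rw [Real.norm_eq_abs]
  have := abs_sub_abs_le_abs_sub (f x) (f a)
  linarith


/-! ### Branches of a piecewise expanding map -/

/-- The points of `(0,1) \ D` with exactly `j` points of `D` to their left. -/
def branch (D : Finset ℝ) (j : ℕ) : Set ℝ :=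
  {y | y ∈ Ioo (0 : ℝ) 1 ∧ y ∉ D ∧ (D.filter (· < y)).card = j}

lemma branch_subset_Ioo (D : Finset ℝ) (j : ℕ) : branch D j ⊆ Ioo 0 1 := fun _ h => h.1

lemma branch_subset_Icc (D : Finset ℝ) (j : ℕ) : branch D j ⊆ Icc 0 1 :=
  (branch_subset_Ioo D j).trans Ioo_subset_Icc_self

lemma filter_lt_mono (D : Finset ℝ) {x y : ℝ} (h : x ≤ y) :
    D.filter (· < x) ⊆ D.filter (· < y) :=
  Finset.monotone_filter_right _ fun _ _ ha => lt_of_lt_of_le ha h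

lemma branch_le {D : Finset ℝ} {i j : ℕ} (hij : i < j) {x y : ℝ} (hx : x ∈ branch D i)
    (hy : y ∈ branch D j) : x ≤ y := by
  by_contra! h
  have := Finset.card_le_card (filter_lt_mono D h.le)
  rw [hx.2.2, hy.2.2] at this
  omega

lemma pairwise_disjoint_branch (D : Finset ℝ) : Pairwise (Function.onFun Disjoint (branch D)) := by
  intro i j hij
  exact Set.disjoint_left.2 fun x hx hx' => hij (hx.2.2.symm.trans hx'.2.2)

lemma mem_branch_iUnion {D : Finset ℝ} {y : ℝ} (hy : y ∈ Ioo (0 : ℝ) 1) (hD : y ∉ D) :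
    ∃ j ∈ Finset.range (D.card + 1), y ∈ branch D j :=
  ⟨_, Finset.mem_range.2 (Nat.lt_succ_of_le (Finset.card_filter_le _ _)), hy, hD, rfl⟩

lemma ordConnected_branch (D : Finset ℝ) (j : ℕ) : (branch D j).OrdConnected := by
  refine ⟨fun x hx y hy z hz => ⟨⟨hx.1.1.trans_le hz.1, hz.2.trans_lt hy.1.2⟩, ?_, ?_⟩⟩
  · intro hzD
    have hzy : z < y := lt_of_le_of_ne hz.2 fun h => hy.2.1 (h ▸ hzD)
    have h1 : D.filter (· < x) = D.filter (· < y) :=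
      Finset.eq_of_subset_of_card_le (filter_lt_mono D (hz.1.trans hz.2)) (by rw [hx.2.2, hy.2.2])
    have h2 : z ∈ D.filter (· < x) := by
      rw [h1]; exact Finset.mem_filter.2 ⟨hzD, hzy⟩
    exact absurd (Finset.mem_filter.1 h2).2 (not_lt.2 hz.1)
  · have h1 := Finset.card_le_card (filter_lt_mono D hz.1)
    have h2 := Finset.card_le_card (filter_lt_mono D hz.2)
    rw [hx.2.2] at h1
    rw [hy.2.2] at h2
    omega

lemma isOpen_branch (D : Finset ℝ) (j : ℕ) : IsOpen (branch D j) := by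
  rw [isOpen_iff_mem_nhds]
  rintro y ⟨hy, hyD, hj⟩
  have h1 : ∀ᶠ z in 𝓝 y, ∀ d ∈ D, z ≠ d ∧ (d < z ↔ d < y) := by
    rw [Filter.eventually_all_finset]
    intro d hd
    have hne : y ≠ d := fun h => hyD (h ▸ hd)
    rcases lt_or_gt_of_ne hne with h | h
    · filter_upwards [Iio_mem_nhds h] with z hz
      exact ⟨ne_of_lt hz, ⟨fun h' => absurd h' (not_lt.2 (le_of_lt hz)),
        fun h' => absurd h' (not_lt.2 h.le)⟩⟩
    · filter_upwards [Ioi_mem_nhds h] with z hz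
      exact ⟨ne_of_gt hz, ⟨fun _ => h, fun _ => hz⟩⟩
  filter_upwards [h1, isOpen_Ioo.mem_nhds hy] with z hz hz'
  refine ⟨hz', fun h => (hz z h).1 rfl, ?_⟩
  rw [← hj, Finset.filter_congr fun d hd => (hz d hd).2]

lemma measurableSet_branch (D : Finset ℝ) (j : ℕ) : MeasurableSet (branch D j) :=
  (isOpen_branch D j).measurableSet

namespace IsPiecewiseExpanding

variable {T : ℝ → ℝ} {D : Finset ℝ}

lemma diff_eq (hT : IsPiecewiseExpanding T D) :
    Icc (0 : ℝ) 1 \ D = Ioo (0 : ℝ) 1 \ D := by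
  ext x
  constructor
  · rintro ⟨⟨h0, h1⟩, hD⟩
    refine ⟨⟨lt_of_le_of_ne h0 ?_, lt_of_le_of_ne h1 ?_⟩, hD⟩
    · rintro rfl; exact hD hT.zero_mem
    · rintro rfl; exact hD hT.one_mem
  · exact fun h => ⟨Ioo_subset_Icc_self h.1, h.2⟩

lemma isOpen_diff (hT : IsPiecewiseExpanding T D) : IsOpen (Icc (0 : ℝ) 1 \ D) := by
  rw [hT.diff_eq]
  exact isOpen_Ioo.sdiff D.finite_toSet.isClosed

lemma branch_subset (_hT : IsPiecewiseExpanding T D) (j : ℕ) : branch D j ⊆ Icc (0 : ℝ) 1 \ D :=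
  fun _ hy => ⟨Ioo_subset_Icc_self hy.1, hy.2.1⟩

lemma mono {D' : Finset ℝ} (hT : IsPiecewiseExpanding T D) (h : D ⊆ D')
    (h' : (D' : Set ℝ) ⊆ Icc 0 1) : IsPiecewiseExpanding T D' where
  mapsTo := hT.mapsTo
  subset_Icc := h'
  zero_mem := h hT.zero_mem
  one_mem := h hT.one_mem
  contDiffOn := hT.contDiffOn.mono (sdiff_subset_sdiff_right (by exact_mod_cast h))
  integrableOn_distortion := hT.integrableOn_distortion
  expanding := by
    obtain ⟨c, hc, hc'⟩ := hT.expanding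
    exact ⟨c, hc, fun x hx => hc' x ⟨hx.1, fun hxD => hx.2 (h hxD)⟩⟩

lemma hasDerivAt (hT : IsPiecewiseExpanding T D) {x : ℝ} (hx : x ∈ Icc (0 : ℝ) 1 \ D) :
    HasDerivAt T (deriv T x) x :=
  ((hT.contDiffOn.differentiableOn (by norm_num)).differentiableAt
    (hT.isOpen_diff.mem_nhds hx)).hasDerivAt

lemma hasDerivAt_deriv (hT : IsPiecewiseExpanding T D) {x : ℝ} (hx : x ∈ Icc (0 : ℝ) 1 \ D) :
    HasDerivAt (deriv T) (deriv (deriv T) x) x := by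
  have h : ContDiffOn ℝ 1 (deriv T) (Icc (0 : ℝ) 1 \ D) :=
    hT.contDiffOn.deriv_of_isOpen hT.isOpen_diff (by norm_num)
  exact ((h.differentiableOn (by norm_num)).differentiableAt
    (hT.isOpen_diff.mem_nhds hx)).hasDerivAt

lemma deriv_ne_zero (hT : IsPiecewiseExpanding T D) {x : ℝ} (hx : x ∈ Icc (0 : ℝ) 1 \ D) :
    deriv T x ≠ 0 := by
  obtain ⟨c, hc, hc'⟩ := hT.expanding
  exact abs_pos.1 (by linarith [hc' x hx])

lemma continuousOn (hT : IsPiecewiseExpanding T D) : ContinuousOn T (Icc (0 : ℝ) 1 \ D) :=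
  hT.contDiffOn.continuousOn

lemma strictMonoOn_or_strictAntiOn (hT : IsPiecewiseExpanding T D) (j : ℕ) :
    StrictMonoOn T (branch D j) ∨ StrictAntiOn T (branch D j) := by
  have hconv : Convex ℝ (branch D j) := (ordConnected_branch D j).convex
  have hsub := hT.branch_subset j
  have hc : ContinuousOn T (branch D j) := hT.continuousOn.mono hsub
  rcases hasDerivWithinAt_forall_lt_or_forall_gt_of_forall_ne hconv
    (fun x hx => (hT.hasDerivAt (hsub hx)).hasDerivWithinAt)
    (fun x hx => hT.deriv_ne_zero (hsub hx)) with h | h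
  · exact .inr (strictAntiOn_of_deriv_neg hconv hc fun x hx => h x (interior_subset hx))
  · exact .inl (strictMonoOn_of_deriv_pos hconv hc fun x hx => h x (interior_subset hx))

lemma injOn_branch (hT : IsPiecewiseExpanding T D) (j : ℕ) : InjOn T (branch D j) :=
  (hT.strictMonoOn_or_strictAntiOn j).elim StrictMonoOn.injOn StrictAntiOn.injOn

lemma ordConnected_image (hT : IsPiecewiseExpanding T D) (j : ℕ) :
    (T '' branch D j).OrdConnected :=
  (((ordConnected_branch D j).isPreconnected).image T
    (hT.continuousOn.mono (hT.branch_subset j))).ordConnected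

lemma image_branch_subset (hT : IsPiecewiseExpanding T D) (j : ℕ) :
    T '' branch D j ⊆ Icc 0 1 :=
  (hT.mapsTo.mono_left (branch_subset_Icc D j)).image_subset

lemma measurableSet_preimage (hT : IsPiecewiseExpanding T D) {A : Set ℝ} (hA : MeasurableSet A) :
    MeasurableSet (Icc (0 : ℝ) 1 ∩ T ⁻¹' A) := by
  have h1 : Icc (0 : ℝ) 1 ∩ T ⁻¹' A =
      ((Icc (0 : ℝ) 1 \ D) ∩ T ⁻¹' A) ∪ ((D : Set ℝ) ∩ (Icc (0 : ℝ) 1 ∩ T ⁻¹' A)) := by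
    ext x; by_cases hx : x ∈ (D : Set ℝ) <;> simp [hx]
  rw [h1]
  refine MeasurableSet.union ?_ (D.finite_toSet.subset inter_subset_left).measurableSet
  have h2 := (continuousOn_iff_continuous_domRestrict.1 hT.continuousOn).measurable hA
  have h3 := hT.isOpen_diff.measurableSet.subtype_image h2
  convert h3 using 1
  ext x
  constructor
  · rintro ⟨h, h'⟩; exact ⟨⟨x, h⟩, h', rfl⟩
  · rintro ⟨⟨y, hy⟩, h', rfl⟩; exact ⟨hy, h'⟩

end IsPiecewiseExpanding

/-- The contribution of a branch to the transfer operator. -/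
noncomputable def branchTerm (T : ℝ → ℝ) (D : Finset ℝ) (j : ℕ) (f : ℝ → ℝ) (x : ℝ) : ℝ :=
  ∑ᶠ y ∈ {y : ℝ | y ∈ branch D j ∧ T y = x}, f y / |deriv T y|

namespace IsPiecewiseExpanding

variable {T : ℝ → ℝ} {D : Finset ℝ}

lemma branchTerm_apply (hT : IsPiecewiseExpanding T D) {j : ℕ} {y : ℝ} (hy : y ∈ branch D j)
    (f : ℝ → ℝ) : branchTerm T D j f (T y) = f y / |deriv T y| := by
  have h : {z : ℝ | z ∈ branch D j ∧ T z = T y} = {y} := by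
    ext z
    constructor
    · rintro ⟨h1, h2⟩; exact hT.injOn_branch j h1 hy h2
    · rintro rfl; exact ⟨hy, rfl⟩
  rw [branchTerm, h, finsum_mem_singleton]

lemma branchTerm_eq_zero (T : ℝ → ℝ) (D : Finset ℝ) {j : ℕ} {x : ℝ} (hx : x ∉ T '' branch D j)
    (f : ℝ → ℝ) : branchTerm T D j f x = 0 := by
  have h : {z : ℝ | z ∈ branch D j ∧ T z = x} = ∅ := by
    ext z
    simp only [mem_ofPred_eq, mem_empty_iff_false, iff_false]
    exact fun h => hx ⟨z, h⟩
  rw [branchTerm, h, finsum_mem_empty]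

lemma finite_branch_fibre (hT : IsPiecewiseExpanding T D) (j : ℕ) (x : ℝ) :
    {y : ℝ | y ∈ branch D j ∧ T y = x}.Finite := by
  refine Set.Subsingleton.finite ?_
  rintro y ⟨hy, rfl⟩ z ⟨hz, h⟩
  exact (hT.injOn_branch j hz hy h).symm

lemma transferOp_eq_sum (hT : IsPiecewiseExpanding T D) (f : ℝ → ℝ) {x : ℝ}
    (hx : x ∉ T '' D) :
    transferOp T f x = ∑ j ∈ Finset.range (D.card + 1), branchTerm T D j f x := by
  have h : {y : ℝ | y ∈ Icc (0 : ℝ) 1 ∧ T y = x} =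
      ⋃ j ∈ (Finset.range (D.card + 1) : Set ℕ), {y : ℝ | y ∈ branch D j ∧ T y = x} := by
    ext y
    simp only [mem_ofPred_eq, mem_iUnion, Finset.mem_coe, exists_prop]
    constructor
    · rintro ⟨hy, rfl⟩
      have hyD : y ∉ D := fun h => hx ⟨y, h, rfl⟩
      have hy' : y ∈ Ioo (0 : ℝ) 1 \ D := hT.diff_eq ▸ ⟨hy, hyD⟩
      obtain ⟨j, hj, hyj⟩ := mem_branch_iUnion hy'.1 hyD
      exact ⟨j, hj, hyj, rfl⟩
    · rintro ⟨j, -, hy, rfl⟩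
      exact ⟨branch_subset_Icc D j hy, rfl⟩
  rw [transferOp, h, finsum_mem_biUnion _ (Finset.finite_toSet _)
    fun j _ => hT.finite_branch_fibre j x, finsum_mem_coe_finset]
  · rfl
  · intro i _ j _ hij
    exact (pairwise_disjoint_branch D hij).mono (fun _ h => h.1) (fun _ h => h.1)

lemma ae_notMem_image (T : ℝ → ℝ) (D : Finset ℝ) (s : Set ℝ) :
    ∀ᵐ x ∂(volume.restrict s), x ∉ T '' D :=
  ae_restrict_of_ae ((D.finite_toSet.image T).measure_zero volume |> measure_eq_zero_iff_ae_notMem.1)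

lemma transferOp_ae_eq_sum (hT : IsPiecewiseExpanding T D) (f : ℝ → ℝ) (s : Set ℝ) :
    transferOp T f =ᵐ[volume.restrict s]
      fun x => ∑ j ∈ Finset.range (D.card + 1), branchTerm T D j f x := by
  filter_upwards [ae_notMem_image T D s] with x hx using hT.transferOp_eq_sum f hx

lemma integrableOn_branchTerm (hT : IsPiecewiseExpanding T D) {f : ℝ → ℝ}
    (hf : IntegrableOn f (Icc 0 1)) (j : ℕ) :
    IntegrableOn (branchTerm T D j f) (Icc 0 1) := by
  have h1 : IntegrableOn (branchTerm T D j f) (T '' branch D j) := by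
    rw [integrableOn_image_iff_integrableOn_abs_deriv_smul (measurableSet_branch D j)
      (fun x hx => (hT.hasDerivAt (hT.branch_subset j hx)).hasDerivWithinAt) (hT.injOn_branch j)]
    refine (hf.mono_set (branch_subset_Icc D j)).congr_fun (fun y hy => ?_) (measurableSet_branch D j)
    have := abs_ne_zero.2 (hT.deriv_ne_zero (hT.branch_subset j hy))
    simp only [hT.branchTerm_apply hy, smul_eq_mul]
    field_simp
  have hm := (hT.ordConnected_image j).measurableSet
  exact h1.of_forall_sdiff_eq_zero measurableSet_Icc fun x hx => branchTerm_eq_zero T D hx.2 f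

lemma setIntegral_branchTerm (hT : IsPiecewiseExpanding T D) (f : ℝ → ℝ) (j : ℕ) {A : Set ℝ}
    (hA : MeasurableSet A) :
    ∫ x in Icc (0 : ℝ) 1 ∩ A, branchTerm T D j f x = ∫ x in branch D j ∩ T ⁻¹' A, f x := by
  have himg : T '' (branch D j ∩ T ⁻¹' A) = T '' branch D j ∩ A := image_inter_preimage _ _ _
  have hm : MeasurableSet (branch D j ∩ T ⁻¹' A) := by
    rw [← inter_eq_left.2 (branch_subset_Icc D j), inter_assoc]
    exact (measurableSet_branch D j).inter (hT.measurableSet_preimage hA)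
  have h1 := integral_image_eq_integral_abs_deriv_smul hm
      (fun x hx => (hT.hasDerivAt (hT.branch_subset j hx.1)).hasDerivWithinAt)
      ((hT.injOn_branch j).mono inter_subset_left) (branchTerm T D j f)
  rw [himg] at h1
  rw [setIntegral_eq_of_subset_of_forall_sdiff_eq_zero (measurableSet_Icc.inter hA)
    (inter_subset_inter_left A (hT.image_branch_subset j)), h1]
  · refine setIntegral_congr_fun hm fun y hy => ?_
    have := abs_ne_zero.2 (hT.deriv_ne_zero (hT.branch_subset j hy.1))
    simp only [hT.branchTerm_apply hy.1, smul_eq_mul]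
    field_simp
  · rintro x ⟨⟨_, hxA⟩, hx⟩
    exact branchTerm_eq_zero T D (fun h => hx ⟨h, hxA⟩) f

lemma integrableOn_transferOp (hT : IsPiecewiseExpanding T D) {f : ℝ → ℝ}
    (hf : IntegrableOn f (Icc 0 1)) : IntegrableOn (transferOp T f) (Icc 0 1) := by
  have h : IntegrableOn (fun x => ∑ j ∈ Finset.range (D.card + 1), branchTerm T D j f x)
      (Icc 0 1) := integrable_finsetSum _ fun j _ => hT.integrableOn_branchTerm hf j
  exact h.congr (hT.transferOp_ae_eq_sum f _).symm

lemma setIntegral_transferOp (hT : IsPiecewiseExpanding T D) {f : ℝ → ℝ}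
    (hf : IntegrableOn f (Icc 0 1)) {A : Set ℝ} (hA : MeasurableSet A) :
    ∫ x in Icc (0 : ℝ) 1 ∩ A, transferOp T f x = ∫ x in Icc (0 : ℝ) 1 ∩ T ⁻¹' A, f x := by
  have hm : ∀ j, MeasurableSet (branch D j ∩ T ⁻¹' A) := by
    intro j
    rw [← inter_eq_left.2 (branch_subset_Icc D j), inter_assoc]
    exact (measurableSet_branch D j).inter (hT.measurableSet_preimage hA)
  rw [integral_congr_ae (hT.transferOp_ae_eq_sum f _), integral_finsetSum]
  · simp_rw [hT.setIntegral_branchTerm f _ hA]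
    rw [← integral_biUnion_finset _ (fun j _ => hm j)]
    · refine setIntegral_congr_set ?_
      have hnull : ∀ᵐ x, x ∉ (D : Set ℝ) :=
        measure_eq_zero_iff_ae_notMem.1 (D.finite_toSet.measure_zero volume)
      filter_upwards [hnull] with x hx
      refine propext ⟨fun h => ?_, fun h => ?_⟩
      · have h' : x ∈ ⋃ j ∈ Finset.range (D.card + 1), branch D j ∩ T ⁻¹' A := h
        simp only [mem_iUnion] at h'
        obtain ⟨j, _, h1, h2⟩ := h'
        exact ⟨branch_subset_Icc D j h1, h2⟩
      · have hy' : x ∈ Ioo (0 : ℝ) 1 \ D := hT.diff_eq ▸ ⟨h.1, hx⟩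
        obtain ⟨j, hj, hyj⟩ := mem_branch_iUnion hy'.1 hx
        show x ∈ ⋃ j ∈ Finset.range (D.card + 1), branch D j ∩ T ⁻¹' A
        simp only [mem_iUnion]
        exact ⟨j, hj, hyj, h.2⟩
    · intro i _ j _ hij
      exact (pairwise_disjoint_branch D hij).mono inter_subset_left inter_subset_left
    · exact fun j _ => hf.mono_set (inter_subset_left.trans (branch_subset_Icc D j))
  · exact fun j _ => (hT.integrableOn_branchTerm hf j).mono_set inter_subset_left

end IsPiecewiseExpanding


/-! ### The Lasota-Yorke inequality -/

namespace IsPiecewiseExpanding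

variable {T : ℝ → ℝ} {D : Finset ℝ}

lemma abs_inv_abs_deriv_sub_le (hT : IsPiecewiseExpanding T D) {j : ℕ} {x y : ℝ}
    (hx : x ∈ branch D j) (hy : y ∈ branch D j) (hxy : x ≤ y) :
    |(1 / |deriv T y| - 1 / |deriv T x|)| ≤
      (∫ t in (0 : ℝ)..y, |deriv (deriv T) t| / (deriv T t) ^ 2) -
        ∫ t in (0 : ℝ)..x, |deriv (deriv T) t| / (deriv T t) ^ 2 := by
  have hρ := hT.integrableOn_distortion
  have hsub : Icc x y ⊆ branch D j := (ordConnected_branch D j).out hx hy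
  have hint : ∀ a ∈ Icc (0 : ℝ) 1, ∀ b ∈ Icc (0 : ℝ) 1, IntervalIntegrable
      (fun t => |deriv (deriv T) t| / (deriv T t) ^ 2) volume a b := by
    intro a ha b hb
    rw [intervalIntegrable_iff]
    refine hρ.mono_set (uIoc_subset_uIcc.trans ?_)
    exact uIcc_subset_Icc ha hb
  have hx1 := branch_subset_Icc D j hx
  have hy1 := branch_subset_Icc D j hy
  have h01 : (0 : ℝ) ∈ Icc (0 : ℝ) 1 := by simp
  rw [intervalIntegral.integral_interval_sub_left (hint _ h01 _ hy1) (hint _ h01 _ hx1)]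
  have hder : ∀ t ∈ uIcc x y, HasDerivAt (fun t => (deriv T t)⁻¹)
      (-deriv (deriv T) t / (deriv T t) ^ 2) t := by
    intro t ht
    rw [uIcc_of_le hxy] at ht
    have ht' := hT.branch_subset j (hsub ht)
    exact (hT.hasDerivAt_deriv ht').inv (hT.deriv_ne_zero ht')
  have habs : ∀ t, |(-deriv (deriv T) t / (deriv T t) ^ 2)| =
      |deriv (deriv T) t| / (deriv T t) ^ 2 := by
    intro t
    rw [abs_div, abs_neg, abs_of_nonneg (sq_nonneg (deriv T t))]
  have hii : IntervalIntegrable (fun t => -deriv (deriv T) t / (deriv T t) ^ 2) volume x y := by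
    refine (hint x hx1 y hy1).mono_fun' ?_ (ae_of_all _ fun t => ?_)
    · have h1 : Measurable (deriv T) := measurable_deriv T
      have h2 : Measurable (deriv (deriv T)) := measurable_deriv _
      exact (h2.neg.div (h1.pow_const 2)).aestronglyMeasurable
    · exact (habs t).le
  calc |(1 / |deriv T y| - 1 / |deriv T x|)|
      = |(|(deriv T y)⁻¹| - |(deriv T x)⁻¹|)| := by simp [abs_inv]
    _ ≤ |(deriv T y)⁻¹ - (deriv T x)⁻¹| := abs_abs_sub_abs_le _ _
    _ = |∫ t in x..y, -deriv (deriv T) t / (deriv T t) ^ 2| := by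
        rw [intervalIntegral.integral_eq_sub_of_hasDerivAt hder hii]
    _ ≤ ∫ t in x..y, |(-deriv (deriv T) t / (deriv T t) ^ 2)| :=
        intervalIntegral.abs_integral_le_integral_abs hxy
    _ = _ := by simp_rw [habs]

lemma exists_refinement (hT : IsPiecewiseExpanding T D) {ε : ℝ} (hε : 0 < ε) :
    ∃ D' : Finset ℝ, D ⊆ D' ∧ IsPiecewiseExpanding T D' ∧ ∀ j,
      eVariationOn (fun y => 1 / |deriv T y|) (branch D' j) ≤ ENNReal.ofReal ε := by
  classical
  set G : ℝ → ℝ := fun y => ∫ t in (0 : ℝ)..y, |deriv (deriv T) t| / (deriv T t) ^ 2 with hG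
  have hcont : ContinuousOn G (Icc 0 1) := by
    have := intervalIntegral.continuousOn_primitive_interval (a := 0) (b := 1)
      (f := fun t => |deriv (deriv T) t| / (deriv T t) ^ 2) (μ := volume)
      (by rw [uIcc_of_le zero_le_one]; exact hT.integrableOn_distortion)
    rwa [uIcc_of_le zero_le_one] at this
  have huc := isCompact_Icc.uniformContinuousOn_of_continuous hcont
  rw [Metric.uniformContinuousOn_iff] at huc
  obtain ⟨δ, hδ, huc⟩ := huc ε hε
  obtain ⟨m, hm⟩ := exists_nat_one_div_lt hδ
  set M : ℝ := m + 1 with hM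
  have hM0 : 0 < M := by positivity
  set D' := D ∪ (Finset.range (m + 2)).image (fun i : ℕ => (i : ℝ) / M) with hD'
  have hsub : (D' : Set ℝ) ⊆ Icc 0 1 := by
    intro x hx
    rcases Finset.mem_union.1 hx with h | h
    · exact hT.subset_Icc h
    · obtain ⟨i, hi, rfl⟩ := Finset.mem_image.1 h
      refine ⟨by positivity, ?_⟩
      rw [div_le_one hM0, hM]
      have : i ≤ m + 1 := by have := Finset.mem_range.1 hi; omega
      exact_mod_cast this
  have hT' := hT.mono Finset.subset_union_left hsub
  refine ⟨D', Finset.subset_union_left, hT', fun j => ?_⟩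
  refine eVariationOn_le_of_abs_sub_le (F := G)
    (fun x hx y hy hxy => hT'.abs_inv_abs_deriv_sub_le hx hy hxy) fun x hx y hy hxy => ?_
  have hclose : y - x < δ := by
    refine lt_of_le_of_lt ?_ hm
    by_contra! hlt
    have hx0 := (branch_subset_Ioo _ _ hx).1
    have hy1 := (branch_subset_Ioo _ _ hy).2
    have h1 : x ≤ (⌈x * M⌉₊ : ℝ) / M := by
      rw [le_div_iff₀ hM0]; exact Nat.le_ceil _
    have h2 : (⌈x * M⌉₊ : ℝ) / M < y := by
      rw [div_lt_iff₀ hM0]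
      have h3 := Nat.ceil_lt_add_one (a := x * M) (by positivity)
      have h4 : 1 < (y - x) * M := by rwa [div_lt_iff₀ hM0] at hlt
      linarith
    have h3 := (ordConnected_branch D' j).out hx hy ⟨h1, h2.le⟩
    refine h3.2.1 (Finset.mem_union_right _ (Finset.mem_image.2 ⟨_, ?_, rfl⟩))
    have h5 : (⌈x * M⌉₊ : ℝ) < m + 1 := by
      have := h2.trans hy1
      rwa [div_lt_one hM0] at this
    have : ⌈x * M⌉₊ < m + 1 := by exact_mod_cast h5
    exact Finset.mem_range.2 (by omega)
  have := huc y (branch_subset_Icc _ _ hy) x (branch_subset_Icc _ _ hx)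
    (by rw [Real.dist_eq, abs_of_nonneg (by linarith)]; exact hclose)
  rw [Real.dist_eq] at this
  exact (le_abs_self _).trans this.le

lemma eVariationOn_branchTerm_le (hT : IsPiecewiseExpanding T D) {j : ℕ} {θ ε : ℝ} (hθ : 0 < θ)
    (hε : 0 ≤ ε) (hw : ∀ y ∈ branch D j, 1 / |deriv T y| ≤ θ)
    (hv : eVariationOn (fun y => 1 / |deriv T y|) (branch D j) ≤ ENNReal.ofReal ε)
    (f : ℝ → ℝ) {z : ℝ} (hz : z ∈ branch D j) :
    eVariationOn (branchTerm T D j f) univ ≤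
      ENNReal.ofReal (2 * θ + ε) * eVariationOn f (branch D j) +
        ENNReal.ofReal ((2 * θ + ε) * |f z|) := by
  by_cases hV : eVariationOn f (branch D j) = ⊤
  · rw [hV, ENNReal.mul_top (by simpa using by linarith), top_add]; exact le_top
  set H := branchTerm T D j f with hH
  have := hT.ordConnected_image j
  have hzero : ∀ x ∉ T '' branch D j, H x = 0 := fun x hx => branchTerm_eq_zero T D hx f
  have hval : ∀ y ∈ branch D j, H (T y) = f y / |deriv T y| :=
    fun y hy => hT.branchTerm_apply hy f
  have hHS : eVariationOn H (T '' branch D j) ≤ ENNReal.ofReal θ * eVariationOn f (branch D j) +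
      (ENNReal.ofReal |f z| + eVariationOn f (branch D j)) * ENNReal.ofReal ε := by
    have h1 : eVariationOn H (T '' branch D j) =
        eVariationOn (fun y => f y * (1 / |deriv T y|)) (branch D j) := by
      have h2 : eVariationOn (H ∘ T) (branch D j) = eVariationOn H (T '' branch D j) := by
        rcases hT.strictMonoOn_or_strictAntiOn j with h | h
        · exact eVariationOn.comp_eq_of_monotoneOn H T h.monotoneOn
        · exact eVariationOn.comp_eq_of_antitoneOn H T h.antitoneOn
      rw [← h2]
      exact eVariationOn.congr fun y hy => by simp [hval y hy, div_eq_mul_inv]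
    rw [h1]
    refine (eVariationOn_mul_le (θ := θ)
      (M := |f z| + (eVariationOn f (branch D j)).toReal) (fun y hy => ?_) (fun y hy => ?_)).trans ?_
    · rw [abs_of_nonneg (by positivity)]; exact hw y hy
    · have := BoundedVariationOn.dist_le hV hy hz
      rw [Real.dist_eq] at this
      linarith [abs_sub_abs_le_abs_sub (f y) (f z)]
    · rw [ENNReal.ofReal_add (abs_nonneg _) ENNReal.toReal_nonneg, ENNReal.ofReal_toReal hV]
      gcongr
  have hend : ∀ s : Set ℝ, z ∈ s → ∀ y ∈ branch D j, y ∈ s → ENNReal.ofReal |H (T y)| ≤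
      ENNReal.ofReal θ * (ENNReal.ofReal |f z| + eVariationOn f (branch D j ∩ s)) := by
    intro s hzs y hy hys
    rw [hval y hy, abs_div, abs_abs, div_eq_mul_one_div, mul_comm, ENNReal.ofReal_mul (by positivity)]
    gcongr
    · exact hw y hy
    · have h1 := eVariationOn.edist_le f (s := branch D j ∩ s) ⟨hy, hys⟩ ⟨hz, hzs⟩
      rw [edist_dist, Real.dist_eq] at h1
      refine le_trans ?_ (add_le_add le_rfl h1)
      rw [← ENNReal.ofReal_add (abs_nonneg _) (abs_nonneg _)]
      exact ENNReal.ofReal_le_ofReal (by linarith [abs_sub_abs_le_abs_sub (f y) (f z)])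
  have hmain : ∀ s t : Set ℝ, z ∈ s → z ∈ t → (∀ y ∈ branch D j, T y ≤ T z → y ∈ s) →
      (∀ y ∈ branch D j, T z ≤ T y → y ∈ t) →
      eVariationOn f (branch D j ∩ s) + eVariationOn f (branch D j ∩ t) =
        eVariationOn f (branch D j) →
      eVariationOn H univ ≤ ENNReal.ofReal θ * (2 * ENNReal.ofReal |f z| +
        eVariationOn f (branch D j)) + eVariationOn H (T '' branch D j) := by
    intro s t hzs hzt hs ht hst
    have hTz : T z ∈ T '' branch D j := ⟨z, hz, rfl⟩
    have hl : eVariationOn H (Iic (T z)) ≤ ENNReal.ofReal θ * (ENNReal.ofReal |f z| +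
        eVariationOn f (branch D j ∩ s)) + eVariationOn H (T '' branch D j ∩ Iic (T z)) := by
      refine eVariationOn_Iic_le_of_eq_zero hTz hzero ?_
      rintro _ ⟨y, hy, rfl⟩ hyz
      gcongr
      · exact hend s hzs y hy (hs y hy hyz)
      · exact eVariationOn.mono _ (inter_subset_inter_right _ Icc_subset_Iic_self)
    have hr : eVariationOn H (Ici (T z)) ≤ ENNReal.ofReal θ * (ENNReal.ofReal |f z| +
        eVariationOn f (branch D j ∩ t)) + eVariationOn H (T '' branch D j ∩ Ici (T z)) := by
      refine eVariationOn_Ici_le_of_eq_zero hTz hzero ?_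
      rintro _ ⟨y, hy, rfl⟩ hyz
      gcongr
      · exact hend t hzt y hy (ht y hy hyz)
      · exact eVariationOn.mono _ (inter_subset_inter_right _ Icc_subset_Ici_self)
    rw [eVariationOn_univ_eq H (T z), ← eVariationOn_split H hTz, ← hst]
    refine (add_le_add hl hr).trans (le_of_eq ?_)
    ring
  have htot : eVariationOn H univ ≤ ENNReal.ofReal θ * (2 * ENNReal.ofReal |f z| +
        eVariationOn f (branch D j)) + eVariationOn H (T '' branch D j) := by
    rcases hT.strictMonoOn_or_strictAntiOn j with h | h
    · exact hmain (Iic z) (Ici z) self_mem_Iic self_mem_Ici (fun y hy h' => (h.le_iff_le hy hz).1 h')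
        (fun y hy h' => (h.le_iff_le hz hy).1 h') (eVariationOn_split f hz)
    · exact hmain (Ici z) (Iic z) self_mem_Ici self_mem_Iic (fun y hy h' => (h.le_iff_ge hy hz).1 h')
        (fun y hy h' => (h.le_iff_ge hz hy).1 h') (by rw [add_comm]; exact eVariationOn_split f hz)
  refine htot.trans ((add_le_add le_rfl hHS).trans (le_of_eq ?_))
  rw [ENNReal.ofReal_mul (by positivity), ENNReal.ofReal_add (by positivity) hε,
    ENNReal.ofReal_mul (by norm_num)]
  simp only [ENNReal.ofReal_ofNat]
  ring

/-- The Lasota-Yorke inequality, with a constant smaller than one. -/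
theorem exists_eVariationOn_transferOp_le (hT : IsPiecewiseExpanding T D) :
    ∃ α C : ℝ, 0 < α ∧ α < 1 ∧ 0 ≤ C ∧ ∀ f : ℝ → ℝ, IntegrableOn f (Icc 0 1) →
      ∃ g : ℝ → ℝ, transferOp T f =ᵐ[volume.restrict (Icc (0 : ℝ) 1)] g ∧
        eVariationOn g (Ioo 0 1) ≤ ENNReal.ofReal α * eVariationOn f (Ioo 0 1) +
          ENNReal.ofReal (C * ∫ x in Icc (0 : ℝ) 1, |f x|) := by
  obtain ⟨c, hc, hc'⟩ := hT.expanding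
  have hc0 : 0 < c := by linarith
  have hθ1 : 2 * (1 / c) < 1 := by rw [← mul_div_assoc, mul_one, div_lt_one hc0]; exact hc
  set ε : ℝ := (1 - 2 * (1 / c)) / 2 with hε
  have hε0 : 0 < ε := by linarith
  obtain ⟨D', hDD, hT', hvar⟩ := hT.exists_refinement hε0
  set α : ℝ := 2 * (1 / c) + ε with hα
  have hα0 : 0 < α := by positivity
  set C : ℕ → ℝ := fun j => α * (volume.real (branch D' j))⁻¹ with hC
  have hCnn : ∀ j, 0 ≤ C j := fun j => by positivity
  refine ⟨α, ∑ j ∈ Finset.range (D'.card + 1), C j, hα0, by linarith,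
    Finset.sum_nonneg fun j _ => hCnn j, fun f hf => ⟨_, hT'.transferOp_ae_eq_sum f _, ?_⟩⟩
  have hI : 0 ≤ ∫ x in Icc (0 : ℝ) 1, |f x| := integral_nonneg fun _ => abs_nonneg _
  have hterm : ∀ j, eVariationOn (branchTerm T D' j f) univ ≤
      ENNReal.ofReal α * eVariationOn f (branch D' j) +
        ENNReal.ofReal (C j * ∫ x in Icc (0 : ℝ) 1, |f x|) := by
    intro j
    rcases (branch D' j).eq_empty_or_nonempty with he | hne
    · have : branchTerm T D' j f = fun _ => 0 := by
        ext x; exact branchTerm_eq_zero T D' (by simp [he]) f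
      rw [this, eVariationOn.constant_on (by rintro _ ⟨_, _, rfl⟩ _ ⟨_, _, rfl⟩; rfl)]
      exact zero_le
    · have hpos : volume (branch D' j) ≠ 0 := ((isOpen_branch D' j).measure_pos volume hne).ne'
      have hfin : volume (branch D' j) ≠ ⊤ :=
        ne_top_of_le_ne_top (by simp) (measure_mono (branch_subset_Icc D' j))
      have hf' : IntegrableOn (fun x => |f x|) (Icc 0 1) := hf.abs
      obtain ⟨z, hz, hzle⟩ := exists_le_setAverage hpos hfin
        (hf'.mono_set (branch_subset_Icc D' j))
      have hz2 : |f z| ≤ (volume.real (branch D' j))⁻¹ * ∫ x in Icc (0 : ℝ) 1, |f x| := by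
        refine hzle.trans ?_
        rw [setAverage_eq, smul_eq_mul]
        gcongr
        · exact ae_of_all _ fun _ => abs_nonneg _
        · exact branch_subset_Icc D' j
      refine (hT'.eVariationOn_branchTerm_le (θ := 1 / c) (by positivity) hε0.le (fun y hy => ?_)
        (hvar j) f hz).trans ?_
      · refine one_div_le_one_div_of_le hc0 (hc' y ⟨branch_subset_Icc D' j hy, fun h => ?_⟩)
        exact hy.2.1 (hDD h)
      · refine add_le_add le_rfl (ENNReal.ofReal_le_ofReal ?_)
        rw [hC]
        simp only
        rw [mul_assoc]
        gcongr
  calc eVariationOn (fun x => ∑ j ∈ Finset.range (D'.card + 1), branchTerm T D' j f x) (Ioo 0 1)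
      ≤ ∑ j ∈ Finset.range (D'.card + 1), eVariationOn (branchTerm T D' j f) univ :=
        (eVariationOn.mono _ (subset_univ _)).trans (eVariationOn_sum_le _ _ _)
    _ ≤ ∑ j ∈ Finset.range (D'.card + 1), (ENNReal.ofReal α * eVariationOn f (branch D' j) +
          ENNReal.ofReal (C j * ∫ x in Icc (0 : ℝ) 1, |f x|)) :=
        Finset.sum_le_sum fun j _ => hterm j
    _ ≤ _ := by
        rw [Finset.sum_add_distrib, ← Finset.mul_sum, Finset.sum_mul,
          ENNReal.ofReal_sum_of_nonneg fun j _ => mul_nonneg (hCnn j) hI]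
        gcongr
        exact sum_eVariationOn_le f (fun i j hij x hx y hy => branch_le hij hx hy) _
          fun j _ => branch_subset_Ioo D' j

end IsPiecewiseExpanding


/-! ### Step functions and cell averages -/

lemma natCast_pos_of_pos {k : ℕ} (hk : 0 < k) : (0 : ℝ) < k := by exact_mod_cast hk

lemma mem_cell_iff {k : ℕ} (hk : 0 < k) (i : Fin k) {x : ℝ} (hx : 0 ≤ x) :
    x ∈ cell k i ↔ ⌊k * x⌋₊ = i := by
  have hk' := natCast_pos_of_pos hk
  rw [Nat.floor_eq_iff (by positivity), cell, mem_Ico, div_le_iff₀ hk', lt_div_iff₀ hk', mul_comm x]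

lemma nonneg_of_mem_cell {k : ℕ} {i : Fin k} {x : ℝ} (hx : x ∈ cell k i) : 0 ≤ x :=
  le_trans (by positivity) hx.1

lemma cell_subset_Ico {k : ℕ} (i : Fin k) : cell k i ⊆ Ico 0 1 := by
  intro x hx
  have hk' : (0 : ℝ) < k := natCast_pos_of_pos i.pos
  refine ⟨nonneg_of_mem_cell hx, hx.2.trans_le ?_⟩
  rw [div_le_one hk']
  exact_mod_cast i.2

lemma cell_subset_Icc {k : ℕ} (i : Fin k) : cell k i ⊆ Icc 0 1 :=
  (cell_subset_Ico i).trans Ico_subset_Icc_self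

lemma floor_lt_of_lt_one {k : ℕ} (hk : 0 < k) {x : ℝ} (hx : x < 1) : ⌊k * x⌋₊ < k := by
  rw [Nat.floor_lt' hk.ne']
  have hk' := natCast_pos_of_pos hk
  nlinarith

lemma exists_mem_cell {k : ℕ} (hk : 0 < k) {x : ℝ} (hx : x ∈ Ico (0 : ℝ) 1) :
    ∃ i, x ∈ cell k i :=
  ⟨⟨⌊k * x⌋₊, floor_lt_of_lt_one hk hx.2⟩, (mem_cell_iff hk _ hx.1).2 rfl⟩

lemma measurableSet_cell {k : ℕ} (i : Fin k) : MeasurableSet (cell k i) := measurableSet_Ico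

lemma pairwise_disjoint_cell (k : ℕ) : Pairwise (Function.onFun Disjoint (cell k)) := by
  intro i j hij
  refine Set.disjoint_left.2 fun x hx hx' => hij ?_
  have hx0 := nonneg_of_mem_cell hx
  rw [mem_cell_iff i.pos _ hx0] at hx hx'
  exact Fin.ext (hx.symm.trans hx')

lemma volume_real_cell {k : ℕ} (i : Fin k) : volume.real (cell k i) = 1 / k := by
  have hk' : (0 : ℝ) < k := natCast_pos_of_pos i.pos
  rw [cell, Real.volume_real_Ico_of_le (by gcongr; linarith)]
  ring

lemma iUnion_cell {k : ℕ} (hk : 0 < k) : ⋃ i, cell k i = Ico 0 1 :=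
  Subset.antisymm (iUnion_subset cell_subset_Ico) fun _ hx => mem_iUnion.2 (exists_mem_cell hk hx)

lemma setIntegral_Icc_eq_sum_cell {k : ℕ} (hk : 0 < k) {g : ℝ → ℝ}
    (hg : IntegrableOn g (Icc 0 1)) :
    ∫ x in Icc (0 : ℝ) 1, g x = ∑ i, ∫ x in cell k i, g x := by
  rw [integral_Icc_eq_integral_Ico, ← iUnion_cell hk,
    integral_iUnion_fintype measurableSet_cell (pairwise_disjoint_cell k)]
  exact fun i => hg.mono_set (cell_subset_Icc i)

lemma stepFun_apply {k : ℕ} (w : Fin k → ℝ) {i : Fin k} {x : ℝ} (hx : x ∈ cell k i) :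
    stepFun k w x = k * w i := by
  rw [stepFun, Finset.sum_eq_single i]
  · rw [indicator_of_mem hx]
  · intro j _ hj
    exact indicator_of_notMem (fun h => Set.disjoint_left.1 (pairwise_disjoint_cell k hj) h hx) _
  · simp

lemma integrable_stepFun (k : ℕ) (w : Fin k → ℝ) : Integrable (stepFun k w) := by
  refine integrable_finsetSum _ fun i _ => ?_
  refine (integrable_indicator_iff (measurableSet_cell i)).2 (integrableOn_const ?_)
  exact ne_top_of_le_ne_top (by simp) (measure_mono (cell_subset_Icc i))

lemma setIntegral_cell_const {k : ℕ} (i : Fin k) (a : ℝ) : ∫ _ in cell k i, a = a / k := by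
  rw [setIntegral_const, volume_real_cell, smul_eq_mul]; ring

lemma setIntegral_cell_stepFun {k : ℕ} (w : Fin k → ℝ) (i : Fin k) :
    ∫ x in cell k i, stepFun k w x = w i := by
  have hk' : (0 : ℝ) < k := natCast_pos_of_pos i.pos
  rw [setIntegral_congr_fun (measurableSet_cell i) fun x hx => stepFun_apply w hx,
    setIntegral_cell_const]
  field_simp

lemma integral_stepFun {k : ℕ} (hk : 0 < k) (w : Fin k → ℝ) :
    ∫ x in Icc (0 : ℝ) 1, stepFun k w x = ∑ i, w i := by
  rw [setIntegral_Icc_eq_sum_cell hk (integrable_stepFun k w).integrableOn]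
  simp_rw [setIntegral_cell_stepFun]

lemma integral_abs_stepFun {k : ℕ} (hk : 0 < k) (w : Fin k → ℝ) :
    ∫ x in Icc (0 : ℝ) 1, |stepFun k w x| = ∑ i, |w i| := by
  rw [setIntegral_Icc_eq_sum_cell hk (integrable_stepFun k w).integrableOn.abs]
  refine Finset.sum_congr rfl fun i _ => ?_
  have hk' : (0 : ℝ) < k := natCast_pos_of_pos hk
  rw [setIntegral_congr_fun (g := fun _ => |k * w i|) (measurableSet_cell i)
    fun x hx => by simp only [stepFun_apply w hx], setIntegral_cell_const, abs_mul,
    abs_of_pos hk']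
  field_simp

lemma cellAverage_stepFun (k : ℕ) (w : Fin k → ℝ) : cellAverage k (stepFun k w) = stepFun k w := by
  simp_rw [cellAverage, setIntegral_cell_stepFun]

lemma stepFun_add (k : ℕ) (v w : Fin k → ℝ) (x : ℝ) :
    stepFun k (fun i => v i + w i) x = stepFun k v x + stepFun k w x := by
  simp only [stepFun, ← Finset.sum_add_distrib]
  refine Finset.sum_congr rfl fun i _ => ?_
  by_cases hx : x ∈ cell k i <;> simp [hx, mul_add]

lemma stepFun_smul (k : ℕ) (c : ℝ) (w : Fin k → ℝ) (x : ℝ) :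
    stepFun k (fun i => c * w i) x = c * stepFun k w x := by
  simp only [stepFun, Finset.mul_sum]
  refine Finset.sum_congr rfl fun i _ => ?_
  by_cases hx : x ∈ cell k i <;> simp [hx]; ring

lemma integral_abs_cellAverage_le {k : ℕ} (hk : 0 < k) {f : ℝ → ℝ} (hf : IntegrableOn f (Icc 0 1)) :
    ∫ x in Icc (0 : ℝ) 1, |cellAverage k f x| ≤ ∫ x in Icc (0 : ℝ) 1, |f x| := by
  rw [cellAverage, integral_abs_stepFun hk, setIntegral_Icc_eq_sum_cell hk hf.abs]
  exact Finset.sum_le_sum fun i _ => abs_integral_le_integral_abs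

lemma eVariationOn_comp_floor_le {k : ℕ} (hk : 0 < k) (A : ℕ → ℝ) :
    eVariationOn (fun x : ℝ => A ⌊k * x⌋₊) (Ioo 0 1) ≤
      ENNReal.ofReal (∑ j ∈ Finset.range (k - 1), |A (j + 1) - A j|) := by
  have hk' := natCast_pos_of_pos hk
  set B : ℕ → ℝ := fun n => ∑ j ∈ Finset.range n, |A (j + 1) - A j| with hB
  have hAB : ∀ m n, m ≤ n → |A n - A m| ≤ B n - B m := by
    intro m n hmn
    induction n, hmn using Nat.le_induction with
    | base => simp
    | succ n _ ih =>
      have : B (n + 1) = B n + |A (n + 1) - A n| := Finset.sum_range_succ _ _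
      have h2 := abs_add_le (A (n + 1) - A n) (A n - A m)
      rw [show A (n + 1) - A n + (A n - A m) = A (n + 1) - A m by ring] at h2
      linarith
  have hBmono : Monotone B := monotone_nat_of_le_succ fun n => by
    rw [hB]; simp only [Finset.sum_range_succ]; linarith [abs_nonneg (A (n + 1) - A n)]
  refine eVariationOn_le_of_abs_sub_le (F := fun x => B ⌊k * x⌋₊) (fun x _ y _ hxy => ?_)
    fun x _ y hy _ => ?_
  · exact hAB _ _ (Nat.floor_mono (by gcongr))
  · have h0 : 0 ≤ B ⌊k * x⌋₊ := Finset.sum_nonneg fun _ _ => abs_nonneg _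
    have h1 : B ⌊k * y⌋₊ ≤ B (k - 1) := hBmono (by have := floor_lt_of_lt_one hk hy.2; omega)
    linarith

lemma stepFun_eq_comp_floor {k : ℕ} (hk : 0 < k) (w : Fin k → ℝ) {a : ℕ → ℝ}
    (ha : ∀ i : Fin k, a i = w i) :
    EqOn (stepFun k w) (fun x => k * a ⌊k * x⌋₊) (Ioo 0 1) := by
  intro x hx
  obtain ⟨i, hi⟩ := exists_mem_cell hk (Ioo_subset_Ico_self hx)
  simp only
  rw [stepFun_apply w hi, (mem_cell_iff hk i hx.1.le).1 hi, ha]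

lemma eVariationOn_stepFun_le {k : ℕ} (hk : 0 < k) (w : Fin k → ℝ) :
    eVariationOn (stepFun k w) (Ioo 0 1) ≤ ENNReal.ofReal (2 * k * ∑ i, |w i|) := by
  set a : ℕ → ℝ := fun n => if h : n < k then w ⟨n, h⟩ else 0 with ha
  have ha' : ∀ i : Fin k, a i = w i := fun i => by simp [ha]
  have hk' := natCast_pos_of_pos hk
  rw [eVariationOn.congr (stepFun_eq_comp_floor hk w ha')]
  refine (eVariationOn_comp_floor_le hk fun n => k * a n).trans (ENNReal.ofReal_le_ofReal ?_)
  have h1 : ∑ i, |w i| = ∑ j ∈ Finset.range k, |a j| := by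
    rw [← Fin.sum_univ_eq_sum_range (fun j => |a j|)]
    simp_rw [ha']
  have h2 : ∑ j ∈ Finset.range (k - 1), |a j| ≤ ∑ j ∈ Finset.range k, |a j| :=
    Finset.sum_le_sum_of_subset_of_nonneg (by simp) fun _ _ _ => abs_nonneg _
  have h3 : ∑ j ∈ Finset.range (k - 1), |a (j + 1)| ≤ ∑ j ∈ Finset.range k, |a j| := by
    obtain ⟨m, rfl⟩ : ∃ m, k = m + 1 := ⟨k - 1, by omega⟩
    rw [Finset.sum_range_succ' _ m]
    simp
  calc ∑ j ∈ Finset.range (k - 1), |k * a (j + 1) - k * a j|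
      ≤ ∑ j ∈ Finset.range (k - 1), (k * |a (j + 1)| + k * |a j|) := by
        refine Finset.sum_le_sum fun j _ => (abs_sub _ _).trans (le_of_eq ?_)
        rw [abs_mul, abs_mul, abs_of_pos hk']
    _ = k * ∑ j ∈ Finset.range (k - 1), |a (j + 1)| + k * ∑ j ∈ Finset.range (k - 1), |a j| := by
        rw [Finset.sum_add_distrib, Finset.mul_sum, Finset.mul_sum]
    _ ≤ k * ∑ j ∈ Finset.range k, |a j| + k * ∑ j ∈ Finset.range k, |a j| := by gcongr
    _ = _ := by rw [h1]; ring

lemma integrableOn_Icc_of_eVariationOn_Ioo {f : ℝ → ℝ} (hf : BoundedVariationOn f (Ioo 0 1)) :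
    IntegrableOn f (Icc 0 1) := by
  rw [integrableOn_Icc_iff_integrableOn_Ioo]
  exact integrableOn_of_boundedVariationOn measurableSet_Ioo (by simp) hf

lemma eVariationOn_cellAverage_le {k : ℕ} (hk : 0 < k) (f : ℝ → ℝ) :
    eVariationOn (cellAverage k f) (Ioo 0 1) ≤ eVariationOn f (Ioo 0 1) := by
  by_cases hV : eVariationOn f (Ioo 0 1) = ⊤
  · rw [hV]; exact le_top
  have hk' := natCast_pos_of_pos hk
  have hint := integrableOn_Icc_of_eVariationOn_Ioo hV
  set V := (eVariationOn f (Ioo 0 1)).toReal with hVdef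
  set a : ℕ → ℝ := fun j => ∫ x in Ioo (0 : ℝ) (1 / k), f (x + j / k) with ha
  have htrans : ∀ j : ℕ, j < k → IntegrableOn (fun x => f (x + j / k)) (Ioo (0 : ℝ) (1 / k)) ∧
      a j = ∫ x in Ico ((j : ℝ) / k) ((j + 1) / k), f x := by
    intro j hj
    have hle : (j : ℝ) / k ≤ (j + 1) / k := by gcongr; linarith
    have hii : IntervalIntegrable f volume ((j : ℝ) / k) ((j + 1) / k) := by
      rw [intervalIntegrable_iff_integrableOn_Icc_of_le hle]
      refine hint.mono_set (Icc_subset_Icc (by positivity) ?_)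
      rw [div_le_one hk']; exact_mod_cast hj
    have h0 : (0 : ℝ) ≤ 1 / k := by positivity
    constructor
    · have := hii.comp_add_right (j / k : ℝ)
      rw [sub_self, ← sub_div, add_sub_cancel_left,
        intervalIntegrable_iff_integrableOn_Ioo_of_le h0] at this
      exact this
    · rw [ha]
      simp only
      rw [← integral_Ioc_eq_integral_Ioo, ← intervalIntegral.integral_of_le h0,
        intervalIntegral.integral_comp_add_right, integral_Ico_eq_integral_Ioc,
        ← intervalIntegral.integral_of_le hle, zero_add, ← add_div, add_comm (1 : ℝ)]
  have hsum : ∀ x ∈ Ioo (0 : ℝ) (1 / k),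
      ∑ j ∈ Finset.range (k - 1), |f (x + (j + 1 : ℕ) / k) - f (x + j / k)| ≤ V := by
    intro x hx
    have hmono : Monotone fun j : ℕ => x + (j : ℝ) / k := fun i j hij => by
      simp only; gcongr
    have h1 := eVariationOn.sum_le_of_monotoneOn_Iic (f := f) (s := Ioo 0 1) (n := k - 1)
      (hmono.monotoneOn _) (fun j hj => ⟨by have := hx.1; positivity, ?_⟩)
    · rw [← ENNReal.ofReal_le_ofReal_iff ENNReal.toReal_nonneg, ENNReal.ofReal_toReal hV,
        ENNReal.ofReal_sum_of_nonneg fun _ _ => abs_nonneg _]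
      refine le_trans (le_of_eq (Finset.sum_congr rfl fun j _ => ?_)) h1
      rw [edist_dist, Real.dist_eq]
    · have h2 : (j : ℝ) + 1 ≤ k := by
        have : j + 1 ≤ k := by omega
        exact_mod_cast this
      calc x + (j : ℝ) / k < 1 / k + j / k := by linarith [hx.2]
        _ = (j + 1) / k := by ring
        _ ≤ 1 := by rwa [div_le_one hk']
  have hstep := stepFun_eq_comp_floor hk (fun i : Fin k => ∫ x in cell k i, f x) (a := a)
    fun i => (htrans i i.2).2
  rw [cellAverage, eVariationOn.congr hstep, ← ENNReal.ofReal_toReal hV]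
  refine (eVariationOn_comp_floor_le hk fun n => k * a n).trans (ENNReal.ofReal_le_ofReal ?_)
  have hi : ∀ j ∈ Finset.range (k - 1), IntegrableOn
      (fun x => |f (x + (j + 1 : ℕ) / k) - f (x + j / k)|) (Ioo (0 : ℝ) (1 / k)) := by
    intro j hj
    have := Finset.mem_range.1 hj
    exact ((htrans (j + 1) (by omega)).1.sub (htrans j (by omega)).1).abs
  calc ∑ j ∈ Finset.range (k - 1), |k * a (j + 1) - k * a j|
      ≤ ∑ j ∈ Finset.range (k - 1),
          k * ∫ x in Ioo (0 : ℝ) (1 / k), |f (x + (j + 1 : ℕ) / k) - f (x + j / k)| := by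
        refine Finset.sum_le_sum fun j hj => ?_
        have := Finset.mem_range.1 hj
        rw [← mul_sub, abs_mul, abs_of_pos hk', ha]
        simp only
        rw [← integral_sub (htrans (j + 1) (by omega)).1 (htrans j (by omega)).1]
        gcongr
        exact abs_integral_le_integral_abs
    _ = k * ∫ x in Ioo (0 : ℝ) (1 / k),
          ∑ j ∈ Finset.range (k - 1), |f (x + (j + 1 : ℕ) / k) - f (x + j / k)| := by
        rw [integral_finsetSum _ hi, Finset.mul_sum]
    _ ≤ k * ∫ x in Ioo (0 : ℝ) (1 / k), V := by
        refine mul_le_mul_of_nonneg_left ?_ hk'.le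
        exact setIntegral_mono_on (integrable_finsetSum _ hi)
          (integrableOn_const (by simp)) measurableSet_Ioo hsum
    _ = V := by
        rw [setIntegral_const, Real.volume_real_Ioo_of_le (by positivity), smul_eq_mul]
        field_simp
        ring

lemma sum_eVariationOn_cell_le {k : ℕ} (f : ℝ → ℝ) :
    ∑ i : Fin k, eVariationOn f (cell k i ∩ Ioo 0 1) ≤ eVariationOn f (Ioo 0 1) := by
  have := Fin.sum_univ_eq_sum_range
    (fun j => eVariationOn f (Ico ((j : ℝ) / k) ((j + 1) / k) ∩ Ioo 0 1)) k
  refine (le_of_eq this).trans (sum_eVariationOn_le f ?_ k fun _ _ => inter_subset_right)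
  intro i j hij x hx y hy
  refine hx.1.2.le.trans (le_trans ?_ hy.1.1)
  gcongr
  exact_mod_cast hij

lemma cell_inter_ae_eq {k : ℕ} (i : Fin k) : (cell k i ∩ Ioo 0 1 : Set ℝ) =ᵐ[volume] cell k i := by
  have h : ∀ᵐ x : ℝ, x ≠ 0 := by simp [ae_iff]
  filter_upwards [h] with x hx
  refine propext ⟨fun h => h.1, fun h => ⟨h, ?_⟩⟩
  have h1 := cell_subset_Ico i h
  exact ⟨lt_of_le_of_ne h1.1 hx.symm, h1.2⟩

lemma setIntegral_cell_mono {k : ℕ} {i : Fin k} {f g : ℝ → ℝ} (hf : IntegrableOn f (Icc 0 1))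
    (hg : IntegrableOn g (Icc 0 1)) (h : ∀ x ∈ cell k i ∩ Ioo 0 1, f x ≤ g x) :
    ∫ x in cell k i, f x ≤ ∫ x in cell k i, g x := by
  rw [← setIntegral_congr_set (cell_inter_ae_eq i), ← setIntegral_congr_set (cell_inter_ae_eq i)]
  have hs : cell k i ∩ Ioo 0 1 ⊆ Icc 0 1 := inter_subset_right.trans Ioo_subset_Icc_self
  exact setIntegral_mono_on (hf.mono_set hs) (hg.mono_set hs)
    ((measurableSet_cell i).inter measurableSet_Ioo) h

lemma sum_toReal_eVariationOn_cell_le {k : ℕ} {f : ℝ → ℝ} {V : ℝ} (hV : 0 ≤ V)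
    (hf : eVariationOn f (Ioo 0 1) ≤ ENNReal.ofReal V) :
    (∀ i : Fin k, eVariationOn f (cell k i ∩ Ioo 0 1) ≠ ⊤) ∧
      ∑ i : Fin k, (eVariationOn f (cell k i ∩ Ioo 0 1)).toReal ≤ V := by
  have hfin : ∀ i : Fin k, eVariationOn f (cell k i ∩ Ioo 0 1) ≠ ⊤ := fun i =>
    ne_top_of_le_ne_top ENNReal.ofReal_ne_top
      ((eVariationOn.mono _ inter_subset_right).trans hf)
  refine ⟨hfin, ?_⟩
  rw [← ENNReal.toReal_sum fun i _ => hfin i]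
  exact ENNReal.toReal_le_of_le_ofReal hV ((sum_eVariationOn_cell_le f).trans hf)

lemma integral_abs_cellAverage_sub_le {k : ℕ} (hk : 0 < k) {f : ℝ → ℝ} {V : ℝ} (hV : 0 ≤ V)
    (hf : eVariationOn f (Ioo 0 1) ≤ ENNReal.ofReal V) :
    ∫ x in Icc (0 : ℝ) 1, |cellAverage k f x - f x| ≤ 1 / k * V := by
  have hk' := natCast_pos_of_pos hk
  have hint := integrableOn_Icc_of_eVariationOn_Ioo (ne_top_of_le_ne_top ENNReal.ofReal_ne_top hf)
  obtain ⟨hfin, hsum⟩ := sum_toReal_eVariationOn_cell_le (k := k) hV hf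
  have hci : ∀ a : ℝ, IntegrableOn (fun _ => a) (Icc (0 : ℝ) 1) := fun a =>
    integrableOn_const (by simp)
  have hcell : ∀ i : Fin k, ∫ x in cell k i, |cellAverage k f x - f x| ≤
      1 / k * (eVariationOn f (cell k i ∩ Ioo 0 1)).toReal := by
    intro i
    set W := (eVariationOn f (cell k i ∩ Ioo 0 1)).toReal
    have hd : ∀ x ∈ cell k i ∩ Ioo 0 1, ∀ y ∈ cell k i ∩ Ioo 0 1, |f x - f y| ≤ W :=
      fun x hx y hy => by
        have := BoundedVariationOn.dist_le (hfin i) hx hy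
        rwa [Real.dist_eq] at this
    calc ∫ x in cell k i, |cellAverage k f x - f x| ≤ ∫ x in cell k i, W := by
          refine setIntegral_cell_mono ((integrable_stepFun k _).integrableOn.sub hint).abs
            (hci _) fun x hx => ?_
          have h1 : ∫ y in cell k i, f y ≤ ∫ y in cell k i, (f x + W) :=
            setIntegral_cell_mono hint (hci _) fun y hy => by
              linarith [(abs_le.1 (hd x hx y hy)).1]
          have h2 : ∫ y in cell k i, (f x - W) ≤ ∫ y in cell k i, f y :=
            setIntegral_cell_mono (hci _) hint fun y hy => by
              linarith [(abs_le.1 (hd x hx y hy)).2]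
          rw [setIntegral_cell_const, le_div_iff₀ hk', mul_comm] at h1
          rw [setIntegral_cell_const, div_le_iff₀ hk', mul_comm _ (k : ℝ)] at h2
          rw [cellAverage, stepFun_apply _ hx.1, abs_le]
          constructor <;> linarith
      _ = 1 / k * W := by rw [setIntegral_cell_const]; ring
  have hint' : IntegrableOn (fun x => |cellAverage k f x - f x|) (Icc 0 1) :=
    ((integrable_stepFun k _).integrableOn.sub hint).abs
  rw [setIntegral_Icc_eq_sum_cell hk hint']
  calc _ ≤ ∑ i : Fin k, 1 / k * (eVariationOn f (cell k i ∩ Ioo 0 1)).toReal :=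
        Finset.sum_le_sum fun i _ => hcell i
    _ ≤ _ := by rw [← Finset.mul_sum]; gcongr

/-- A function of small variation compared to its integral is large on a whole cell. -/
lemma exists_cell_le {k : ℕ} (hk : 0 < k) {f : ℝ → ℝ} {V κ : ℝ} (hV : 0 ≤ V)
    (hf : eVariationOn f (Ioo 0 1) ≤ ENNReal.ofReal V)
    (h : κ + 1 / k * V < ∫ x in Icc (0 : ℝ) 1, f x) :
    ∃ i, ∀ x ∈ cell k i ∩ Ioo 0 1, κ ≤ f x := by
  have hk' := natCast_pos_of_pos hk
  have hint := integrableOn_Icc_of_eVariationOn_Ioo (ne_top_of_le_ne_top ENNReal.ofReal_ne_top hf)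
  obtain ⟨hfin, hsum⟩ := sum_toReal_eVariationOn_cell_le (k := k) hV hf
  have hci : ∀ a : ℝ, IntegrableOn (fun _ => a) (Icc (0 : ℝ) 1) := fun a =>
    integrableOn_const (by simp)
  by_contra! hcon
  rw [setIntegral_Icc_eq_sum_cell hk hint] at h
  refine absurd h (not_lt.2 ?_)
  calc ∑ i : Fin k, ∫ x in cell k i, f x
      ≤ ∑ i : Fin k, (κ + (eVariationOn f (cell k i ∩ Ioo 0 1)).toReal) / k := by
        refine Finset.sum_le_sum fun i _ => ?_
        obtain ⟨z, hz, hzκ⟩ := hcon i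
        rw [← setIntegral_cell_const i]
        refine setIntegral_cell_mono hint (hci _) fun x hx => ?_
        have := BoundedVariationOn.dist_le (hfin i) hx hz
        rw [Real.dist_eq] at this
        linarith [le_abs_self (f x - f z)]
    _ = κ + 1 / k * ∑ i : Fin k, (eVariationOn f (cell k i ∩ Ioo 0 1)).toReal := by
        rw [← Finset.sum_div, Finset.sum_add_distrib]
        simp only [Finset.sum_const, Finset.card_univ, Fintype.card_fin, nsmul_eq_mul]
        field_simp
    _ ≤ κ + 1 / k * V := by gcongr


/-! ### The operators on `L¹[0,1]` -/

/-- Lebesgue measure on `[0,1]`. -/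
noncomputable abbrev unitMeasure : Measure ℝ := volume.restrict (Icc (0 : ℝ) 1)

/-- The space `L¹[0,1]`. -/
abbrev UnitL1 : Type := Lp ℝ 1 unitMeasure

lemma integrable_coeFn (x : UnitL1) : Integrable x unitMeasure := L1.integrable_coeFn x

lemma norm_toL1_eq {f : ℝ → ℝ} (hf : Integrable f unitMeasure) :
    ‖hf.toL1 f‖ = ∫ x in Icc (0 : ℝ) 1, |f x| :=
  L1.norm_of_fun_eq_integral_norm hf

lemma norm_toL1_sub_eq {f g : ℝ → ℝ} (hf : Integrable f unitMeasure)
    (hg : Integrable g unitMeasure) : ‖hf.toL1 f - hg.toL1 g‖ = l1Dist f g := by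
  rw [← Integrable.toL1_sub, norm_toL1_eq]
  rfl

/-- The integral of an element of `L¹[0,1]`. -/
noncomputable def mean : UnitL1 →L[ℝ] ℝ := L1.integralCLM

lemma mean_eq (x : UnitL1) : mean x = ∫ t in Icc (0 : ℝ) 1, x t := by
  rw [← L1.integral_eq_integral, L1.integral_eq]; rfl

lemma mean_toL1 {f : ℝ → ℝ} (hf : Integrable f unitMeasure) :
    mean (hf.toL1 f) = ∫ x in Icc (0 : ℝ) 1, f x := by
  rw [mean_eq]
  exact integral_congr_ae hf.coeFn_toL1

lemma norm_eq_mean {x : UnitL1} (hx : 0 ≤ x) : ‖x‖ = mean x := by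
  rw [L1.norm_eq_integral_norm, mean_eq]
  refine integral_congr_ae ?_
  filter_upwards [(Lp.coeFn_nonneg x).2 hx] with t ht
  exact abs_of_nonneg ht

lemma mean_le_norm (x : UnitL1) : mean x ≤ ‖x‖ := by
  rw [L1.norm_eq_integral_norm, mean_eq]
  exact integral_mono (integrable_coeFn x) (integrable_coeFn x).norm fun t => le_abs_self _

/-- A linear contraction for the `L¹` norm, defined on integrable functions. -/
structure IsL1Contraction (Φ : (ℝ → ℝ) → ℝ → ℝ) : Prop where
  integrable : ∀ f, Integrable f unitMeasure → Integrable (Φ f) unitMeasure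
  add : ∀ f g, Integrable f unitMeasure → Integrable g unitMeasure →
    Φ (f + g) =ᵐ[unitMeasure] Φ f + Φ g
  smul : ∀ (c : ℝ) f, Integrable f unitMeasure → Φ (c • f) =ᵐ[unitMeasure] c • Φ f
  norm_le : ∀ f, Integrable f unitMeasure →
    ∫ x in Icc (0 : ℝ) 1, |Φ f x| ≤ ∫ x in Icc (0 : ℝ) 1, |f x|

namespace IsL1Contraction

variable {Φ : (ℝ → ℝ) → ℝ → ℝ}

lemma ae_eq (h : IsL1Contraction Φ) {f g : ℝ → ℝ} (hf : Integrable f unitMeasure)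
    (hfg : f =ᵐ[unitMeasure] g) : Φ f =ᵐ[unitMeasure] Φ g := by
  have hg : Integrable g unitMeasure := hf.congr hfg
  have hd : Integrable ((-1 : ℝ) • g + f) unitMeasure := (hg.smul (-1 : ℝ)).add hf
  have h1 := h.norm_le _ hd
  have h2 : ∫ x in Icc (0 : ℝ) 1, |((-1 : ℝ) • g + f) x| = 0 := by
    refine integral_eq_zero_of_ae ?_
    filter_upwards [hfg] with x hx
    simp [hx]
  rw [h2] at h1
  have h3 : (fun x => |Φ ((-1 : ℝ) • g + f) x|) =ᵐ[unitMeasure] 0 :=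
    (integral_eq_zero_iff_of_nonneg (fun x => abs_nonneg _) (h.integrable _ hd).abs).1
      (le_antisymm h1 (integral_nonneg fun x => abs_nonneg _))
  filter_upwards [h3, h.add _ _ (hg.smul (-1 : ℝ)) hf, h.smul (-1) g hg] with x hx1 hx2 hx3
  simp only [Pi.zero_apply, abs_eq_zero] at hx1
  rw [hx2, Pi.add_apply, hx3, Pi.smul_apply, smul_eq_mul] at hx1
  linarith

/-- The contraction of `L¹[0,1]` induced by a contraction on integrable functions. -/
noncomputable def lift (h : IsL1Contraction Φ) : UnitL1 →L[ℝ] UnitL1 :=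
  LinearMap.mkContinuous
    { toFun := fun x => (h.integrable x (integrable_coeFn x)).toL1 (Φ x)
      map_add' := fun x y => by
        rw [← Integrable.toL1_add, Integrable.toL1_eq_toL1_iff]
        exact (h.ae_eq (integrable_coeFn _) (Lp.coeFn_add x y)).trans
          (h.add _ _ (integrable_coeFn x) (integrable_coeFn y))
      map_smul' := fun c x => by
        rw [RingHom.id_apply, ← Integrable.toL1_smul', Integrable.toL1_eq_toL1_iff]
        exact (h.ae_eq (integrable_coeFn _) (Lp.coeFn_smul c x)).trans
          (h.smul _ _ (integrable_coeFn x)) }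
    1 fun x => by
      rw [one_mul, L1.norm_eq_integral_norm x]
      exact (norm_toL1_eq (h.integrable x (integrable_coeFn x))).trans_le
        (h.norm_le x (integrable_coeFn x))

lemma lift_toL1 (h : IsL1Contraction Φ) {f : ℝ → ℝ} (hf : Integrable f unitMeasure) :
    h.lift (hf.toL1 f) = (h.integrable f hf).toL1 (Φ f) :=
  (Integrable.toL1_eq_toL1_iff _ _ (h.integrable _ (integrable_coeFn _)) _).2
    (h.ae_eq (integrable_coeFn _) hf.coeFn_toL1)

lemma norm_lift_le (h : IsL1Contraction Φ) (x : UnitL1) : ‖h.lift x‖ ≤ ‖x‖ := by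
  rw [L1.norm_eq_integral_norm x]
  exact (norm_toL1_eq (h.integrable x (integrable_coeFn x))).trans_le
    (h.norm_le x (integrable_coeFn x))

end IsL1Contraction

lemma exists_eq_toL1 (x : UnitL1) :
    ∃ (f : ℝ → ℝ) (hf : Integrable f unitMeasure), x = hf.toL1 f :=
  ⟨x, integrable_coeFn x, (Integrable.toL1_coeFn x _).symm⟩

namespace IsPiecewiseExpanding

variable {T : ℝ → ℝ} {D : Finset ℝ}

lemma branchTerm_add (hT : IsPiecewiseExpanding T D) (j : ℕ) (f g : ℝ → ℝ) (x : ℝ) :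
    branchTerm T D j (f + g) x = branchTerm T D j f x + branchTerm T D j g x := by
  by_cases hx : x ∈ T '' branch D j
  · obtain ⟨y, hy, rfl⟩ := hx
    simp only [hT.branchTerm_apply hy, Pi.add_apply, add_div]
  · simp only [branchTerm_eq_zero T D hx, add_zero]

lemma branchTerm_smul (hT : IsPiecewiseExpanding T D) (j : ℕ) (c : ℝ) (f : ℝ → ℝ) (x : ℝ) :
    branchTerm T D j (c • f) x = c * branchTerm T D j f x := by
  by_cases hx : x ∈ T '' branch D j
  · obtain ⟨y, hy, rfl⟩ := hx
    simp only [hT.branchTerm_apply hy, Pi.smul_apply, smul_eq_mul, mul_div_assoc]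
  · simp only [branchTerm_eq_zero T D hx, mul_zero]

lemma transferOp_add (hT : IsPiecewiseExpanding T D) (f g : ℝ → ℝ) :
    transferOp T (f + g) =ᵐ[unitMeasure] transferOp T f + transferOp T g := by
  filter_upwards [hT.transferOp_ae_eq_sum f _, hT.transferOp_ae_eq_sum g _,
    hT.transferOp_ae_eq_sum (f + g) _] with x h1 h2 h3
  rw [Pi.add_apply, h1, h2, h3, ← Finset.sum_add_distrib]
  exact Finset.sum_congr rfl fun j _ => hT.branchTerm_add j f g x

lemma transferOp_smul (hT : IsPiecewiseExpanding T D) (c : ℝ) (f : ℝ → ℝ) :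
    transferOp T (c • f) =ᵐ[unitMeasure] c • transferOp T f := by
  filter_upwards [hT.transferOp_ae_eq_sum f _,
    hT.transferOp_ae_eq_sum (c • f) _] with x h1 h2
  rw [Pi.smul_apply, smul_eq_mul, h1, h2, Finset.mul_sum]
  exact Finset.sum_congr rfl fun j _ => hT.branchTerm_smul j c f x

lemma abs_transferOp_le (T f : ℝ → ℝ) {x : ℝ}
    (hx : {y : ℝ | y ∈ Icc (0 : ℝ) 1 ∧ T y = x}.Finite) :
    |transferOp T f x| ≤ transferOp T (fun y => |f y|) x := by
  rw [transferOp, transferOp, finsum_mem_eq_finite_toFinset_sum _ hx,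
    finsum_mem_eq_finite_toFinset_sum _ hx]
  refine (Finset.abs_sum_le_sum_abs _ _).trans (Finset.sum_le_sum fun y _ => ?_)
  rw [abs_div, abs_abs]

lemma finite_fibre (hT : IsPiecewiseExpanding T D) (x : ℝ) :
    {y : ℝ | y ∈ Icc (0 : ℝ) 1 ∧ T y = x}.Finite := by
  refine (((Finset.range (D.card + 1)).finite_toSet.biUnion fun j _ =>
    hT.finite_branch_fibre j x).union D.finite_toSet).subset ?_
  rintro y ⟨hy, hyx⟩
  by_cases hyD : y ∈ D
  · exact .inr hyD
  · have hy' : y ∈ Ioo (0 : ℝ) 1 \ D := hT.diff_eq ▸ ⟨hy, hyD⟩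
    obtain ⟨j, hj, hyj⟩ := mem_branch_iUnion hy'.1 hyD
    exact .inl (mem_biUnion (Finset.mem_coe.2 hj) ⟨hyj, hyx⟩)

lemma integral_abs_transferOp_le (hT : IsPiecewiseExpanding T D) {f : ℝ → ℝ}
    (hf : Integrable f unitMeasure) :
    ∫ x in Icc (0 : ℝ) 1, |transferOp T f x| ≤ ∫ x in Icc (0 : ℝ) 1, |f x| := by
  have h1 := hT.setIntegral_transferOp hf.abs MeasurableSet.univ
  rw [preimage_univ, inter_univ] at h1
  rw [← h1]
  exact integral_mono (hT.integrableOn_transferOp hf).abs (hT.integrableOn_transferOp hf.abs)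
    fun x => abs_transferOp_le T f (hT.finite_fibre x)

lemma integrable_transferOp (hT : IsPiecewiseExpanding T D) {f : ℝ → ℝ}
    (hf : Integrable f unitMeasure) : Integrable (transferOp T f) unitMeasure :=
  hT.integrableOn_transferOp hf

lemma isL1Contraction (hT : IsPiecewiseExpanding T D) : IsL1Contraction (transferOp T) where
  integrable _ hf := hT.integrable_transferOp hf
  add f g _ _ := hT.transferOp_add f g
  smul c f _ := hT.transferOp_smul c f
  norm_le _ hf := hT.integral_abs_transferOp_le hf

/-- The transfer operator on `L¹[0,1]`. -/
noncomputable def transferL1 (hT : IsPiecewiseExpanding T D) : UnitL1 →L[ℝ] UnitL1 :=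
  hT.isL1Contraction.lift

lemma transferL1_toL1 (hT : IsPiecewiseExpanding T D) {f : ℝ → ℝ}
    (hf : Integrable f unitMeasure) :
    hT.transferL1 (hf.toL1 f) = (hT.integrable_transferOp hf).toL1 (transferOp T f) :=
  hT.isL1Contraction.lift_toL1 hf

lemma norm_transferL1_le (hT : IsPiecewiseExpanding T D) (x : UnitL1) : ‖hT.transferL1 x‖ ≤ ‖x‖ :=
  hT.isL1Contraction.norm_lift_le x

lemma setIntegral_transferL1 (hT : IsPiecewiseExpanding T D) (x : UnitL1) {A : Set ℝ} (hA : MeasurableSet A) :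
    ∫ t in Icc (0 : ℝ) 1 ∩ A, hT.transferL1 x t = ∫ t in Icc (0 : ℝ) 1 ∩ T ⁻¹' A, x t := by
  rw [← hT.setIntegral_transferOp (integrable_coeFn x) hA]
  refine integral_congr_ae ?_
  refine ae_mono (Measure.restrict_mono_set _ inter_subset_left) ?_
  have h := hT.transferL1_toL1 (integrable_coeFn x)
  rw [Integrable.toL1_coeFn] at h
  rw [h]
  exact Integrable.coeFn_toL1 _

lemma setIntegral_transferL1_pow (hT : IsPiecewiseExpanding T D) (n : ℕ) (x : UnitL1) {A : Set ℝ} (hA : MeasurableSet A) :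
    MeasurableSet (Icc (0 : ℝ) 1 ∩ T^[n] ⁻¹' A) ∧
    ∫ t in Icc (0 : ℝ) 1 ∩ A, (hT.transferL1 ^ n) x t =
      ∫ t in Icc (0 : ℝ) 1 ∩ T^[n] ⁻¹' A, x t := by
  induction n generalizing A with
  | zero => exact ⟨measurableSet_Icc.inter hA, by simp⟩
  | succ n ih =>
    have hset : Icc (0 : ℝ) 1 ∩ T^[n] ⁻¹' (Icc (0 : ℝ) 1 ∩ T ⁻¹' A) =
        Icc (0 : ℝ) 1 ∩ T^[n + 1] ⁻¹' A := by
      ext t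
      simp only [mem_inter_iff, mem_preimage, Function.iterate_succ_apply']
      exact ⟨fun h => ⟨h.1, h.2.2⟩, fun h => ⟨h.1, hT.mapsTo.iterate n h.1, h.2⟩⟩
    have h := ih (hT.measurableSet_preimage hA)
    rw [hset, ← inter_assoc, inter_self] at h
    refine ⟨h.1, ?_⟩
    rw [pow_succ', mul_apply_eq_comp, hT.setIntegral_transferL1 _ hA, h.2]

lemma mean_transferL1 (hT : IsPiecewiseExpanding T D) (x : UnitL1) : mean (hT.transferL1 x) = mean x := by
  have := hT.setIntegral_transferL1 x MeasurableSet.univ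
  rwa [preimage_univ, inter_univ, ← mean_eq, ← mean_eq] at this

lemma transferL1_nonneg (hT : IsPiecewiseExpanding T D) {x : UnitL1} (hx : 0 ≤ x) : 0 ≤ hT.transferL1 x := by
  rw [← Lp.coeFn_nonneg]
  refine ae_nonneg_of_forall_setIntegral_nonneg (integrable_coeFn _) fun A hA _ => ?_
  rw [Measure.restrict_restrict hA, inter_comm, hT.setIntegral_transferL1 x hA]
  rw [← Lp.coeFn_nonneg] at hx
  refine integral_nonneg_of_ae ?_
  exact ae_mono (Measure.restrict_mono_set _ inter_subset_left) hx

end IsPiecewiseExpanding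

lemma cellAverage_add (k : ℕ) {f g : ℝ → ℝ} (hf : Integrable f unitMeasure)
    (hg : Integrable g unitMeasure) :
    cellAverage k (f + g) = cellAverage k f + cellAverage k g := by
  ext x
  rw [Pi.add_apply, cellAverage, cellAverage, cellAverage, ← stepFun_add]
  congr 1
  ext i
  exact integral_add (hf.mono_measure (Measure.restrict_mono_set _ (cell_subset_Icc i)))
    (hg.mono_measure (Measure.restrict_mono_set _ (cell_subset_Icc i)))

lemma cellAverage_smul (k : ℕ) (c : ℝ) (f : ℝ → ℝ) :
    cellAverage k (c • f) = c • cellAverage k f := by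
  ext x
  rw [Pi.smul_apply, cellAverage, cellAverage, smul_eq_mul, ← stepFun_smul]
  congr 1
  ext i
  exact integral_const_mul c f

lemma integrable_stepFun_unit (k : ℕ) (w : Fin k → ℝ) : Integrable (stepFun k w) unitMeasure :=
  (integrable_stepFun k w).integrableOn

lemma integrable_cellAverage (k : ℕ) (f : ℝ → ℝ) : Integrable (cellAverage k f) unitMeasure :=
  integrable_stepFun_unit k _

lemma isL1Contraction_cellAverage {k : ℕ} (hk : 0 < k) : IsL1Contraction (cellAverage k) where
  integrable f _ := integrable_cellAverage k f
  add _ _ hf hg := by rw [cellAverage_add k hf hg]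
  smul c f _ := by rw [cellAverage_smul]
  norm_le _ hf := integral_abs_cellAverage_le hk hf

/-- The conditional expectation on the partition into `k` intervals, as an operator on `L¹[0,1]`. -/
noncomputable def cellL1 {k : ℕ} (hk : 0 < k) : UnitL1 →L[ℝ] UnitL1 :=
  (isL1Contraction_cellAverage hk).lift

lemma cellL1_toL1 {k : ℕ} (hk : 0 < k) {f : ℝ → ℝ} (hf : Integrable f unitMeasure) :
    cellL1 hk (hf.toL1 f) = (integrable_cellAverage k f).toL1 (cellAverage k f) :=
  (isL1Contraction_cellAverage hk).lift_toL1 hf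

lemma norm_cellL1_le {k : ℕ} (hk : 0 < k) (x : UnitL1) : ‖cellL1 hk x‖ ≤ ‖x‖ :=
  (isL1Contraction_cellAverage hk).norm_lift_le x

lemma mean_cellL1 {k : ℕ} (hk : 0 < k) (x : UnitL1) : mean (cellL1 hk x) = mean x := by
  obtain ⟨f, hf, rfl⟩ := exists_eq_toL1 x
  rw [cellL1_toL1, mean_toL1, mean_toL1, cellAverage, integral_stepFun hk,
    setIntegral_Icc_eq_sum_cell hk hf]

/-- The element of `L¹[0,1]` defined by a step function. -/
noncomputable def stepL1 (k : ℕ) (w : Fin k → ℝ) : UnitL1 :=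
  (integrable_stepFun_unit k w).toL1 (stepFun k w)

lemma norm_stepL1 {k : ℕ} (hk : 0 < k) (w : Fin k → ℝ) : ‖stepL1 k w‖ = ∑ i, |w i| := by
  rw [stepL1, norm_toL1_eq, integral_abs_stepFun hk]

lemma mean_stepL1 {k : ℕ} (hk : 0 < k) (w : Fin k → ℝ) : mean (stepL1 k w) = ∑ i, w i := by
  rw [stepL1, mean_toL1, integral_stepFun hk]

lemma cellL1_stepL1 {k : ℕ} (hk : 0 < k) (w : Fin k → ℝ) : cellL1 hk (stepL1 k w) = stepL1 k w := by
  rw [stepL1, cellL1_toL1]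
  simp only [cellAverage_stepFun]

lemma exists_cellL1_eq {k : ℕ} (hk : 0 < k) (x : UnitL1) : ∃ w, cellL1 hk x = stepL1 k w := by
  obtain ⟨f, hf, rfl⟩ := exists_eq_toL1 x
  exact ⟨_, cellL1_toL1 hk hf⟩

/-! ### Variation on `L¹[0,1]` -/

/-- Some version of `x ∈ L¹[0,1]` has variation at most `V` on `(0,1)`. -/
def VarLe (x : UnitL1) (V : ℝ) : Prop :=
  0 ≤ V ∧ ∃ g : ℝ → ℝ, x =ᵐ[unitMeasure] g ∧ eVariationOn g (Ioo 0 1) ≤ ENNReal.ofReal V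

namespace VarLe

lemma exists_toL1 {x : UnitL1} {V : ℝ} (h : VarLe x V) : ∃ (g : ℝ → ℝ)
    (hg : Integrable g unitMeasure), x = hg.toL1 g ∧
      eVariationOn g (Ioo 0 1) ≤ ENNReal.ofReal V := by
  obtain ⟨_, g, hxg, hg⟩ := h
  have hi : Integrable g unitMeasure :=
    integrableOn_Icc_of_eVariationOn_Ioo (ne_top_of_le_ne_top ENNReal.ofReal_ne_top hg)
  refine ⟨g, hi, ?_, hg⟩
  rw [← Integrable.toL1_coeFn x (integrable_coeFn x), Integrable.toL1_eq_toL1_iff]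
  exact hxg

lemma of_toL1 {g : ℝ → ℝ} (hg : Integrable g unitMeasure) {V : ℝ} (hV : 0 ≤ V)
    (h : eVariationOn g (Ioo 0 1) ≤ ENNReal.ofReal V) : VarLe (hg.toL1 g) V :=
  ⟨hV, g, hg.coeFn_toL1, h⟩

lemma mono {x : UnitL1} {V W : ℝ} (h : VarLe x V) (hVW : V ≤ W) : VarLe x W :=
  ⟨h.1.trans hVW, h.2.imp fun _ hg => ⟨hg.1, hg.2.trans (ENNReal.ofReal_le_ofReal hVW)⟩⟩

lemma add {x y : UnitL1} {V W : ℝ} (hx : VarLe x V) (hy : VarLe y W) : VarLe (x + y) (V + W) := by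
  obtain ⟨hV, f, hf, hf'⟩ := hx
  obtain ⟨hW, g, hg, hg'⟩ := hy
  refine ⟨add_nonneg hV hW, fun t => f t + g t, ?_, ?_⟩
  · filter_upwards [hf, hg, Lp.coeFn_add x y] with t h1 h2 h3
    rw [h3, Pi.add_apply, h1, h2]
  · rw [ENNReal.ofReal_add hV hW]
    exact (eVariationOn_add_le f g _).trans (add_le_add hf' hg')

lemma neg {x : UnitL1} {V : ℝ} (hx : VarLe x V) : VarLe (-x) V := by
  obtain ⟨hV, f, hf, hf'⟩ := hx
  refine ⟨hV, fun t => -f t, ?_, le_trans (le_of_eq ?_) hf'⟩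
  · filter_upwards [hf, Lp.coeFn_neg x] with t h1 h2
    rw [h2, Pi.neg_apply, h1]
  · simp only [eVariationOn, edist_neg_neg]

lemma sub {x y : UnitL1} {V W : ℝ} (hx : VarLe x V) (hy : VarLe y W) : VarLe (x - y) (V + W) :=
  sub_eq_add_neg x y ▸ hx.add hy.neg

lemma cellL1 {x : UnitL1} {V : ℝ} (hx : VarLe x V) {k : ℕ} (hk : 0 < k) :
    VarLe (cellL1 hk x) V := by
  obtain ⟨g, hg, rfl, hV⟩ := hx.exists_toL1
  rw [cellL1_toL1]
  exact of_toL1 _ hx.1 ((eVariationOn_cellAverage_le hk g).trans hV)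

lemma norm_cellL1_sub_le {x : UnitL1} {V : ℝ} (hx : VarLe x V) {k : ℕ} (hk : 0 < k) :
    ‖UlamMethod.cellL1 hk x - x‖ ≤ 1 / k * V := by
  obtain ⟨g, hg, rfl, hV⟩ := hx.exists_toL1
  rw [cellL1_toL1, norm_toL1_sub_eq]
  exact integral_abs_cellAverage_sub_le hk hx.1 hV

lemma stepL1 {k : ℕ} (hk : 0 < k) (w : Fin k → ℝ) :
    VarLe (stepL1 k w) (2 * k * ∑ i, |w i|) :=
  of_toL1 _ (mul_nonneg (by positivity) (Finset.sum_nonneg fun _ _ => abs_nonneg _))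
    (eVariationOn_stepFun_le hk w)

end VarLe

/-- An operator satisfying a Lasota-Yorke inequality with contraction factor `α`. -/
def LasotaYorke (A : UnitL1 →L[ℝ] UnitL1) (α C : ℝ) : Prop :=
  ∀ x V, VarLe x V → VarLe (A x) (α * V + C * ‖x‖)

lemma IsPiecewiseExpanding.exists_lasotaYorke {T : ℝ → ℝ} {D : Finset ℝ}
    (hT : IsPiecewiseExpanding T D) :
    ∃ α C : ℝ, 0 < α ∧ α < 1 ∧ 0 ≤ C ∧ LasotaYorke hT.transferL1 α C := by
  obtain ⟨α, C, h0, h1, hC, h⟩ := hT.exists_eVariationOn_transferOp_le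
  refine ⟨α, C, h0, h1, hC, fun x V hx => ?_⟩
  obtain ⟨g, hg, rfl, hV⟩ := hx.exists_toL1
  obtain ⟨u, hu, hu'⟩ := h g hg
  have h2 : 0 ≤ α * V := mul_nonneg h0.le hx.1
  have h3 : 0 ≤ C * ‖hg.toL1 g‖ := by positivity
  refine ⟨by positivity, u, ?_, ?_⟩
  · rw [hT.transferL1_toL1]
    exact (Integrable.coeFn_toL1 _).trans hu
  · rw [ENNReal.ofReal_add h2 h3, ENNReal.ofReal_mul h0.le, norm_toL1_eq]
    refine hu'.trans (add_le_add ?_ le_rfl)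
    gcongr

lemma norm_pow_apply_le {A : UnitL1 →L[ℝ] UnitL1} (hA : ∀ x, ‖A x‖ ≤ ‖x‖) (n : ℕ) (x : UnitL1) :
    ‖(A ^ n) x‖ ≤ ‖x‖ := by
  induction n with
  | zero => simp
  | succ n ih =>
    rw [pow_succ', mul_apply_eq_comp]
    exact (hA _).trans ih

lemma mean_pow_apply {A : UnitL1 →L[ℝ] UnitL1} (hA : ∀ x, mean (A x) = mean x) (n : ℕ)
    (x : UnitL1) : mean ((A ^ n) x) = mean x := by
  induction n with
  | zero => simp
  | succ n ih => rw [pow_succ', mul_apply_eq_comp, hA, ih]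

lemma LasotaYorke.pow {A : UnitL1 →L[ℝ] UnitL1} {α C : ℝ} (h : LasotaYorke A α C)
    (h1 : α < 1) (hC : 0 ≤ C) (hA : ∀ x, ‖A x‖ ≤ ‖x‖) (n : ℕ) {x : UnitL1} {V : ℝ}
    (hx : VarLe x V) : VarLe ((A ^ n) x) (α ^ n * V + C / (1 - α) * ‖x‖) := by
  have h2 : 0 < 1 - α := by linarith
  induction n with
  | zero =>
    refine VarLe.mono (V := V) (by simpa using hx) ?_
    have : 0 ≤ C / (1 - α) * ‖x‖ := by positivity
    simpa using this
  | succ n ih =>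
    rw [pow_succ', mul_apply_eq_comp]
    refine (h _ _ ih).mono ?_
    have h3 := norm_pow_apply_le hA n x
    calc α * (α ^ n * V + C / (1 - α) * ‖x‖) + C * ‖(A ^ n) x‖
        ≤ α * (α ^ n * V + C / (1 - α) * ‖x‖) + C * ‖x‖ := by gcongr
      _ = α ^ (n + 1) * V + C / (1 - α) * ‖x‖ := by field_simp; ring

lemma LasotaYorke.cellL1 {A : UnitL1 →L[ℝ] UnitL1} {α C : ℝ} (h : LasotaYorke A α C) (hC : 0 ≤ C)
    {k : ℕ} (hk : 0 < k) : LasotaYorke (cellL1 hk * A * cellL1 hk) α C := by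
  intro x V hx
  rw [mul_apply_eq_comp, mul_apply_eq_comp]
  refine ((h _ _ (hx.cellL1 hk)).cellL1 hk).mono ?_
  gcongr
  exact norm_cellL1_le hk x


/-! ### Loss of memory -/

lemma IsPiecewiseExpanding.continuousAt_iterate {T : ℝ → ℝ} {D : Finset ℝ}
    (hT : IsPiecewiseExpanding T D) {x : ℝ} (hx : x ∈ Icc (0 : ℝ) 1) (n : ℕ)
    (h : ∀ i < n, T^[i] x ∉ D) : ContinuousAt T^[n] x := by
  induction n with
  | zero => exact continuousAt_id
  | succ n ih =>
    rw [Function.iterate_succ']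
    refine ContinuousAt.comp ?_ (ih fun i hi => h i (by omega))
    exact (hT.hasDerivAt ⟨hT.mapsTo.iterate n hx, h n (by omega)⟩).continuousAt

lemma IsTopologicallyMixing.exists_measure_pos {T : ℝ → ℝ} {D : Finset ℝ}
    (hmix : IsTopologicallyMixing T D) (hT : IsPiecewiseExpanding T D) (k : ℕ) :
    ∃ m, ∀ i j : Fin k, 0 < volume (Icc 0 1 ∩ T^[m] ⁻¹' cell k j ∩ cell k i) := by
  classical
  set U : Fin k → Set ℝ := fun i => Ioo (((i : ℕ) : ℝ) / k) ((((i : ℕ) : ℝ) + 1) / k) with hU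
  have hUc : ∀ i, U i ⊆ cell k i := fun i => Ioo_subset_Ico_self
  have hUo : ∀ i, IsOpen (U i) := fun i => isOpen_Ioo
  have hUn : ∀ i, (U i ∩ Icc 0 1).Nonempty := by
    intro i
    have hk : (0 : ℝ) < k := natCast_pos_of_pos i.pos
    have hlt : ((i : ℕ) : ℝ) / k < (((i : ℕ) : ℝ) + 1) / k := by gcongr; linarith
    obtain ⟨x, hx⟩ := nonempty_Ioo.2 hlt
    exact ⟨x, hx, cell_subset_Icc i (hUc i hx)⟩
  choose n₀ hn₀ using fun i j : Fin k => hmix (U i) (U j) (hUo i) (hUo j) (hUn i) (hUn j)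
  refine ⟨Finset.univ.sup fun p : Fin k × Fin k => n₀ p.1 p.2, fun i j => ?_⟩
  set m := Finset.univ.sup fun p : Fin k × Fin k => n₀ p.1 p.2
  obtain ⟨x, ⟨hxU, hx01⟩, hxD, hxV⟩ := hn₀ i j m
    (Finset.le_sup (f := fun p : Fin k × Fin k => n₀ p.1 p.2) (Finset.mem_univ (i, j)))
  have h1 : T^[m] ⁻¹' U j ∈ 𝓝 x :=
    (hT.continuousAt_iterate hx01 m hxD).preimage_mem_nhds ((hUo j).mem_nhds hxV)
  have h2 : U i ∈ 𝓝 x := (hUo i).mem_nhds hxU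
  refine Measure.measure_pos_of_mem_nhds volume (x := x) (mem_of_superset (inter_mem h1 h2) ?_)
  rintro y ⟨hy1, hy2⟩
  exact ⟨⟨cell_subset_Icc i (hUc i hy2), hUc j hy1⟩, hUc i hy2⟩

/-- The uniform probability density on a cell. -/
noncomputable def cellDensity (k : ℕ) (i : Fin k) : UnitL1 := stepL1 k (Pi.single i 1)

lemma stepFun_single {k : ℕ} (i : Fin k) :
    stepFun k (Pi.single i 1) = (cell k i).indicator fun _ => (k : ℝ) := by
  ext x
  rw [stepFun, Finset.sum_eq_single i]
  · simp
  · intro j _ hj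
    simp [Pi.single_eq_of_ne hj]
  · simp

lemma coeFn_cellDensity {k : ℕ} (i : Fin k) :
    cellDensity k i =ᵐ[unitMeasure] (cell k i).indicator fun _ => (k : ℝ) := by
  rw [← stepFun_single]
  exact (integrable_stepFun_unit k _).coeFn_toL1

lemma cellDensity_nonneg {k : ℕ} (i : Fin k) : 0 ≤ cellDensity k i := by
  rw [← Lp.coeFn_nonneg]
  filter_upwards [coeFn_cellDensity i] with x hx
  rw [hx]
  exact indicator_nonneg (fun _ _ => Nat.cast_nonneg k) x

lemma mean_inf_cellDensity_pos {k : ℕ} {a : UnitL1} (ha : 0 ≤ a) (j : Fin k)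
    (h : 0 < ∫ t in Icc (0 : ℝ) 1 ∩ cell k j, a t) : 0 < mean (a ⊓ cellDensity k j) := by
  have h0 : 0 ≤ a ⊓ cellDensity k j := le_inf ha (cellDensity_nonneg j)
  rw [← norm_eq_mean h0]
  refine norm_pos_iff.2 fun hzero => h.ne' ?_
  have h1 := Lp.coeFn_inf a (cellDensity k j)
  rw [hzero] at h1
  refine integral_eq_zero_of_ae ?_
  have hm : MeasurableSet (Icc (0 : ℝ) 1 ∩ cell k j) :=
    measurableSet_Icc.inter (measurableSet_cell j)
  have h2 : ∀ᵐ t ∂unitMeasure, t ∈ cell k j → a t = 0 := by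
    filter_upwards [h1, Lp.coeFn_zero ℝ 1 unitMeasure, coeFn_cellDensity j,
      (Lp.coeFn_nonneg a).2 ha] with t ht1 ht2 ht3 ht4 ht
    rw [ht2, Pi.inf_apply, ht3, indicator_of_mem ht] at ht1
    have hk : (0 : ℝ) < k := natCast_pos_of_pos j.pos
    simp only [Pi.zero_apply] at ht1 ht4
    rcases min_choice (a t) (k : ℝ) with h' | h'
    · exact (h'.symm.trans ht1.symm)
    · exact absurd (h'.symm.trans ht1.symm) hk.ne'
  filter_upwards [ae_mono (Measure.restrict_mono_set _ inter_subset_left) h2,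
    ae_restrict_mem hm] with t ht htm using ht htm.2

lemma norm_sub_eq_mean (a b : UnitL1) : ‖a - b‖ = mean a + mean b - 2 * mean (a ⊓ b) := by
  rw [← smul_eq_mul, ← map_smul, ← map_add, ← map_sub, L1.norm_eq_integral_norm, mean_eq]
  refine integral_congr_ae ?_
  filter_upwards [Lp.coeFn_sub a b, Lp.coeFn_sub (a + b) ((2 : ℝ) • (a ⊓ b)), Lp.coeFn_add a b,
    Lp.coeFn_smul (2 : ℝ) (a ⊓ b), Lp.coeFn_inf a b] with t h1 h2 h3 h4 h5
  rw [h1, h2, Pi.sub_apply, Pi.sub_apply, h3, h4, Pi.smul_apply, h5, Pi.add_apply, Pi.inf_apply,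
    Real.norm_eq_abs, smul_eq_mul]
  rcases le_total (a t) (b t) with h | h
  · rw [abs_of_nonpos (by linarith), inf_of_le_left h]; ring
  · rw [abs_of_nonneg (by linarith), inf_of_le_right h]; ring

lemma mean_mono {a b : UnitL1} (h : a ≤ b) : mean a ≤ mean b := by
  rw [mean_eq, mean_eq]
  exact integral_mono_ae (integrable_coeFn a) (integrable_coeFn b) ((Lp.coeFn_le a b).2 h)

lemma smul_le_smul_unitL1 {c : ℝ} (hc : 0 ≤ c) {a b : UnitL1} (h : a ≤ b) : c • a ≤ c • b := by
  rw [← Lp.coeFn_le] at h ⊢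
  filter_upwards [h, Lp.coeFn_smul c a, Lp.coeFn_smul c b] with t h1 h2 h3
  rw [h2, h3, Pi.smul_apply, Pi.smul_apply, smul_eq_mul, smul_eq_mul]
  gcongr

lemma smul_inf_le_inf_smul {c : ℝ} (hc : 0 ≤ c) (a b : UnitL1) : c • (a ⊓ b) ≤ c • a ⊓ c • b :=
  le_inf (smul_le_smul_unitL1 hc inf_le_left) (smul_le_smul_unitL1 hc inf_le_right)

lemma VarLe.exists_smul_cellDensity_le {x : UnitL1} {V κ : ℝ} (hx : VarLe x V) (hx0 : 0 ≤ x)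
    {k : ℕ} (hk : 0 < k) (h : k * κ + 1 / k * V < mean x) :
    ∃ i, κ • cellDensity k i ≤ x := by
  obtain ⟨g, hg, rfl, hV⟩ := hx.exists_toL1
  rw [mean_toL1] at h
  obtain ⟨i, hi⟩ := exists_cell_le hk hx.1 hV h
  refine ⟨i, ?_⟩
  rw [← Lp.coeFn_le]
  rw [← Lp.coeFn_nonneg] at hx0
  have hc : ∀ᵐ t ∂unitMeasure, t ∈ cell k i → t ∈ cell k i ∩ Ioo 0 1 := by
    refine ae_restrict_of_ae ?_
    filter_upwards [cell_inter_ae_eq i] with t ht h'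
    exact (iff_of_eq ht).2 h'
  filter_upwards [hx0, Lp.coeFn_smul κ (cellDensity k i), coeFn_cellDensity i, hg.coeFn_toL1, hc]
    with t h1 h2 h3 h4 h5
  rw [h2, Pi.smul_apply, h3, smul_eq_mul]
  by_cases ht : t ∈ cell k i
  · rw [indicator_of_mem ht, h4, mul_comm]
    exact hi t (h5 ht)
  · rw [indicator_of_notMem ht, mul_zero]
    exact h1

lemma VarLe.exists_decomposition {x : UnitL1} {V : ℝ} (hx : VarLe x V) :
    ∃ p q : UnitL1, x = p - q ∧ 0 ≤ p ∧ 0 ≤ q ∧ VarLe p V ∧ VarLe q V ∧ ‖x‖ = mean p + mean q := by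
  obtain ⟨g, hg, rfl, hV⟩ := hx.exists_toL1
  have hlip : ∀ f : ℝ → ℝ, eVariationOn f (Ioo 0 1) ≤ ENNReal.ofReal V →
      eVariationOn (fun t => max (f t) 0) (Ioo 0 1) ≤ ENNReal.ofReal V := by
    intro f hf
    have h1 : LipschitzWith 1 fun a : ℝ => max a 0 := LipschitzWith.id.max_const 0
    have h2 := (h1.lipschitzOnWith (s := univ)).comp_eVariationOn_le (g := f) (s := Ioo 0 1)
      (mapsTo_univ _ _)
    rw [ENNReal.coe_one, one_mul] at h2
    exact h2.trans hf
  have hneg : eVariationOn (fun t => -g t) (Ioo 0 1) ≤ ENNReal.ofReal V := by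
    simpa only [eVariationOn, edist_neg_neg] using hV
  have hp : Integrable (fun t => max (g t) 0) unitMeasure := hg.pos_part
  have hq : Integrable (fun t => max (-g t) 0) unitMeasure := hg.neg_part
  refine ⟨hp.toL1 _, hq.toL1 _, ?_, ?_, ?_, VarLe.of_toL1 hp hx.1 (hlip _ hV),
    VarLe.of_toL1 hq hx.1 (hlip _ hneg), ?_⟩
  · rw [← Integrable.toL1_sub, Integrable.toL1_eq_toL1_iff]
    refine ae_of_all _ fun t => ?_
    simp only [Pi.sub_apply]
    rcases le_total (g t) 0 with h | h
    · rw [max_eq_right h, max_eq_left (by linarith)]; ring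
    · rw [max_eq_left h, max_eq_right (by linarith)]; ring
  · rw [← Lp.coeFn_nonneg]
    filter_upwards [hp.coeFn_toL1] with t ht
    rw [ht]; exact le_max_right _ _
  · rw [← Lp.coeFn_nonneg]
    filter_upwards [hq.coeFn_toL1] with t ht
    rw [ht]; exact le_max_right _ _
  · rw [mean_toL1, mean_toL1, norm_toL1_eq, ← integral_add hp hq]
    refine integral_congr_ae (ae_of_all _ fun t => ?_)
    simp only
    rcases le_total (g t) 0 with h | h
    · rw [max_eq_right h, max_eq_left (by linarith), abs_of_nonpos h]; ring
    · rw [max_eq_left h, max_eq_right (by linarith), abs_of_nonneg h]; ring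

namespace IsPiecewiseExpanding

variable {T : ℝ → ℝ} {D : Finset ℝ}

lemma transferL1_pow_nonneg (hT : IsPiecewiseExpanding T D) (n : ℕ) {x : UnitL1} (hx : 0 ≤ x) :
    0 ≤ (hT.transferL1 ^ n) x := by
  induction n with
  | zero => simpa using hx
  | succ n ih => rw [pow_succ', mul_apply_eq_comp]; exact hT.transferL1_nonneg ih

lemma transferL1_pow_mono (hT : IsPiecewiseExpanding T D) (n : ℕ) {x y : UnitL1} (h : x ≤ y) :
    (hT.transferL1 ^ n) x ≤ (hT.transferL1 ^ n) y := by
  rw [← sub_nonneg, ← map_sub]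
  exact hT.transferL1_pow_nonneg n (sub_nonneg.2 h)

lemma exists_overlap (hT : IsPiecewiseExpanding T D) (hmix : IsTopologicallyMixing T D) {k : ℕ}
    (hk : 0 < k) : ∃ (m : ℕ) (c : ℝ), 0 < c ∧ ∀ i j : Fin k,
      c ≤ mean ((hT.transferL1 ^ m) (cellDensity k i) ⊓ cellDensity k j) := by
  obtain ⟨m, hm⟩ := hmix.exists_measure_pos hT k
  have : Nonempty (Fin k) := ⟨⟨0, hk⟩⟩
  obtain ⟨p, hp⟩ := Finite.exists_min fun p : Fin k × Fin k =>
    mean ((hT.transferL1 ^ m) (cellDensity k p.1) ⊓ cellDensity k p.2)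
  refine ⟨m, _, ?_, fun i j => hp (i, j)⟩
  refine mean_inf_cellDensity_pos (hT.transferL1_pow_nonneg m (cellDensity_nonneg _)) _ ?_
  obtain ⟨hmeas, hint⟩ := hT.setIntegral_transferL1_pow m (cellDensity k p.1)
    (measurableSet_cell p.2)
  rw [hint, integral_congr_ae (ae_mono (Measure.restrict_mono_set _ inter_subset_left)
    (coeFn_cellDensity p.1)), setIntegral_indicator (measurableSet_cell _), setIntegral_const,
    smul_eq_mul]
  refine mul_pos ?_ (natCast_pos_of_pos hk)
  refine ENNReal.toReal_pos (hm p.1 p.2).ne' (ne_top_of_le_ne_top ?_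
    (measure_mono (inter_subset_right.trans (cell_subset_Icc p.1))))
  simp

lemma exists_norm_pow_le_sub (hT : IsPiecewiseExpanding T D) (hmix : IsTopologicallyMixing T D)
    {V R ε : ℝ} (hV : 0 ≤ V) (hR : 0 ≤ R) (hε : 0 < ε) :
    ∃ (m : ℕ) (κ : ℝ), 0 < κ ∧ ∀ x, VarLe x V → mean x = 0 → ‖x‖ ≤ R → ε ≤ ‖x‖ →
      ‖(hT.transferL1 ^ m) x‖ ≤ ‖x‖ - κ := by
  obtain ⟨α, C, hα0, hα1, hC, hLY⟩ := hT.exists_lasotaYorke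
  have hα2 : 0 < 1 - α := by linarith
  set W : ℝ := V + C / (1 - α) * R with hW
  have hVW : V ≤ W := by have : 0 ≤ C / (1 - α) * R := by positivity
                         linarith
  obtain ⟨k₀, hk₀⟩ := exists_nat_gt (W / (ε / 4))
  set k := k₀ + 1 with hkdef
  have hk : 0 < k := Nat.succ_pos _
  have hk' := natCast_pos_of_pos hk
  have hsmall : 1 / (k : ℝ) * W < ε / 4 := by
    rw [one_div_mul_eq_div, div_lt_iff₀ hk']
    rw [div_lt_iff₀ (by positivity)] at hk₀
    rw [hkdef]; push_cast
    nlinarith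
  obtain ⟨m, c, hc, hov⟩ := hT.exists_overlap hmix hk
  set κ : ℝ := ε / 4 / k with hκ
  have hκ0 : 0 < κ := by positivity
  have hkκ : k * κ = ε / 4 := by rw [hκ]; field_simp
  refine ⟨m, 2 * (κ * c), by positivity, fun x hx hx0 hxR hxε => ?_⟩
  obtain ⟨p, q, rfl, hp, hq, hpV, hqV, hnorm⟩ := hx.exists_decomposition
  rw [map_sub, sub_eq_zero] at hx0
  have hpm : ε / 2 ≤ mean p := by rw [hnorm] at hxε; linarith
  have hqR : ‖q‖ ≤ R := by
    rw [norm_eq_mean hq]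
    have := norm_nonneg p
    rw [norm_eq_mean hp] at this
    linarith
  obtain ⟨i, hi⟩ := (hpV.mono hVW).exists_smul_cellDensity_le hp hk (κ := κ) (by linarith)
  have hQ : VarLe ((hT.transferL1 ^ m) q) W := by
    refine (hLY.pow hα1 hC hT.norm_transferL1_le m hqV).mono ?_
    have h1 : α ^ m * V ≤ V := mul_le_of_le_one_left hV (pow_le_one₀ hα0.le hα1.le)
    have h2 : C / (1 - α) * ‖q‖ ≤ C / (1 - α) * R := by gcongr
    linarith
  have hQm : mean ((hT.transferL1 ^ m) q) = mean q := mean_pow_apply hT.mean_transferL1 m q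
  have hPm : mean ((hT.transferL1 ^ m) p) = mean p := mean_pow_apply hT.mean_transferL1 m p
  obtain ⟨j, hj⟩ := hQ.exists_smul_cellDensity_le (hT.transferL1_pow_nonneg m hq) hk (κ := κ)
    (by linarith)
  have hP : κ • (hT.transferL1 ^ m) (cellDensity k i) ≤ (hT.transferL1 ^ m) p := by
    rw [← map_smul]; exact hT.transferL1_pow_mono m hi
  have hinf : κ * c ≤ mean ((hT.transferL1 ^ m) p ⊓ (hT.transferL1 ^ m) q) := by
    calc κ * c ≤ κ * mean ((hT.transferL1 ^ m) (cellDensity k i) ⊓ cellDensity k j) := by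
          gcongr; exact hov i j
      _ = mean (κ • ((hT.transferL1 ^ m) (cellDensity k i) ⊓ cellDensity k j)) := by
          rw [map_smul, smul_eq_mul]
      _ ≤ _ := mean_mono ((smul_inf_le_inf_smul hκ0.le _ _).trans (inf_le_inf hP hj))
  rw [map_sub, norm_sub_eq_mean, hPm, hQm, hnorm]
  linarith

/-- Uniform loss of memory on sets of bounded variation. -/
theorem exists_norm_pow_le (hT : IsPiecewiseExpanding T D) (hmix : IsTopologicallyMixing T D)
    {V R ε : ℝ} (hV : 0 ≤ V) (hR : 0 ≤ R) (hε : 0 < ε) :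
    ∃ n : ℕ, ∀ x, VarLe x V → mean x = 0 → ‖x‖ ≤ R → ‖(hT.transferL1 ^ n) x‖ ≤ ε := by
  obtain ⟨α, C, hα0, hα1, hC, hLY⟩ := hT.exists_lasotaYorke
  have hα2 : 0 < 1 - α := by linarith
  set W : ℝ := V + C / (1 - α) * R with hW
  have hW0 : 0 ≤ W := by positivity
  obtain ⟨m, κ, hκ, h⟩ := hT.exists_norm_pow_le_sub hmix hW0 hR hε
  obtain ⟨j, hj⟩ := exists_nat_gt (R / κ)
  rw [div_lt_iff₀ hκ] at hj
  have key : ∀ j : ℕ, ∀ x, VarLe x V → mean x = 0 → ‖x‖ ≤ R →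
      ‖(hT.transferL1 ^ (m * j)) x‖ ≤ max ε (R - j * κ) := by
    intro j x hx hx0 hxR
    induction j with
    | zero => simpa using .inr hxR
    | succ j ih =>
      set y := (hT.transferL1 ^ (m * j)) x with hy
      have hstep : (hT.transferL1 ^ (m * (j + 1))) x = (hT.transferL1 ^ m) y := by
        rw [hy, ← mul_apply_eq_comp, ← pow_add, mul_add, mul_one, add_comm]
      have hyR : ‖y‖ ≤ R := (norm_pow_apply_le hT.norm_transferL1_le _ x).trans hxR
      have hyV : VarLe y W := by
        refine (hLY.pow hα1 hC hT.norm_transferL1_le (m * j) hx).mono ?_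
        have h1 : α ^ (m * j) * V ≤ V := mul_le_of_le_one_left hV (pow_le_one₀ hα0.le hα1.le)
        have h2 : C / (1 - α) * ‖x‖ ≤ C / (1 - α) * R := by gcongr
        linarith
      have hym : mean y = 0 := (mean_pow_apply hT.mean_transferL1 _ x).trans hx0
      rw [hstep]
      rcases le_or_gt ε ‖y‖ with hle | hlt
      · have h1 := h y hyV hym hyR hle
        rcases le_max_iff.1 ih with h2 | h2
        · exact le_max_of_le_left (by linarith)
        · refine le_max_of_le_right ?_
          rw [Nat.cast_succ]
          linarith
      · exact le_max_of_le_left ((norm_pow_apply_le hT.norm_transferL1_le m y).trans hlt.le)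
  refine ⟨m * j, fun x hx hx0 hxR => (key j x hx hx0 hxR).trans (max_le le_rfl ?_)⟩
  linarith

end IsPiecewiseExpanding


/-! ### The invariant density -/

lemma ae_mem_Ioo : ∀ᵐ t ∂unitMeasure, t ∈ Ioo (0 : ℝ) 1 := by
  have h : unitMeasure = volume.restrict (Ioo (0 : ℝ) 1) := Measure.restrict_congr_set Ioo_ae_eq_Icc.symm
  rw [h]
  exact ae_restrict_mem measurableSet_Ioo

lemma exists_boundedVariationOn_of_tendsto {u : ℕ → UnitL1} {φ : UnitL1} {W : ℝ}
    (hu : ∀ n, VarLe (u n) W) (h : Tendsto u atTop (𝓝 φ)) :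
    ∃ f : ℝ → ℝ, φ =ᵐ[unitMeasure] f ∧ BoundedVariationOn f (Icc 0 1) := by
  choose g hg hgV using fun n => (hu n).2
  obtain ⟨ns, -, hns⟩ := (tendstoInMeasure_of_tendsto_Lp h).exists_seq_tendsto_ae
  set E : Set ℝ := {t | t ∈ Ioo (0 : ℝ) 1 ∧ Tendsto (fun i => g (ns i) t) atTop (𝓝 (φ t))} with hE
  have hEae : ∀ᵐ t ∂unitMeasure, t ∈ E := by
    filter_upwards [ae_mem_Ioo, hns, ae_all_iff.2 hg] with t h1 h2 h3
    refine ⟨h1, ?_⟩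
    simpa only [h3] using h2
  have hvar : eVariationOn φ E ≤ ENNReal.ofReal W := by
    by_contra! hlt
    obtain ⟨i, hi⟩ := (eVariationOn.lowerSemicontinuous_aux (F := fun i => g (ns i)) (p := atTop)
      (fun t ht => ht.2) hlt).exists
    exact absurd ((eVariationOn.mono _ fun t ht => ht.1).trans (hgV (ns i))) (not_le.2 hi)
  obtain ⟨p, q, hp, hq, he⟩ := exists_monotone_sub_eqOn
    (ne_top_of_le_ne_top ENNReal.ofReal_ne_top hvar : BoundedVariationOn φ E)
  refine ⟨_, ?_, boundedVariationOn_Icc_monotone_sub hp hq 0 1⟩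
  filter_upwards [hEae] with t ht using he ht

lemma boundedVariationOn_polynomial (p : Polynomial ℝ) :
    BoundedVariationOn (fun x => p.eval x) (Icc 0 1) := by
  have h1 : ContDiff ℝ 1 fun x => p.eval x := by
    simpa using p.contDiff_aeval (𝕜 := ℝ) 1
  obtain ⟨K, hK⟩ := (h1.locallyLipschitz.locallyLipschitzOn (s := Icc (0 : ℝ) 1)).exists_lipschitzOnWith_of_compact
    isCompact_Icc
  exact hK.comp_boundedVariationOn (g := id) (mapsTo_id _) (BoundedVariationOn.id_Icc 0 1)

lemma exists_varLe_norm_sub_le {z : UnitL1} (hz : mean z = 0) {ε : ℝ} (hε : 0 < ε) :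
    ∃ b V, VarLe b V ∧ mean b = 0 ∧ ‖z - b‖ ≤ ε := by
  obtain ⟨g, hg, hgi⟩ := (integrable_coeFn z).exists_boundedContinuous_integral_sub_le
    (ε := ε / 4) (by positivity)
  obtain ⟨p, hp⟩ := exists_polynomial_near_of_continuousOn 0 1 g g.continuous.continuousOn (ε / 4)
    (by positivity)
  have hpi : ∀ q : Polynomial ℝ, Integrable (fun x => q.eval x) unitMeasure := fun q =>
    (q.continuous.continuousOn (s := Icc (0 : ℝ) 1)).integrableOn_Icc
  have h1 : ‖z - (hpi p).toL1 _‖ ≤ ε / 2 := by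
    have h2 : ‖z - hgi.toL1 _‖ ≤ ε / 4 := by
      rw [← Integrable.toL1_coeFn z (integrable_coeFn z), norm_toL1_sub_eq]
      exact hg
    have h3 : ‖hgi.toL1 _ - (hpi p).toL1 _‖ ≤ ε / 4 := by
      rw [norm_toL1_sub_eq, l1Dist]
      calc ∫ x in Icc (0 : ℝ) 1, |g x - p.eval x| ≤ ∫ x in Icc (0 : ℝ) 1, ε / 4 := by
            refine setIntegral_mono_on (hgi.sub (hpi p)).abs (integrableOn_const (by simp))
              measurableSet_Icc fun x hx => ?_
            rw [abs_sub_comm]; exact (hp x hx).le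
        _ = ε / 4 := by simp
    calc ‖z - (hpi p).toL1 _‖ ≤ ‖z - hgi.toL1 _‖ + ‖hgi.toL1 _ - (hpi p).toL1 _‖ :=
          norm_sub_le_norm_sub_add_norm_sub _ _ _
      _ ≤ ε / 2 := by linarith
  set c := ∫ x in Icc (0 : ℝ) 1, p.eval x with hc
  have hcε : |c| ≤ ε / 2 := by
    have h2 : c = mean ((hpi p).toL1 _ - z) := by rw [map_sub, hz, mean_toL1, sub_zero]
    have h3 : -c = mean (z - (hpi p).toL1 _) := by rw [map_sub, hz, mean_toL1, zero_sub]
    rw [abs_le']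
    rw [h3, h2]
    exact ⟨(mean_le_norm _).trans (by rwa [norm_sub_rev]), (mean_le_norm _).trans h1⟩
  set q := p - Polynomial.C c with hq
  have hV := (boundedVariationOn_polynomial q).mono Ioo_subset_Icc_self
  refine ⟨(hpi q).toL1 _, _, VarLe.of_toL1 _ ENNReal.toReal_nonneg
    (le_of_eq (ENNReal.ofReal_toReal hV).symm), ?_, ?_⟩
  · rw [mean_toL1]
    simp only [hq, Polynomial.eval_sub, Polynomial.eval_C]
    rw [integral_sub (hpi p) (integrableOn_const (by simp)), ← hc]
    simp
  · have h4 : ‖(hpi p).toL1 _ - (hpi q).toL1 _‖ ≤ ε / 2 := by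
      rw [norm_toL1_sub_eq, l1Dist]
      simpa [hq] using hcε
    calc ‖z - (hpi q).toL1 _‖ ≤ ‖z - (hpi p).toL1 _‖ + ‖(hpi p).toL1 _ - (hpi q).toL1 _‖ :=
          norm_sub_le_norm_sub_add_norm_sub _ _ _
      _ ≤ ε := by linarith

namespace IsPiecewiseExpanding

variable {T : ℝ → ℝ} {D : Finset ℝ}

lemma eq_zero_of_transferL1_eq (hT : IsPiecewiseExpanding T D) (hmix : IsTopologicallyMixing T D)
    {z : UnitL1} (hz : mean z = 0) (h : hT.transferL1 z = z) : z = 0 := by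
  rw [← norm_le_zero_iff]
  refine le_of_forall_pos_le_add fun ε hε => ?_
  obtain ⟨b, V, hb, hb0, hzb⟩ := exists_varLe_norm_sub_le hz (ε := ε / 2) (by positivity)
  obtain ⟨n, hn⟩ := hT.exists_norm_pow_le hmix (ε := ε / 2) hb.1 (norm_nonneg b) (by positivity)
  have hzn : (hT.transferL1 ^ n) z = z := by
    clear hn
    induction n with
    | zero => simp
    | succ n ih => rw [pow_succ, mul_apply_eq_comp, h, ih]
  calc ‖z‖ = ‖(hT.transferL1 ^ n) (z - b) + (hT.transferL1 ^ n) b‖ := by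
        rw [map_sub, sub_add_cancel, hzn]
    _ ≤ ‖z - b‖ + ‖(hT.transferL1 ^ n) b‖ :=
        (norm_add_le _ _).trans (add_le_add (norm_pow_apply_le hT.norm_transferL1_le n _) le_rfl)
    _ ≤ 0 + ε := by linarith [hn b hb hb0 le_rfl]

lemma exists_invariant (hT : IsPiecewiseExpanding T D) (hmix : IsTopologicallyMixing T D) :
    ∃ φ : UnitL1, hT.transferL1 φ = φ ∧ mean φ = 1 ∧ 0 ≤ φ ∧
      ∃ f : ℝ → ℝ, φ =ᵐ[unitMeasure] f ∧ BoundedVariationOn f (Icc 0 1) := by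
  obtain ⟨α, C, hα0, hα1, hC, hLY⟩ := hT.exists_lasotaYorke
  have hα2 : 0 < 1 - α := by linarith
  set u₀ : UnitL1 := cellDensity 1 0 with hu₀
  set u : ℕ → UnitL1 := fun n => (hT.transferL1 ^ n) u₀ with hu
  have h0 : 0 ≤ u₀ := cellDensity_nonneg 0
  have hm0 : mean u₀ = 1 := by
    rw [hu₀, cellDensity, mean_stepL1 one_pos]; simp
  have hm : ∀ n, mean (u n) = 1 := fun n => (mean_pow_apply hT.mean_transferL1 n u₀).trans hm0
  have hpos : ∀ n, 0 ≤ u n := fun n => hT.transferL1_pow_nonneg n h0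
  have hn1 : ∀ n, ‖u n‖ = 1 := fun n => by rw [norm_eq_mean (hpos n), hm]
  have hn0 : ‖u₀‖ = 1 := hn1 0
  have hV0 : VarLe u₀ 2 := by
    refine (VarLe.stepL1 one_pos _).mono ?_
    simp
  set W : ℝ := 2 + C / (1 - α) with hW
  have hW0 : 0 ≤ W := by positivity
  have hVar : ∀ n, VarLe (u n) W := fun n => by
    refine (hLY.pow hα1 hC hT.norm_transferL1_le n hV0).mono ?_
    rw [hn0, mul_one]
    have : α ^ n ≤ 1 := pow_le_one₀ hα0.le hα1.le
    linarith
  have hcauchy : CauchySeq u := by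
    rw [Metric.cauchySeq_iff]
    intro ε hε
    obtain ⟨n, hn⟩ := hT.exists_norm_pow_le hmix (V := W + W) (R := 2) (ε := ε / 2)
      (by positivity) (by norm_num) (by positivity)
    refine ⟨n, fun a ha b hb => ?_⟩
    obtain ⟨a, rfl⟩ := Nat.exists_eq_add_of_le ha
    obtain ⟨b, rfl⟩ := Nat.exists_eq_add_of_le hb
    have hsplit : ∀ c, u (n + c) = (hT.transferL1 ^ n) (u c) := fun c => by
      rw [hu]; simp only; rw [pow_add, mul_apply_eq_comp]
    rw [dist_eq_norm, hsplit, hsplit, ← map_sub]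
    refine (hn _ ((hVar a).sub (hVar b)) (by rw [map_sub, hm, hm, sub_self]) ?_).trans_lt
      (by linarith)
    calc ‖u a - u b‖ ≤ ‖u a‖ + ‖u b‖ := norm_sub_le _ _
      _ = 2 := by rw [hn1, hn1]; norm_num
  obtain ⟨φ, hφ⟩ := cauchySeq_tendsto_of_complete hcauchy
  refine ⟨φ, ?_, ?_, ge_of_tendsto' hφ hpos, exists_boundedVariationOn_of_tendsto hVar hφ⟩
  · refine tendsto_nhds_unique ((hT.transferL1.continuous.tendsto φ).comp hφ) ?_
    refine (hφ.comp (tendsto_add_atTop_nat 1)).congr fun n => ?_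
    simp only [hu, Function.comp]
    rw [pow_succ', mul_apply_eq_comp]
  · refine tendsto_nhds_unique ((mean.continuous.tendsto φ).comp hφ) ?_
    exact tendsto_const_nhds.congr fun n => (hm n).symm

lemma transferOp_ae_eq_of_isInvariantDensity (hT : IsPiecewiseExpanding T D) {g : ℝ → ℝ}
    (hg : IsInvariantDensity T g) : transferOp T g =ᵐ[unitMeasure] g := by
  have hgi : Integrable g unitMeasure := hg.integrableOn
  refine Integrable.ae_eq_of_forall_setIntegral_eq _ _ (hT.integrable_transferOp hgi) hgi
    fun A hA _ => ?_
  rw [Measure.restrict_restrict hA, inter_comm, hT.setIntegral_transferOp hgi hA, hg.invariant A hA]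

/-- Existence and uniqueness of the absolutely continuous invariant probability measure. -/
theorem exists_unique_density (hT : IsPiecewiseExpanding T D) (hmix : IsTopologicallyMixing T D) :
    ∃ f : ℝ → ℝ, IsInvariantDensity T f ∧ BoundedVariationOn f (Icc 0 1) ∧
      transferOp T f =ᵐ[unitMeasure] f ∧
      ∀ g : ℝ → ℝ, IsInvariantDensity T g → g =ᵐ[unitMeasure] f := by
  obtain ⟨φ, hφL, hφm, hφ0, f, hφf, hf⟩ := hT.exists_invariant hmix
  have hfi : Integrable f unitMeasure := (integrable_coeFn φ).congr hφf
  have hφe : φ = hfi.toL1 f := by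
    rw [← Integrable.toL1_coeFn φ (integrable_coeFn φ), Integrable.toL1_eq_toL1_iff]
    exact hφf
  have hLf : transferOp T f =ᵐ[unitMeasure] f := by
    rwa [hφe, hT.transferL1_toL1, Integrable.toL1_eq_toL1_iff] at hφL
  refine ⟨f, ⟨hfi, ?_, ?_, fun A hA => ?_⟩, hf, hLf, fun g hg => ?_⟩
  · filter_upwards [hφf, (Lp.coeFn_nonneg φ).2 hφ0] with t h1 h2
    rw [← h1]; exact h2
  · rw [← mean_toL1 hfi, ← hφe, hφm]
  · rw [← hT.setIntegral_transferOp hfi hA]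
    exact integral_congr_ae (ae_mono (Measure.restrict_mono_set _ inter_subset_left) hLf)
  · have hgi : Integrable g unitMeasure := hg.integrableOn
    have hz : hgi.toL1 g - φ = 0 := by
      refine hT.eq_zero_of_transferL1_eq hmix ?_ ?_
      · rw [map_sub, hφm, mean_toL1, hg.integral_eq_one, sub_self]
      · rw [map_sub, hφL, hT.transferL1_toL1]
        congr 1
        rw [Integrable.toL1_eq_toL1_iff]
        exact hT.transferOp_ae_eq_of_isInvariantDensity hg
    rwa [sub_eq_zero, hφe, Integrable.toL1_eq_toL1_iff] at hz

end IsPiecewiseExpanding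


/-! ### The norm on zero-sum vectors -/

section NormOnV

variable {k : ℕ}

lemma sum_abs_vecMul_le (M : Matrix (Fin k) (Fin k) ℝ) {c : ℝ} (hM : ∀ i, ∑ j, |M i j| ≤ c)
    (v : Fin k → ℝ) : ∑ j, |Matrix.vecMul v M j| ≤ c * ∑ i, |v i| := by
  calc ∑ j, |Matrix.vecMul v M j| ≤ ∑ j, ∑ i, |v i| * |M i j| := by
        refine Finset.sum_le_sum fun j _ => ?_
        rw [Matrix.vecMul, dotProduct]
        refine (Finset.abs_sum_le_sum_abs _ _).trans (le_of_eq ?_)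
        simp_rw [abs_mul]
    _ = ∑ i, |v i| * ∑ j, |M i j| := by
        rw [Finset.sum_comm]
        simp_rw [Finset.mul_sum]
    _ ≤ ∑ i, |v i| * c := by gcongr with i; exact hM i
    _ = _ := by rw [← Finset.sum_mul, mul_comm]

lemma normOnV_nonneg (M : Matrix (Fin k) (Fin k) ℝ) : 0 ≤ normOnV M :=
  Real.sSup_nonneg (by rintro r ⟨v, _, _, rfl⟩; exact Finset.sum_nonneg fun _ _ => abs_nonneg _)

lemma normOnV_le {M : Matrix (Fin k) (Fin k) ℝ} {c : ℝ} (hc : 0 ≤ c)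
    (h : ∀ v : Fin k → ℝ, ∑ i, v i = 0 → ∑ i, |v i| = 1 → ∑ i, |Matrix.vecMul v M i| ≤ c) :
    normOnV M ≤ c :=
  Real.sSup_le (by rintro r ⟨v, h0, h1, rfl⟩; exact h v h0 h1) hc

lemma sum_abs_vecMul_le_normOnV (M : Matrix (Fin k) (Fin k) ℝ) {v : Fin k → ℝ}
    (hv : ∑ i, v i = 0) : ∑ i, |Matrix.vecMul v M i| ≤ normOnV M * ∑ i, |v i| := by
  set s := ∑ i, |v i| with hs
  have hs0 : 0 ≤ s := Finset.sum_nonneg fun _ _ => abs_nonneg _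
  rcases hs0.eq_or_lt with h | h
  · have hv0 : v = 0 := by
      ext i
      have := (Finset.sum_eq_zero_iff_of_nonneg fun i _ => abs_nonneg (v i)).1 (hs.symm.trans h.symm)
        i (Finset.mem_univ i)
      exact abs_eq_zero.1 this
    rw [← h, hv0]; simp
  · have hbdd : BddAbove {r : ℝ | ∃ v : Fin k → ℝ, ∑ i, v i = 0 ∧ ∑ i, |v i| = 1 ∧
        r = ∑ i, |Matrix.vecMul v M i|} := by
      refine ⟨∑ i, ∑ j, |M i j|, ?_⟩
      rintro r ⟨v, _, h1, rfl⟩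
      refine (sum_abs_vecMul_le M (fun i => ?_) v).trans (le_of_eq (by rw [h1, mul_one]))
      exact Finset.single_le_sum (f := fun i => ∑ j, |M i j|)
        (fun i _ => Finset.sum_nonneg fun _ _ => abs_nonneg _) (Finset.mem_univ i)
    have hle : ∑ i, |Matrix.vecMul (s⁻¹ • v) M i| ≤ normOnV M := by
      refine le_csSup hbdd ⟨s⁻¹ • v, ?_, ?_, rfl⟩
      · simp [← Finset.mul_sum, hv]
      · simp only [Pi.smul_apply, smul_eq_mul, abs_mul, abs_of_pos (inv_pos.2 h), ← Finset.mul_sum]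
        exact inv_mul_cancel₀ h.ne'
    rw [Matrix.smul_vecMul] at hle
    simp only [Pi.smul_apply, smul_eq_mul, abs_mul, abs_of_pos (inv_pos.2 h),
      ← Finset.mul_sum] at hle
    rwa [inv_mul_le_iff₀ h, mul_comm] at hle

lemma sum_vecMul {M : Matrix (Fin k) (Fin k) ℝ} (hM : ∀ i, ∑ j, M i j = 1) (v : Fin k → ℝ) :
    ∑ j, Matrix.vecMul v M j = ∑ i, v i := by
  simp only [Matrix.vecMul, dotProduct]
  rw [Finset.sum_comm]
  simp_rw [← Finset.mul_sum, hM, mul_one]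

lemma IsProbVec.sum_abs {v : Fin k → ℝ} (h : IsProbVec v) : ∑ i, |v i| = 1 := by
  rw [← h.2]
  exact Finset.sum_congr rfl fun i _ => abs_of_nonneg (h.1 i)

lemma vecMul_pow_succ (M : Matrix (Fin k) (Fin k) ℝ) (n : ℕ) (v : Fin k → ℝ) :
    Matrix.vecMul v (M ^ (n + 1)) = Matrix.vecMul (Matrix.vecMul v (M ^ n)) M := by
  rw [pow_succ, Matrix.vecMul_vecMul]

lemma vecMul_pow_eq_self {M : Matrix (Fin k) (Fin k) ℝ} {v : Fin k → ℝ}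
    (h : Matrix.vecMul v M = v) (n : ℕ) : Matrix.vecMul v (M ^ n) = v := by
  induction n with
  | zero => simp
  | succ n ih => rw [vecMul_pow_succ, ih, h]

lemma sum_vecMul_pow {M : Matrix (Fin k) (Fin k) ℝ} (hM : ∀ i, ∑ j, M i j = 1) (n : ℕ)
    (v : Fin k → ℝ) : ∑ j, Matrix.vecMul v (M ^ n) j = ∑ i, v i := by
  induction n with
  | zero => simp
  | succ n ih => rw [vecMul_pow_succ, sum_vecMul hM, ih]

lemma sum_abs_vecMul_pow_le {M : Matrix (Fin k) (Fin k) ℝ} (hM : ∀ i, IsProbVec (M i)) (n : ℕ)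
    (v : Fin k → ℝ) : ∑ j, |Matrix.vecMul v (M ^ n) j| ≤ ∑ i, |v i| := by
  induction n with
  | zero => simp
  | succ n ih =>
    rw [vecMul_pow_succ]
    refine (sum_abs_vecMul_le M (fun i => (hM i).sum_abs.le) _).trans ?_
    rwa [one_mul]

/-- Powers of nearby stochastic matrices are close. -/
lemma sum_abs_vecMul_pow_sub_le {M P : Matrix (Fin k) (Fin k) ℝ} (hM : ∀ i, IsProbVec (M i))
    (hP : ∀ i, IsProbVec (P i)) {η : ℝ} (h : ∀ i, ∑ j, |M i j - P i j| ≤ η) (n : ℕ)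
    (v : Fin k → ℝ) :
    ∑ j, |Matrix.vecMul v (M ^ n) j - Matrix.vecMul v (P ^ n) j| ≤ n * η * ∑ i, |v i| := by
  induction n with
  | zero => simp
  | succ n ih =>
    set a := Matrix.vecMul v (M ^ n) with ha
    set b := Matrix.vecMul v (P ^ n) with hb
    have hb1 : ∑ i, |b i| ≤ ∑ i, |v i| := sum_abs_vecMul_pow_le hP n v
    have hsplit : ∀ j, Matrix.vecMul v (M ^ (n + 1)) j - Matrix.vecMul v (P ^ (n + 1)) j =
        Matrix.vecMul (a - b) M j + Matrix.vecMul b (M - P) j := by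
      intro j
      rw [vecMul_pow_succ, vecMul_pow_succ, Matrix.sub_vecMul, Matrix.vecMul_sub]
      simp only [Pi.sub_apply]
      ring
    have h1 : ∑ j, |Matrix.vecMul (a - b) M j| ≤ n * η * ∑ i, |v i| :=
      (sum_abs_vecMul_le M (fun i => (hM i).sum_abs.le) _).trans (by rw [one_mul]; exact ih)
    have h2 : ∑ j, |Matrix.vecMul b (M - P) j| ≤ η * ∑ i, |b i| := sum_abs_vecMul_le _ h b
    have h3 : η * ∑ i, |b i| ≤ η * ∑ i, |v i| := by
      rcases isEmpty_or_nonempty (Fin k) with he | ⟨⟨i⟩⟩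
      · simp
      · have : 0 ≤ η := (Finset.sum_nonneg fun j _ => abs_nonneg (M i j - P i j)).trans (h i)
        gcongr
    calc _ ≤ ∑ j, (|Matrix.vecMul (a - b) M j| + |Matrix.vecMul b (M - P) j|) := by
          refine Finset.sum_le_sum fun j _ => ?_
          rw [hsplit]; exact abs_add_le _ _
      _ ≤ n * η * ∑ i, |v i| + η * ∑ i, |v i| := by
          rw [Finset.sum_add_distrib]; linarith
      _ = _ := by rw [Nat.cast_succ]; ring

lemma normOnV_pow_le_add {M P : Matrix (Fin k) (Fin k) ℝ} (hM : ∀ i, IsProbVec (M i))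
    (hP : ∀ i, IsProbVec (P i)) {η : ℝ} (hη : 0 ≤ η) (h : ∀ i, ∑ j, |M i j - P i j| ≤ η) (n : ℕ) :
    normOnV (M ^ n) ≤ normOnV (P ^ n) + n * η := by
  refine normOnV_le (add_nonneg (normOnV_nonneg _) (by positivity)) fun v hv0 hv1 => ?_
  have h1 := sum_abs_vecMul_pow_sub_le hM hP h n v
  have h2 := sum_abs_vecMul_le_normOnV (P ^ n) hv0
  rw [hv1, mul_one] at h1 h2
  calc ∑ i, |Matrix.vecMul v (M ^ n) i|
      ≤ ∑ i, (|Matrix.vecMul v (P ^ n) i| +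
          |Matrix.vecMul v (M ^ n) i - Matrix.vecMul v (P ^ n) i|) := by
        refine Finset.sum_le_sum fun i _ => ?_
        linarith [abs_sub_abs_le_abs_sub (Matrix.vecMul v (M ^ n) i) (Matrix.vecMul v (P ^ n) i)]
    _ ≤ _ := by rw [Finset.sum_add_distrib]; linarith

lemma normOnV_pow_add_le {P : Matrix (Fin k) (Fin k) ℝ} (hP : ∀ i, ∑ j, P i j = 1) (m n : ℕ) :
    normOnV (P ^ (m + n)) ≤ normOnV (P ^ m) * normOnV (P ^ n) := by
  refine normOnV_le (mul_nonneg (normOnV_nonneg _) (normOnV_nonneg _)) fun v hv0 hv1 => ?_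
  rw [pow_add, ← Matrix.vecMul_vecMul]
  have h1 := sum_abs_vecMul_le_normOnV (P ^ m) hv0
  have h2 := sum_abs_vecMul_le_normOnV (P ^ n) (v := Matrix.vecMul v (P ^ m))
    (by rw [sum_vecMul_pow hP, hv0])
  rw [hv1, mul_one] at h1
  calc _ ≤ _ := h2
    _ ≤ normOnV (P ^ n) * normOnV (P ^ m) := by gcongr; exact normOnV_nonneg _
    _ = _ := mul_comm _ _

/-- A stochastic matrix has a stationary probability vector. -/
lemma exists_isStationaryVec {P : Matrix (Fin k) (Fin k) ℝ} (hk : 0 < k)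
    (hP : ∀ i, IsProbVec (P i)) : ∃ v, IsStationaryVec P v := by
  have hsing : (P - 1).det = 0 := by
    rw [← Matrix.exists_mulVec_eq_zero_iff]
    refine ⟨fun _ => 1, fun h => ?_, ?_⟩
    · exact one_ne_zero (congrFun h ⟨0, hk⟩)
    · ext i
      rw [Matrix.sub_mulVec, Matrix.one_mulVec]
      simp [Matrix.mulVec, dotProduct, (hP i).2]
  obtain ⟨u, hu0, hu⟩ := Matrix.exists_vecMul_eq_zero_iff.2 hsing
  rw [Matrix.vecMul_sub, Matrix.vecMul_one, sub_eq_zero] at hu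
  set w : Fin k → ℝ := fun i => |u i| with hw
  have hle : ∀ j, w j ≤ Matrix.vecMul w P j := by
    intro j
    calc w j = |Matrix.vecMul u P j| := by rw [hu]
      _ = |∑ i, u i * P i j| := rfl
      _ ≤ ∑ i, |u i * P i j| := Finset.abs_sum_le_sum_abs _ _
      _ = Matrix.vecMul w P j := by
          refine Finset.sum_congr rfl fun i _ => ?_
          rw [abs_mul, abs_of_nonneg ((hP i).1 j)]
  have heq : ∀ j, Matrix.vecMul w P j = w j := by
    have h1 := sum_vecMul (fun i => (hP i).2) w
    intro j
    exact ((Finset.sum_eq_sum_iff_of_le fun j _ => hle j).1 h1.symm j (Finset.mem_univ j)).symm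
  have hpos : 0 < ∑ i, w i := by
    obtain ⟨i, hi⟩ := Function.ne_iff.1 hu0
    exact Finset.sum_pos' (fun i _ => abs_nonneg _) ⟨i, Finset.mem_univ i, abs_pos.2 hi⟩
  refine ⟨(∑ i, w i)⁻¹ • w, ⟨fun i => ?_, ?_⟩, ?_⟩
  · simp only [Pi.smul_apply, smul_eq_mul]
    exact mul_nonneg (inv_nonneg.2 hpos.le) (abs_nonneg _)
  · simp only [Pi.smul_apply, smul_eq_mul, ← Finset.mul_sum]
    exact inv_mul_cancel₀ hpos.ne'
  · rw [Matrix.smul_vecMul]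
    congr 1
    exact funext heq

lemma IsStationaryVec.eq {P : Matrix (Fin k) (Fin k) ℝ} {N : ℕ} (hN : normOnV (P ^ N) ≤ 1 / 2)
    {v w : Fin k → ℝ} (hv : IsStationaryVec P v) (hw : IsStationaryVec P w) : v = w := by
  have h0 : ∑ i, (v - w) i = 0 := by simp [hv.1.2, hw.1.2]
  have h1 := sum_abs_vecMul_le_normOnV (P ^ N) h0
  rw [Matrix.sub_vecMul, vecMul_pow_eq_self hv.2, vecMul_pow_eq_self hw.2] at h1
  have h2 : 0 ≤ ∑ i, |(v - w) i| := Finset.sum_nonneg fun _ _ => abs_nonneg _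
  have h3 : ∑ i, |(v - w) i| = 0 := by nlinarith
  ext i
  have := (Finset.sum_eq_zero_iff_of_nonneg fun i _ => abs_nonneg ((v - w) i)).1 h3 i
    (Finset.mem_univ i)
  exact sub_eq_zero.1 (abs_eq_zero.1 this)

end NormOnV

/-! ### The Ulam operator -/

namespace IsPiecewiseExpanding

variable {T : ℝ → ℝ} {D : Finset ℝ}

/-- The Ulam operator on `L¹[0,1]`. -/
noncomputable def ulamL1 (hT : IsPiecewiseExpanding T D) {k : ℕ} (hk : 0 < k) :
    UnitL1 →L[ℝ] UnitL1 := cellL1 hk * hT.transferL1 * cellL1 hk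

lemma ulamL1_apply (hT : IsPiecewiseExpanding T D) {k : ℕ} (hk : 0 < k) (x : UnitL1) :
    hT.ulamL1 hk x = cellL1 hk (hT.transferL1 (cellL1 hk x)) := rfl

lemma integrable_ulamOp (T : ℝ → ℝ) (k : ℕ) (f : ℝ → ℝ) : Integrable (ulamOp T k f) unitMeasure :=
  integrable_cellAverage k _

lemma ulamL1_toL1 (hT : IsPiecewiseExpanding T D) {k : ℕ} (hk : 0 < k) {f : ℝ → ℝ}
    (hf : Integrable f unitMeasure) :
    hT.ulamL1 hk (hf.toL1 f) = (integrable_ulamOp T k f).toL1 (ulamOp T k f) := by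
  rw [ulamL1_apply, cellL1_toL1, transferL1_toL1, cellL1_toL1]
  rfl

lemma norm_ulamL1_le (hT : IsPiecewiseExpanding T D) {k : ℕ} (hk : 0 < k) (x : UnitL1) :
    ‖hT.ulamL1 hk x‖ ≤ ‖x‖ :=
  (norm_cellL1_le hk _).trans ((hT.norm_transferL1_le _).trans (norm_cellL1_le hk x))

lemma setIntegral_transferOp_stepFun (hT : IsPiecewiseExpanding T D) {k : ℕ} (v : Fin k → ℝ)
    (j : Fin k) :
    ∫ x in cell k j, transferOp T (stepFun k v) x = Matrix.vecMul v (ulamMatrix T k) j := by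
  have hm : MeasurableSet (Icc (0 : ℝ) 1 ∩ T ⁻¹' cell k j) :=
    hT.measurableSet_preimage (measurableSet_cell j)
  have h1 := hT.setIntegral_transferOp (integrable_stepFun_unit k v) (measurableSet_cell j)
  rw [inter_eq_right.2 (cell_subset_Icc j)] at h1
  have hk' : (0 : ℝ) < k := natCast_pos_of_pos j.pos
  have hfin : ∀ i : Fin k, volume (cell k i) ≠ ⊤ := fun i =>
    ne_top_of_le_ne_top (by simp) (measure_mono (cell_subset_Icc i))
  rw [h1]
  simp only [stepFun]
  rw [integral_finsetSum]
  · refine Finset.sum_congr rfl fun i _ => ?_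
    change _ = v i * (volume.real (cell k i ∩ T ⁻¹' cell k j) / volume.real (cell k i))
    rw [setIntegral_indicator (measurableSet_cell i), setIntegral_const, smul_eq_mul,
      volume_real_cell]
    have : Icc (0 : ℝ) 1 ∩ T ⁻¹' cell k j ∩ cell k i = cell k i ∩ T ⁻¹' cell k j := by
      ext x
      constructor
      · rintro ⟨⟨_, h1⟩, h2⟩; exact ⟨h2, h1⟩
      · rintro ⟨h1, h2⟩; exact ⟨⟨cell_subset_Icc i h1, h2⟩, h1⟩
    rw [this]
    field_simp
  · intro i _
    exact ((integrable_indicator_iff (measurableSet_cell i)).2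
      (integrableOn_const (hfin i))).integrableOn

lemma ulamL1_stepL1 (hT : IsPiecewiseExpanding T D) {k : ℕ} (hk : 0 < k) (v : Fin k → ℝ) :
    hT.ulamL1 hk (stepL1 k v) = stepL1 k (Matrix.vecMul v (ulamMatrix T k)) := by
  rw [ulamL1_apply, cellL1_stepL1, stepL1, transferL1_toL1, cellL1_toL1, stepL1,
    Integrable.toL1_eq_toL1_iff]
  refine ae_of_all _ fun x => ?_
  rw [cellAverage]
  congr 1
  ext j
  exact hT.setIntegral_transferOp_stepFun v j

lemma ulamL1_pow_stepL1 (hT : IsPiecewiseExpanding T D) {k : ℕ} (hk : 0 < k) (n : ℕ)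
    (v : Fin k → ℝ) :
    (hT.ulamL1 hk ^ n) (stepL1 k v) = stepL1 k (Matrix.vecMul v (ulamMatrix T k ^ n)) := by
  induction n with
  | zero => simp
  | succ n ih => rw [pow_succ', mul_apply_eq_comp, ih, ulamL1_stepL1, vecMul_pow_succ]

lemma isProbVec_ulamMatrix (hT : IsPiecewiseExpanding T D) {k : ℕ} (i : Fin k) :
    IsProbVec (ulamMatrix T k i) := by
  refine ⟨fun j => div_nonneg measureReal_nonneg measureReal_nonneg, ?_⟩
  have h1 := mean_stepL1 i.pos (Pi.single i 1)
  have h2 := mean_stepL1 i.pos (Matrix.vecMul (Pi.single i 1) (ulamMatrix T k))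
  rw [← hT.ulamL1_stepL1 i.pos, ulamL1_apply, mean_cellL1, mean_transferL1, mean_cellL1, h1,
    Matrix.single_one_vecMul] at h2
  simpa using h2.symm

lemma norm_ulamL1_sub_le (hT : IsPiecewiseExpanding T D) {k : ℕ} (hk : 0 < k) {x : UnitL1}
    {V W : ℝ} (hx : VarLe x V) (hLx : VarLe (hT.transferL1 x) W) :
    ‖hT.ulamL1 hk x - hT.transferL1 x‖ ≤ 1 / k * (V + W) := by
  have h1 : hT.ulamL1 hk x - hT.transferL1 x =
      cellL1 hk (hT.transferL1 (cellL1 hk x - x)) +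
        (cellL1 hk (hT.transferL1 x) - hT.transferL1 x) := by
    rw [ulamL1_apply, map_sub, map_sub]; abel
  rw [h1, mul_add]
  refine (norm_add_le _ _).trans (add_le_add ?_ (hLx.norm_cellL1_sub_le hk))
  exact (norm_cellL1_le hk _).trans ((hT.norm_transferL1_le _).trans (hx.norm_cellL1_sub_le hk))

lemma norm_ulamL1_pow_sub_le (hT : IsPiecewiseExpanding T D) {k : ℕ} (hk : 0 < k) {x : UnitL1}
    {r : ℝ} (n : ℕ) (h : ∀ j, ‖hT.ulamL1 hk ((hT.transferL1 ^ j) x) -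
      hT.transferL1 ((hT.transferL1 ^ j) x)‖ ≤ r) :
    ‖(hT.ulamL1 hk ^ n) x - (hT.transferL1 ^ n) x‖ ≤ n * r := by
  induction n with
  | zero => simp
  | succ n ih =>
    have h1 : (hT.ulamL1 hk ^ (n + 1)) x - (hT.transferL1 ^ (n + 1)) x =
        hT.ulamL1 hk ((hT.ulamL1 hk ^ n) x - (hT.transferL1 ^ n) x) +
          (hT.ulamL1 hk ((hT.transferL1 ^ n) x) - hT.transferL1 ((hT.transferL1 ^ n) x)) := by
      rw [pow_succ', pow_succ', mul_apply_eq_comp, mul_apply_eq_comp, map_sub]; abel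
    rw [h1, Nat.cast_succ, add_mul, one_mul]
    exact (norm_add_le _ _).trans (add_le_add ((hT.norm_ulamL1_le hk _).trans ih) (h n))

/-- The contraction time of the Ulam matrices grows at most logarithmically. -/
theorem exists_contractionTimes_le (hT : IsPiecewiseExpanding T D)
    (hmix : IsTopologicallyMixing T D) :
    ∃ B : ℝ, 0 ≤ B ∧ ∀ᶠ k : ℕ in atTop, ∃ N ∈ contractionTimes T k, (N : ℝ) ≤ B * Real.log k := by
  obtain ⟨α, C, hα0, hα1, hC, hLY⟩ := hT.exists_lasotaYorke
  have hα2 : 0 < 1 - α := by linarith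
  set K : ℝ := C / (1 - α) with hK
  have hK0 : 0 ≤ K := by positivity
  set V : ℝ := 1 + K with hV
  have hV0 : 0 ≤ V := by positivity
  set W : ℝ := V + K with hW
  obtain ⟨n, hn⟩ := hT.exists_norm_pow_le hmix (V := V) (R := 1) (ε := 1 / 4) hV0 zero_le_one
    (by norm_num)
  set ℓ : ℝ := Real.log α⁻¹ with hℓ
  have hℓ0 : 0 < ℓ := Real.log_pos (by rw [one_lt_inv₀ hα0]; exact hα1)
  have hlog : Tendsto (fun k : ℕ => Real.log k) atTop atTop :=
    Real.tendsto_log_atTop.comp tendsto_natCast_atTop_atTop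
  obtain ⟨k₁, hk₁⟩ := exists_nat_gt (n * (W + W) * 4)
  refine ⟨2 / ℓ + 1, by positivity, ?_⟩
  filter_upwards [eventually_ge_atTop (k₁ + 2), hlog.eventually_ge_atTop ((n : ℝ) + 2)] with k hk hkl
  have hk0 : 0 < k := by omega
  have hk' := natCast_pos_of_pos hk0
  have hkk : (k₁ : ℝ) ≤ k := by exact_mod_cast (by omega : k₁ ≤ k)
  have hk2 : (2 : ℝ) ≤ k := by exact_mod_cast (by omega : 2 ≤ k)
  set n₁ : ℕ := ⌈Real.log (2 * k) / ℓ⌉₊ with hn₁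
  have hpow : α ^ n₁ * (2 * k) ≤ 1 := by
    have h1 : Real.log (2 * k) ≤ n₁ * ℓ := by
      rw [← div_le_iff₀ hℓ0]; exact Nat.le_ceil _
    have h2 : 2 * (k : ℝ) ≤ α⁻¹ ^ n₁ := by
      rw [← Real.log_le_log_iff (by positivity) (by positivity), Real.log_pow]
      exact h1
    rw [inv_pow] at h2
    calc α ^ n₁ * (2 * k) ≤ α ^ n₁ * (α ^ n₁)⁻¹ := by gcongr
      _ = 1 := mul_inv_cancel₀ (by positivity)
  refine ⟨n₁ + n + 1, ⟨by omega, ?_⟩, ?_⟩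
  · refine normOnV_le (by norm_num) fun v hv0 hv1 => ?_
    rw [← norm_stepL1 hk0, ← hT.ulamL1_pow_stepL1 hk0]
    set x := stepL1 k v with hx
    have hx1 : ‖x‖ = 1 := by rw [hx, norm_stepL1 hk0, hv1]
    have hxm : mean x = 0 := by rw [hx, mean_stepL1 hk0, hv0]
    have hxV : VarLe x (2 * k) := (VarLe.stepL1 hk0 v).mono (by rw [hv1, mul_one])
    have hmean : ∀ z, mean (hT.ulamL1 hk0 z) = mean z := fun z => by
      rw [ulamL1_apply, mean_cellL1, mean_transferL1, mean_cellL1]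
    set y := (hT.ulamL1 hk0 ^ n₁) x with hy
    have hy1 : ‖y‖ ≤ 1 := (norm_pow_apply_le (hT.norm_ulamL1_le hk0) n₁ x).trans hx1.le
    have hym : mean y = 0 := (mean_pow_apply hmean n₁ x).trans hxm
    have hyV : VarLe y V := by
      refine ((hLY.cellL1 hC hk0).pow hα1 hC (hT.norm_ulamL1_le hk0) n₁ hxV).mono ?_
      rw [hx1, mul_one]
      linarith
    have hiter : ∀ j, VarLe ((hT.transferL1 ^ j) y) W := fun j => by
      refine (hLY.pow hα1 hC hT.norm_transferL1_le j hyV).mono ?_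
      have h1 : α ^ j * V ≤ V := mul_le_of_le_one_left hV0 (pow_le_one₀ hα0.le hα1.le)
      have h2 : C / (1 - α) * ‖y‖ ≤ K := mul_le_of_le_one_right hK0 hy1
      linarith
    have hdiff : ‖(hT.ulamL1 hk0 ^ n) y - (hT.transferL1 ^ n) y‖ ≤ n * (1 / k * (W + W)) :=
      hT.norm_ulamL1_pow_sub_le hk0 n fun j => hT.norm_ulamL1_sub_le hk0 (hiter j) (by
        have := hiter (j + 1)
        rwa [pow_succ', mul_apply_eq_comp] at this)
    have hsmall : n * (1 / (k : ℝ) * (W + W)) ≤ 1 / 4 := by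
      rw [show (n : ℝ) * (1 / k * (W + W)) = n * (W + W) / k by ring, div_le_iff₀ hk']
      linarith
    have hyn := hn y hyV hym hy1
    rw [show n₁ + n + 1 = 1 + (n + n₁) by ring, pow_add, mul_apply_eq_comp, pow_one, pow_add,
      mul_apply_eq_comp, ← hy]
    refine (hT.norm_ulamL1_le hk0 _).trans ?_
    calc ‖(hT.ulamL1 hk0 ^ n) y‖
        ≤ ‖(hT.ulamL1 hk0 ^ n) y - (hT.transferL1 ^ n) y‖ + ‖(hT.transferL1 ^ n) y‖ :=
          norm_le_norm_sub_add _ _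
      _ ≤ 1 / 2 := by linarith
  · have h1 : (n₁ : ℝ) ≤ Real.log (2 * k) / ℓ + 1 :=
      (Nat.ceil_lt_add_one (div_nonneg (Real.log_nonneg (by linarith)) hℓ0.le)).le
    have h2 : Real.log (2 * k) ≤ 2 * Real.log k := by
      rw [Real.log_mul (by norm_num) hk'.ne']
      have := Real.log_le_log (by norm_num) hk2
      linarith
    have h3 : Real.log (2 * k) / ℓ ≤ 2 / ℓ * Real.log k := by
      rw [div_mul_eq_mul_div]; gcongr
    push_cast
    linarith

end IsPiecewiseExpanding


/-! ### Error estimates -/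

lemma l1Dist_triangle {f g h : ℝ → ℝ} (hf : Integrable f unitMeasure)
    (hg : Integrable g unitMeasure) (hh : Integrable h unitMeasure) :
    l1Dist f h ≤ l1Dist f g + l1Dist g h := by
  rw [← norm_toL1_sub_eq hf hh, ← norm_toL1_sub_eq hf hg, ← norm_toL1_sub_eq hg hh]
  exact norm_sub_le_norm_sub_add_norm_sub _ _ _

lemma l1Dist_stepFun {k : ℕ} (hk : 0 < k) (v w : Fin k → ℝ) :
    l1Dist (stepFun k v) (stepFun k w) = ∑ i, |v i - w i| := by
  rw [← integral_abs_stepFun hk, l1Dist]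
  refine integral_congr_ae (ae_of_all _ fun x => ?_)
  have h := stepFun_add k (fun i => v i - w i) w x
  simp only [sub_add_cancel] at h
  simp only [h, add_sub_cancel_right]

namespace IsPiecewiseExpanding

variable {T : ℝ → ℝ} {D : Finset ℝ}

lemma l1Dist_ulamOp_le (hT : IsPiecewiseExpanding T D) {f : ℝ → ℝ}
    (hf : BoundedVariationOn f (Icc 0 1)) (hLf : transferOp T f =ᵐ[unitMeasure] f) {k : ℕ}
    (hk : 0 < k) : l1Dist (ulamOp T k f) (transferOp T f) ≤
      2 * (1 / (k : ℝ)) * (eVariationOn f (Icc 0 1)).toReal := by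
  have hV : eVariationOn f (Ioo 0 1) ≤ ENNReal.ofReal (eVariationOn f (Icc 0 1)).toReal := by
    rw [ENNReal.ofReal_toReal hf]
    exact eVariationOn.mono _ Ioo_subset_Icc_self
  have hfi : Integrable f unitMeasure :=
    integrableOn_Icc_of_eVariationOn_Ioo (hf.mono Ioo_subset_Icc_self)
  have hVar : VarLe (hfi.toL1 f) _ := VarLe.of_toL1 hfi ENNReal.toReal_nonneg hV
  have hinv : hT.transferL1 (hfi.toL1 f) = hfi.toL1 f := by
    rwa [transferL1_toL1, Integrable.toL1_eq_toL1_iff]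
  have h1 := hT.norm_ulamL1_sub_le hk hVar (hinv.symm ▸ hVar)
  rw [ulamL1_toL1, transferL1_toL1, norm_toL1_sub_eq] at h1
  exact h1.trans (le_of_eq (by ring))

lemma l1Dist_stepFun_le (hT : IsPiecewiseExpanding T D) {f : ℝ → ℝ}
    (hf : IsInvariantDensity T f) (hLf : transferOp T f =ᵐ[unitMeasure] f) {k : ℕ} (hk : 0 < k)
    {N : ℕ} (hN0 : 0 < N) (hN : normOnV (ulamMatrix T k ^ N) ≤ 1 / 2) {v : Fin k → ℝ}
    (hv : IsStationaryVec (ulamMatrix T k) v) :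
    l1Dist (stepFun k v) f ≤ 2 * N * l1Dist (ulamOp T k f) (transferOp T f) := by
  have hfi : Integrable f unitMeasure := hf.integrableOn
  set φ := hfi.toL1 f with hφ
  have hinv : hT.transferL1 φ = φ := by
    rwa [hφ, transferL1_toL1, Integrable.toL1_eq_toL1_iff]
  have hinvn : ∀ n, (hT.transferL1 ^ n) φ = φ := fun n => by
    induction n with
    | zero => simp
    | succ n ih => rw [pow_succ, mul_apply_eq_comp, hinv, ih]
  set r := l1Dist (ulamOp T k f) (transferOp T f) with hr
  have hrn : ‖hT.ulamL1 hk φ - hT.transferL1 φ‖ = r := by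
    rw [hφ, ulamL1_toL1, transferL1_toL1, norm_toL1_sub_eq]
  have hd : l1Dist (stepFun k v) f = ‖stepL1 k v - φ‖ := (norm_toL1_sub_eq _ _).symm
  have hstat : (hT.ulamL1 hk ^ N) (stepL1 k v) = stepL1 k v := by
    rw [ulamL1_pow_stepL1, vecMul_pow_eq_self hv.2]
  have hcell : ∀ z, hT.ulamL1 hk (cellL1 hk z) = hT.ulamL1 hk z := fun z => by
    obtain ⟨w, hw⟩ := exists_cellL1_eq hk z
    rw [ulamL1_apply, ulamL1_apply, hw, cellL1_stepL1]
  have hcontr : ∀ z : UnitL1, mean z = 0 → ‖(hT.ulamL1 hk ^ N) (cellL1 hk z)‖ ≤ 1 / 2 * ‖z‖ := by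
    intro z hz
    obtain ⟨w, hw⟩ := exists_cellL1_eq hk z
    have hw0 : ∑ i, w i = 0 := by rw [← mean_stepL1 hk, ← hw, mean_cellL1, hz]
    have hwn : ∑ i, |w i| ≤ ‖z‖ := by rw [← norm_stepL1 hk, ← hw]; exact norm_cellL1_le hk z
    have hw1 : 0 ≤ ∑ i, |w i| := Finset.sum_nonneg fun _ _ => abs_nonneg _
    rw [hw, ulamL1_pow_stepL1, norm_stepL1 hk]
    refine (sum_abs_vecMul_le_normOnV _ hw0).trans ?_
    gcongr
  have hzm : mean (stepL1 k v - φ) = 0 := by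
    rw [map_sub, mean_stepL1 hk, hv.1.2, hφ, mean_toL1, hf.integral_eq_one, sub_self]
  rw [hd]
  have hpowcell : (hT.ulamL1 hk ^ N) (stepL1 k v - φ) =
      (hT.ulamL1 hk ^ N) (cellL1 hk (stepL1 k v - φ)) := by
    obtain ⟨n, rfl⟩ := Nat.exists_eq_succ_of_ne_zero hN0.ne'
    rw [Nat.succ_eq_add_one, pow_succ, mul_apply_eq_comp, mul_apply_eq_comp, hcell]
  have h1 : ‖(hT.ulamL1 hk ^ N) φ - (hT.transferL1 ^ N) φ‖ ≤ N * r :=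
    hT.norm_ulamL1_pow_sub_le hk N fun j => by rw [hinvn, hrn]
  have h2 := hcontr _ hzm
  rw [← hpowcell] at h2
  have h3 : stepL1 k v - φ = (hT.ulamL1 hk ^ N) (stepL1 k v - φ) +
      ((hT.ulamL1 hk ^ N) φ - (hT.transferL1 ^ N) φ) := by
    rw [map_sub, hstat, hinvn]; abel
  have h4 := norm_add_le ((hT.ulamL1 hk ^ N) (stepL1 k v - φ))
    ((hT.ulamL1 hk ^ N) φ - (hT.transferL1 ^ N) φ)
  rw [← h3] at h4
  linarith

end IsPiecewiseExpanding

lemma tendsto_contractionTime {T : ℝ → ℝ} {B : ℝ}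
    (h : ∀ᶠ k : ℕ in atTop, (contractionTime T k : ℝ) ≤ B * Real.log k) :
    Tendsto (fun k : ℕ => 2 * (1 / (k : ℝ)) * (contractionTime T k : ℝ)) atTop (𝓝 0) := by
  have h1 : Tendsto (fun k : ℕ => Real.log (k : ℝ) / k) atTop (𝓝 0) :=
    (Real.isLittleO_log_id_atTop.tendsto_div_nhds_zero).comp tendsto_natCast_atTop_atTop
  have h2 : Tendsto (fun k : ℕ => 2 * B * (Real.log (k : ℝ) / k)) atTop (𝓝 0) := by
    simpa using h1.const_mul (2 * B)
  refine squeeze_zero' (Eventually.of_forall fun k => by positivity) ?_ h2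
  filter_upwards [h, eventually_gt_atTop 0] with k hk hk0
  have hk' := natCast_pos_of_pos hk0
  calc 2 * (1 / (k : ℝ)) * contractionTime T k ≤ 2 * (1 / (k : ℝ)) * (B * Real.log k) := by gcongr
    _ = 2 * B * (Real.log (k : ℝ) / k) := by ring

end UlamMethod

theorem mainTheorem2 (T : ℝ → ℝ) (D : Finset ℝ)
    (hT : IsPiecewiseExpanding T D) (hmix : IsTopologicallyMixing T D) :
    -- `N(δ)` exists for small `δ = 1 / k`, is `O(log (1/δ))`, and `2 δ N(δ) → 0`
    (∀ᶠ k : ℕ in atTop, (contractionTimes T k).Nonempty) ∧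
    (fun k : ℕ => (contractionTime T k : ℝ)) =O[atTop] (fun k : ℕ => Real.log (k : ℝ)) ∧
    Tendsto (fun k : ℕ => 2 * (1 / (k : ℝ)) * (contractionTime T k : ℝ)) atTop (𝓝 0) ∧
    -- there is a unique absolutely continuous invariant measure, with density `f` in `BV`
    ∃ f : ℝ → ℝ, IsInvariantDensity T f ∧ BoundedVariationOn f (Icc 0 1) ∧
      (∀ᵐ x ∂(volume.restrict (Icc (0 : ℝ) 1)), transferOp T f x = f x) ∧
      (∀ g : ℝ → ℝ, IsInvariantDensity T g → ∀ᵐ x ∂(volume.restrict (Icc (0 : ℝ) 1)), g x = f x) ∧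
      -- once `N` is found, the discretized system has a unique fixed point, with explicit error
      (∀ k : ℕ, 0 < k →
        l1Dist (ulamOp T k f) (transferOp T f) ≤
          2 * (1 / (k : ℝ)) * (eVariationOn f (Icc 0 1)).toReal) ∧
      (∀ k : ℕ, 0 < k → ∀ N ∈ contractionTimes T k,
        (∃! v : Fin k → ℝ, IsStationaryVec (ulamMatrix T k) v) ∧
        ∀ v : Fin k → ℝ, IsStationaryVec (ulamMatrix T k) v →
          l1Dist (stepFun k v) f ≤ 2 * N * l1Dist (ulamOp T k f) (transferOp T f)) ∧
      -- the fixed points converge to the invariant density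
      (∀ v : (k : ℕ) → Fin k → ℝ, (∀ᶠ k : ℕ in atTop, IsStationaryVec (ulamMatrix T k) (v k)) →
        Tendsto (fun k : ℕ => l1Dist (stepFun k (v k)) f) atTop (𝓝 0)) ∧
      -- the algorithm reaches every precision `ε`: on every fine enough partition, and with
      -- accurate enough intermediate computations, it stops and its output and error bound are
      -- within `ε`; here `B` is any a priori bound for the variation of `f`
      (∀ B : ℝ, (eVariationOn f (Icc 0 1)).toReal ≤ B → ∀ ε : ℝ, 0 < ε →
        ∃ k₀ : ℕ, ∀ k : ℕ, k₀ ≤ k → ∃ τ : ℝ, 0 < τ ∧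
          ∀ (η ε₁ ε₂ ΔL : ℝ) (M : Matrix (Fin k) (Fin k) ℝ) (v w : Fin k → ℝ),
            0 ≤ η → η ≤ τ → ε₁ ≤ τ → ε₂ ≤ τ →
            IsApproxMatrix T k η M →
            IsStationaryVec (ulamMatrix T k) v → ∑ i, |w i - v i| ≤ ε₁ →
            l1Dist (ulamOp T k f) (transferOp T f) ≤ ΔL + ε₂ →
            ΔL ≤ 2 * (1 / (k : ℝ)) * B + ε₂ →
              (stoppingTimes M η).Nonempty ∧
              l1Dist (stepFun k w) f ≤ errorBound ε₁ (stoppingTime M η) ΔL ε₂ ∧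
              errorBound ε₁ (stoppingTime M η) ΔL ε₂ ≤ ε) := by
  obtain ⟨C, hC, hCk⟩ := hT.exists_contractionTimes_le hmix
  have hne : ∀ᶠ k : ℕ in atTop, (contractionTimes T k).Nonempty :=
    hCk.mono fun k ⟨N, hN, _⟩ => ⟨N, hN⟩
  have hle : ∀ᶠ k : ℕ in atTop, (contractionTime T k : ℝ) ≤ C * Real.log k :=
    hCk.mono fun k ⟨N, hN, hNle⟩ => le_trans (by exact_mod_cast Nat.sInf_le hN) hNle
  have hlim := tendsto_contractionTime hle
  have hmem : ∀ k, (contractionTimes T k).Nonempty →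
      contractionTime T k ∈ contractionTimes T k := fun k h => Nat.sInf_mem h
  obtain ⟨f, hf, hfV, hLf, huniq⟩ := hT.exists_unique_density hmix
  have hr := fun (k : ℕ) (hk : 0 < k) => hT.l1Dist_ulamOp_le hfV hLf hk
  have herr : ∀ (k : ℕ), 0 < k → ∀ N ∈ contractionTimes T k, ∀ v : Fin k → ℝ,
      IsStationaryVec (ulamMatrix T k) v →
      l1Dist (stepFun k v) f ≤ 2 * N * l1Dist (ulamOp T k f) (transferOp T f) :=
    fun k hk N hN v hv => hT.l1Dist_stepFun_le hf hLf hk hN.1 hN.2 hv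
  have hdist : ∀ g h : ℝ → ℝ, 0 ≤ l1Dist g h := fun g h => integral_nonneg fun _ => abs_nonneg _
  refine ⟨hne, ?_, hlim, f, hf, hfV, hLf, huniq, hr, ?_, ?_, ?_⟩
  · refine Asymptotics.IsBigO.of_bound C ?_
    filter_upwards [hle, eventually_gt_atTop 0] with k hk hk0
    rw [Real.norm_of_nonneg (Nat.cast_nonneg _),
      Real.norm_of_nonneg (Real.log_nonneg (by exact_mod_cast hk0))]
    exact hk
  · intro k hk N hN
    obtain ⟨v, hv⟩ := exists_isStationaryVec hk fun i => hT.isProbVec_ulamMatrix i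
    exact ⟨⟨v, hv, fun w hw => IsStationaryVec.eq hN.2 hw hv⟩, herr k hk N hN⟩
  · intro v hv
    have h1 : Tendsto (fun k : ℕ => 2 * (eVariationOn f (Icc 0 1)).toReal *
        (2 * (1 / (k : ℝ)) * (contractionTime T k : ℝ))) atTop (𝓝 0) := by
      simpa using hlim.const_mul (2 * (eVariationOn f (Icc 0 1)).toReal)
    refine squeeze_zero' (Eventually.of_forall fun k => hdist _ _) ?_ h1
    filter_upwards [hv, hne, eventually_gt_atTop 0] with k hvk hk hk0
    calc l1Dist (stepFun k (v k)) f
        ≤ 2 * (contractionTime T k) * l1Dist (ulamOp T k f) (transferOp T f) :=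
          herr k hk0 _ (hmem k hk) _ hvk
      _ ≤ 2 * (contractionTime T k) *
            (2 * (1 / (k : ℝ)) * (eVariationOn f (Icc 0 1)).toReal) := by
          gcongr; exact hr k hk0
      _ = _ := by ring
  · intro B hB ε hε
    have hB0 : 0 ≤ B := ENNReal.toReal_nonneg.trans hB
    have h1 : Tendsto (fun k : ℕ => 4 * B * (2 * (1 / (k : ℝ)) * (contractionTime T k : ℝ)))
        atTop (𝓝 0) := by simpa using hlim.const_mul (4 * B)
    obtain ⟨k₀, hk₀⟩ := eventually_atTop.1
      ((hne.and (eventually_gt_atTop 0)).and (h1.eventually_le_const (half_pos hε)))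
    refine ⟨k₀, fun k hk => ?_⟩
    obtain ⟨⟨hkne, hk0⟩, hkε⟩ := hk₀ k hk
    obtain ⟨hN0, hN⟩ := hmem k hkne
    set N₀ := contractionTime T k with hN₀
    have hN0' : (0 : ℝ) < N₀ := by exact_mod_cast hN0
    refine ⟨min (1 / (32 * N₀)) (ε / (2 * (1 + 8 * N₀))), by positivity, ?_⟩
    intro η ε₁ ε₂ ΔL M v w hη0 hη hε₁ hε₂ hM hv hw hΔ hΔB
    have hη' : η * (32 * N₀) ≤ 1 := by
      rw [← le_div_iff₀ (by positivity)]; exact hη.trans (min_le_left _ _)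
    set τ := min (1 / (32 * (N₀ : ℝ))) (ε / (2 * (1 + 8 * N₀)))
    have hτ : τ * (2 * (1 + 8 * N₀)) ≤ ε := by
      rw [← le_div_iff₀ (by positivity)]; exact min_le_right _ _
    have hP : ∀ i : Fin k, IsProbVec (ulamMatrix T k i) := fun i => hT.isProbVec_ulamMatrix i
    have hterm : 2 * N₀ ∈ stoppingTimes M η := by
      refine ⟨by omega, ?_⟩
      have h2 := normOnV_pow_le_add hM.1 hP hη0 hM.2 (2 * N₀)
      have h3 := normOnV_pow_add_le (fun i => (hP i).2) N₀ N₀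
      rw [← two_mul] at h3
      have h4 := normOnV_nonneg (ulamMatrix T k ^ N₀)
      push_cast at h2 ⊢
      nlinarith
    have hsle : stoppingTime M η ≤ 2 * N₀ := Nat.sInf_le hterm
    obtain ⟨hs0, hs⟩ := Nat.sInf_mem (⟨_, hterm⟩ : (stoppingTimes M η).Nonempty)
    change 0 < stoppingTime M η at hs0
    change normOnV (M ^ stoppingTime M η) + stoppingTime M η * η < 1 / 2 at hs
    refine ⟨⟨_, hterm⟩, ?_, ?_⟩
    · have h2 : normOnV (ulamMatrix T k ^ stoppingTime M η) ≤ 1 / 2 := by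
        refine (normOnV_pow_le_add hP hM.1 hη0 (fun i => ?_) _).trans hs.le
        simp_rw [abs_sub_comm (ulamMatrix T k i _)]
        exact hM.2 i
      have h3 := herr k hk0 _ ⟨hs0, h2⟩ v hv
      have h4 := l1Dist_triangle (integrable_stepFun_unit k w) (integrable_stepFun_unit k v)
        (h := f) hf.integrableOn
      rw [l1Dist_stepFun hk0] at h4
      have h5 : 2 * (stoppingTime M η : ℝ) * l1Dist (ulamOp T k f) (transferOp T f) ≤
          2 * stoppingTime M η * (ΔL + ε₂) := by gcongr
      rw [errorBound]
      linarith
    · have h2 : 0 ≤ ΔL + ε₂ := (hdist _ _).trans hΔ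
      have h3 : (stoppingTime M η : ℝ) ≤ 2 * N₀ := by exact_mod_cast hsle
      have h4 : 2 * (stoppingTime M η : ℝ) * (ΔL + ε₂) ≤ 2 * (2 * N₀) * (ΔL + ε₂) := by gcongr
      have h5 : 2 * (2 * (N₀ : ℝ)) * (ΔL + ε₂) ≤ 2 * (2 * N₀) * (2 * (1 / k) * B + 2 * τ) :=
        mul_le_mul_of_nonneg_left (by linarith) (by positivity)
      have h6 : 2 * (2 * (N₀ : ℝ)) * (2 * (1 / k) * B + 2 * τ) =
          4 * B * (2 * (1 / k) * N₀) + 8 * N₀ * τ := by ring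
      rw [errorBound]
      linarith
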